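/- Let $\mathcal M^0$ be the set of probability measures $\nu$ on $\mathbb R/2\pi\mathbb Z$ with $\int e^{ix}\,d\nu(x)=0$. For $\nu\in\mathcal M^0$ put $F_\nu(x)=\nu([0,x])$ for $0\le x<2\pi$ and $F_\nu(2\pi)=1$, $F_\nu^{-1}(y)=\inf\{x\ge 0: F_\nu(x)\ge y\}$ and $Z_\nu(t)=\int_0^t e^{iF_\nu^{-1}(u)}\,du$ for $t\in[0,1]$. Let $\mathcal C_\nu\subset\mathbb C$ be the compact convex set bounded by the closed curve $Z_\nu$, i.e. the convex hull of $Z_\nu([0,1])$. The perimeter of a compact convex set of the plane is the length of its boundary if it has non-empty interior, and twice its length if it is a segment. For $\theta\in[0,2\pi]$ let $\nu(\theta)$ be the distribution of $X+\theta \bmod 2\pi$, where $X$ has distribution $\nu$; let $\overleftarrow{\nu}$ be the distribution of $2\pi-X \bmod 2\pi$; and let $S(\nu(\theta))=\frac12\bigl(\nu(\theta)+\overleftarrow{\nu(\theta)}\bigr)$. Finally let $D$ be the closed disc with centre $\frac{i}{2\pi}$ and radius $\frac1{2\pi}$, and $d_H$ the Hausdorff distance. **Theorem.** 1) For all $\nu\in\mathcal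 M^0$ and $\theta\in[0,2\pi]$, the measure $S(\nu(\theta))$ is in $\mathcal M^0$, and $\mathcal C_{S(\nu(\theta))}$ has the same perimeter as $\mathcal C_\nu$, namely $1$. 2) For all $\nu\in\mathcal M^0$ and $\theta\in[0,2\pi]$, the area does not decrease: $\mathrm{area}(\mathcal C_{S(\nu(\theta))})\ge \mathrm{area}(\mathcal C_\nu)$. 3) For all $\nu\in\mathcal M^0$ and all integers $k\ge 0$ there are $\theta_1,\dots,\theta_k\in[0,2\pi]$ such that the measure $\nu_k$ defined by $\nu_0=\nu$ and $\nu_{j}=S(\nu_{j-1}(\theta_{j}))$ for $1\le j\le k$ satisfies $$d_H(\mathcal C_{\nu_k},D)\le 2^{-k}\pi .$$ 4) The disc $D$ has perimeter $1$, and every compact convex set $K$ of the plane with perimeter $1$ satisfies $\mathrm{area}(K)\le \mathrm{area}(D)$. -/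

import Mathlib

open MeasureTheory Set
open scoped ENNReal MeasureTheory

noncomputable section

namespace CCS

/-- The circle `ℝ / 2πℤ`. -/
abbrev Torus : Type := AddCircle (2 * Real.pi)

/-- On `ℝ / 2πℤ` the map `AddCircle.toCircle` is `x ↦ exp (i x)`. -/
theorem toCircle_coe (x : ℝ) :
    ((AddCircle.toCircle (x : Torus) : Circle) : ℂ) = Complex.exp (x * Complex.I) := by
  rw [AddCircle.toCircle_apply_mk, Circle.coe_exp]
  congr 3
  have := Real.pi_ne_zero
  field_simp

/-- The probability measures `μ` on the circle `ℝ / 2πℤ` such that `∫ exp (i x) dμ(x) = 0`. -/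
def M0 : Set (Measure Torus) :=
  {μ | IsProbabilityMeasure μ ∧ ∫ x, ((AddCircle.toCircle x : Circle) : ℂ) ∂μ = 0}

/-- The distribution function `F_μ(x) = μ([0, x])`, where `[0, x]` is seen in `ℝ / 2πℤ`
(for `x ≥ 2π` this is the whole circle). -/
def cdf (μ : Measure Torus) (x : ℝ) : ℝ :=
  μ.real ((fun s : ℝ => (s : Torus)) '' Icc 0 x)

/-- The generalised inverse `F_μ⁻¹(y) = inf {x ≥ 0 : F_μ(x) ≥ y}`. -/
def quantile (μ : Measure Torus) (y : ℝ) : ℝ :=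
  sInf {x : ℝ | 0 ≤ x ∧ y ≤ cdf μ x}

/-- The curve `Z_μ(t) = ∫₀ᵗ exp (i F_μ⁻¹(u)) du`. -/
def curve (μ : Measure Torus) (t : ℝ) : ℂ :=
  ∫ u in (0 : ℝ)..t, Complex.exp ((quantile μ u : ℂ) * Complex.I)

/-- The range of `Z_μ` on `[0, 1]`. -/
def boundaryCurve (μ : Measure Torus) : Set ℂ := curve μ '' Icc 0 1

/-- The convex set bounded by the closed curve `Z_μ` (a compact convex set is the convex hull of
its boundary, a segment being its own boundary). -/
def region (μ : Measure Torus) : Set ℂ := convexHull ℝ (boundaryCurve μ)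

/-- The perimeter of a compact convex set of the plane: the length of its boundary if it has
interior points, and twice its length if it is a segment (possibly reduced to a point). The length
of a set is its one-dimensional Hausdorff measure. -/
def perimeter (K : Set ℂ) : ℝ≥0∞ :=
  open scoped Classical in
  if (interior K).Nonempty then μH[1] (frontier K) else 2 * μH[1] K

/-- The measure `ν(θ)`: the distribution of `X + θ mod 2π` for `X` of distribution `ν`. -/
def rotate (θ : ℝ) (ν : Measure Torus) : Measure Torus :=
  ν.map (fun x => x + (θ : Torus))

/-- The reflected measure: the distribution of `2π - X mod 2π` for `X` of distribution `ν`. -/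
def reflect (ν : Measure Torus) : Measure Torus :=
  ν.map (fun x => ((2 * Real.pi : ℝ) : Torus) - x)

/-- `S(ν) = (ν + reflected ν) / 2`. -/
def symm (ν : Measure Torus) : Measure Torus :=
  (2 : ℝ≥0∞)⁻¹ • (ν + reflect ν)

/-- The measures `ν₀ = ν` and `νₖ₊₁ = S(νₖ(θₖ₊₁))`. -/
def symmIter (ν : Measure Torus) (θ : ℕ → ℝ) : ℕ → Measure Torus
  | 0 => ν
  | k + 1 => symm (rotate (θ (k + 1)) (symmIter ν θ k))

/-- The full closed disc with centre `i / (2π)` and radius `1 / (2π)`. -/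
def unitPerimeterDisc : Set ℂ :=
  Metric.closedBall (Complex.I / (2 * (Real.pi : ℂ))) (1 / (2 * Real.pi))

end CCS

end

noncomputable section

namespace CCS

open Filter Topology
open scoped Pointwise

/-! Everything passes through the tangent angle. Extended to the line with gain `2π` per period, the
quantile function is a nondecreasing `q`, and the closed curve has tangent angle `q` with respect to
arc length. An angle that never decreases and turns once keeps the curve to the left of each of its
tangent lines. So when the hull has interior points the curve is its boundary, traversed
injectively, and the perimeter is the arc length `1`. Otherwise the curve runs along a segment of
length `1/2` and back (`IsTurning.perimeter_body`).

For the area, Green's formula (`IsTurning.volume_body`) and the closing of the curve give the double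
integral of `areaKernel |q t - q s|`. Expanding the kernel in cosines with coefficients `c n` turns
it into the sum of `c n * ‖moment q n‖ ^ 2`, where the moments are the Fourier coefficients of the
measure. Here `c 0 = 1 / (4π)`, the moments of index `1` and `-1` vanish because the curve closes,
and all other `c n` are nonpositive. A rotation multiplies each Fourier coefficient by a phase and
the symmetrisation takes its real part, so no modulus grows and the area cannot decrease
(`norm_integral_fourier_symm_le`, `IsTurning.enclosedArea_le_of_moment_le`). Dropping all terms but
the zeroth gives the isoperimetric bound `IsTurning.enclosedArea_le`.

For the convergence, a first rotation moves all atoms away from the dyadic multiples of `π`; the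
next angles are `π/2`, `π/4`, and so on. Each of these steps halves the angle of rotational
invariance (`rotate_symm_rotate`). The dihedral symmetry forces the distribution function to take
the uniform values at the points `2πj/2^k`, `j ≥ 1` (`cdf_of_dihedral`). Hence the quantile function
and `u ↦ 2πu` share the same cells, their L¹ distance is at most `π/2^k`, and this distance bounds
the Hausdorff distance of the bodies (`hausdorffDist_body_le`).

For an arbitrary convex body, an inscribed polygon with vertices in equally spaced directions has a
step function as tangent angle, so the Fourier bound applies to it. Dyadic polygons increase to a
convex set whose closure contains the body. -/

/-- A tangent angle of a closed convex curve of length `1` parametrised by arc length: it is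
nondecreasing, makes one full turn over a period, and the curve closes up. -/
structure IsTurning (q : ℝ → ℝ) : Prop where
  mono : Monotone q
  add_one : ∀ u, q (u + 1) = q u + 2 * Real.pi
  closed : ∫ u in (0 : ℝ)..1, Complex.exp ((q u : ℂ) * Complex.I) = 0

/-- The arc-length parametrised curve with tangent angle `q`, starting at the origin. -/
def path (q : ℝ → ℝ) (t : ℝ) : ℂ := ∫ u in (0 : ℝ)..t, Complex.exp ((q u : ℂ) * Complex.I)

/-- The convex set bounded by the curve with tangent angle `q`. -/
def body (q : ℝ → ℝ) : Set ℂ := convexHull ℝ (range (path q))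

/-- The height of `path q t` over the line of angle `φ` through `path q s`. -/
def height (q : ℝ → ℝ) (φ s t : ℝ) : ℝ := ∫ u in s..t, Real.sin (q u - φ)

theorem intervalIntegrable_of_bound {E : Type*} [NormedAddCommGroup E] {f : ℝ → E}
    (hf : AEStronglyMeasurable f) (C : ℝ) (hC : ∀ x, ‖f x‖ ≤ C) (a b : ℝ) :
    IntervalIntegrable f volume a b := by
  rw [intervalIntegrable_iff]
  exact Measure.integrableOn_of_bounded (by simp) hf (ae_of_all _ hC)

theorem norm_exp_ofReal_mul_I_le (x : ℝ) : ‖Complex.exp ((x : ℂ) * Complex.I)‖ ≤ 1 := by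
  rw [Complex.norm_exp_ofReal_mul_I]

/-! ### Curves with nondecreasing tangent angle, and heights over a line. -/

section Monotone

variable {q : ℝ → ℝ} (hq : Monotone q)

include hq

theorem measurable_exp_mul_I : Measurable fun u => Complex.exp ((q u : ℂ) * Complex.I) :=
  Complex.measurable_exp.comp ((Complex.measurable_ofReal.comp hq.measurable).mul_const _)

theorem intervalIntegrable_exp (a b : ℝ) :
    IntervalIntegrable (fun u => Complex.exp ((q u : ℂ) * Complex.I)) volume a b :=
  intervalIntegrable_of_bound (measurable_exp_mul_I hq).aestronglyMeasurable 1
    (fun _ => norm_exp_ofReal_mul_I_le _) a b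

theorem intervalIntegrable_sin (φ a b : ℝ) :
    IntervalIntegrable (fun u => Real.sin (q u - φ)) volume a b :=
  intervalIntegrable_of_bound
    (Real.measurable_sin.comp (hq.measurable.sub_const _)).aestronglyMeasurable 1
    (fun _ => Real.abs_sin_le_one _) a b

theorem path_sub (s t : ℝ) :
    path q t - path q s = ∫ u in s..t, Complex.exp ((q u : ℂ) * Complex.I) :=
  intervalIntegral.integral_interval_sub_left (intervalIntegrable_exp hq _ _)
    (intervalIntegrable_exp hq _ _)

theorem exp_mul_path_sub (φ s t : ℝ) :
    Complex.exp (-φ * Complex.I) * (path q t - path q s) =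
      ∫ u in s..t, Complex.exp (((q u - φ : ℝ) : ℂ) * Complex.I) := by
  rw [path_sub hq, ← intervalIntegral.integral_const_mul]
  congr 1
  ext u
  rw [← Complex.exp_add]
  congr 1
  push_cast
  ring

theorem im_exp_mul_path_sub (φ s t : ℝ) :
    (Complex.exp (-φ * Complex.I) * (path q t - path q s)).im = height q φ s t := by
  rw [exp_mul_path_sub hq, height]
  have h := Complex.imCLM.intervalIntegral_comp_comm
    (intervalIntegrable_exp (q := fun u => q u - φ) (fun a b h => by simpa using hq h) s t)
  simp only [Complex.imCLM_apply, Complex.exp_ofReal_mul_I_im] at h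
  exact h.symm

theorem height_add (φ a b c : ℝ) : height q φ a b + height q φ b c = height q φ a c :=
  intervalIntegral.integral_add_adjacent_intervals (intervalIntegrable_sin hq _ _ _)
    (intervalIntegrable_sin hq _ _ _)

theorem lipschitzWith_path : LipschitzWith 1 (path q) := by
  refine LipschitzWith.of_dist_le_mul fun a b => ?_
  rw [dist_eq_norm, path_sub hq]
  have := intervalIntegral.norm_integral_le_of_norm_le_const (a := b) (b := a) (C := 1)
    (f := fun u => Complex.exp ((q u : ℂ) * Complex.I)) (fun x _ => norm_exp_ofReal_mul_I_le _)
  simpa [Real.dist_eq] using this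

theorem continuous_path : Continuous (path q) := (lipschitzWith_path hq).continuous

omit hq in
theorem height_nonneg {φ a b : ℝ} (hab : a ≤ b) (h : ∀ u ∈ Ioo a b, φ ≤ q u ∧ q u ≤ φ + Real.pi) :
    0 ≤ height q φ a b := by
  rw [height, intervalIntegral.integral_of_le hab, ← integral_Ioc_eq_integral_Ioo.symm]
  refine setIntegral_nonneg measurableSet_Ioo fun u hu => Real.sin_nonneg_of_nonneg_of_le_pi ?_ ?_
  · linarith [(h u hu).1]
  · linarith [(h u hu).2]

omit hq in
theorem height_nonpos {φ a b : ℝ} (hab : a ≤ b)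
    (h : ∀ u ∈ Ioo a b, φ + Real.pi ≤ q u ∧ q u ≤ φ + 2 * Real.pi) :
    height q φ a b ≤ 0 := by
  rw [height, intervalIntegral.integral_of_le hab, ← integral_Ioc_eq_integral_Ioo.symm]
  refine setIntegral_nonpos measurableSet_Ioo fun u hu => ?_
  have := Real.sin_nonneg_of_nonneg_of_le_pi (x := q u - φ - Real.pi)
    (by linarith [(h u hu).1]) (by linarith [(h u hu).2])
  rw [Real.sin_sub_pi] at this
  linarith

theorem height_pos {φ a b : ℝ} (hab : a < b) (h : ∀ u ∈ Ioo a b, φ < q u ∧ q u < φ + Real.pi) :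
    0 < height q φ a b := by
  refine intervalIntegral.intervalIntegral_pos_of_pos_on (intervalIntegrable_sin hq _ _ _)
    (fun u hu => Real.sin_pos_of_pos_of_lt_pi ?_ ?_) hab
  · linarith [(h u hu).1]
  · linarith [(h u hu).2]

theorem height_neg {φ a b : ℝ} (hab : a < b)
    (h : ∀ u ∈ Ioo a b, φ + Real.pi < q u ∧ q u < φ + 2 * Real.pi) :
    height q φ a b < 0 := by
  have := intervalIntegral.intervalIntegral_pos_of_pos_on
    (intervalIntegrable_sin hq φ a b).neg (fun u hu => ?_) hab
  · simp only [Pi.neg_apply, intervalIntegral.integral_neg] at this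
    rw [height]
    linarith
  · have := Real.sin_pos_of_pos_of_lt_pi (x := q u - φ - Real.pi)
      (by linarith [(h u hu).1]) (by linarith [(h u hu).2])
    rw [Real.sin_sub_pi] at this
    simpa using this

theorem path_sub_of_eq {φ a b : ℝ} (hab : a ≤ b) (h : ∀ u ∈ Ioo a b, q u = φ) :
    path q b - path q a = (b - a : ℝ) * Complex.exp (φ * Complex.I) := by
  rw [path_sub hq, intervalIntegral.integral_of_le hab, ← integral_Ioc_eq_integral_Ioo.symm,
    setIntegral_congr_fun (g := fun _ => Complex.exp (φ * Complex.I)) measurableSet_Ioo]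
  · simp [hab]
  · intro u hu
    simp [h u hu]

end Monotone

/-! ### Tangent lines are supporting lines. -/

/-- The line of angle `φ` through `path q s` is a supporting line, with the curve on its left. -/
def IsTangent (q : ℝ → ℝ) (φ s : ℝ) : Prop := (∀ u < s, q u ≤ φ) ∧ ∀ u, s < u → φ ≤ q u

theorem isTangent_self {q : ℝ → ℝ} (hq : Monotone q) (s : ℝ) : IsTangent q (q s) s :=
  ⟨fun _ h => hq h.le, fun _ h => hq h.le⟩

namespace IsTurning

variable {q : ℝ → ℝ} (hq : IsTurning q)

include hq

theorem periodic_exp : Function.Periodic (fun u => Complex.exp ((q u : ℂ) * Complex.I)) 1 := by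
  intro u
  simp only [hq.add_one]
  push_cast
  rw [add_mul, Complex.exp_add, Complex.exp_two_pi_mul_I, mul_one]

theorem path_add_one (t : ℝ) : path q (t + 1) = path q t := by
  rw [← sub_eq_zero, path_sub hq.mono, hq.periodic_exp.intervalIntegral_add_eq t 0, zero_add,
    hq.closed]

theorem path_periodic : Function.Periodic (path q) 1 := hq.path_add_one

theorem range_path (a : ℝ) : range (path q) = path q '' Ico a (a + 1) :=
  by
  refine Subset.antisymm ?_ (image_subset_range _ _)
  rintro _ ⟨t, rfl⟩
  obtain ⟨y, hy, hty⟩ := hq.path_periodic.exists_mem_Ico one_pos t a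
  exact ⟨y, hy, hty.symm⟩

theorem height_add_one (φ s : ℝ) : height q φ s (s + 1) = 0 := by
  rw [← im_exp_mul_path_sub hq.mono, hq.path_add_one]
  simp

theorem le_of_lt_add_one {φ s u : ℝ} (h : IsTangent q φ s) (hu : u < s + 1) :
    q u ≤ φ + 2 * Real.pi := by
  have := h.1 (u - 1) (by linarith)
  have h2 := hq.add_one (u - 1)
  rw [sub_add_cancel] at h2
  linarith

/-- The height rises while `q ≤ φ + π` and falls afterwards, and it is back at zero after a full
period. So either the piece before `t` only rises, or the piece after `t` only falls down to zero.
-/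
theorem height_nonneg_Icc {φ s t : ℝ} (h : IsTangent q φ s) (ht : t ∈ Icc s (s + 1)) :
    0 ≤ height q φ s t := by
  rcases le_total (q t) (φ + Real.pi) with h1 | h1
  · exact height_nonneg ht.1 fun u hu => ⟨h.2 u hu.1, (hq.mono hu.2.le).trans h1⟩
  · have h2 := height_nonpos ht.2 fun u hu =>
      ⟨h1.trans (hq.mono hu.1.le), hq.le_of_lt_add_one h hu.2⟩
    have h3 := height_add hq.mono φ s t (s + 1)
    rw [hq.height_add_one] at h3
    linarith

theorem im_nonneg {φ s : ℝ} (h : IsTangent q φ s) {x : ℂ} (hx : x ∈ body q) :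
    0 ≤ (Complex.exp (-φ * Complex.I) * (x - path q s)).im := by
  have hc : Convex ℝ {x : ℂ | 0 ≤ (Complex.exp (-φ * Complex.I) * (x - path q s)).im} := by
    intro x hx y hy a b ha hb hab
    simp only [mem_ofPred_eq] at *
    have : Complex.exp (-φ * Complex.I) * (a • x + b • y - path q s) =
        a • (Complex.exp (-φ * Complex.I) * (x - path q s)) +
          b • (Complex.exp (-φ * Complex.I) * (y - path q s)) := by
      have hb' : (b : ℂ) = 1 - a := by
        rw [eq_sub_iff_add_eq, add_comm]
        exact_mod_cast hab
      simp only [Complex.real_smul, hb']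
      ring
    rw [this, Complex.add_im, Complex.smul_im, Complex.smul_im]
    exact add_nonneg (mul_nonneg ha hx) (mul_nonneg hb hy)
  refine convexHull_min ?_ hc hx
  rw [hq.range_path s]
  rintro _ ⟨t, ht, rfl⟩
  rw [mem_ofPred_eq, im_exp_mul_path_sub hq.mono]
  exact hq.height_nonneg_Icc h ⟨ht.1, ht.2.le⟩

/-- If the curve meets a tangent line a second time, then along that line or it is contained in
it. -/
theorem eq_or_eq_or_flat {φ s t : ℝ} (h : IsTangent q φ s) (ht : t ∈ Icc s (s + 1))
    (h0 : height q φ s t = 0) :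
    (∀ u ∈ Ioo s t, q u = φ) ∨ (∀ u ∈ Ioo t (s + 1), q u = φ + 2 * Real.pi) ∨
      ∀ r ∈ Icc s (s + 1), height q φ s r = 0 := by
  have hs1 := hq.height_add_one φ s
  have hm := hq.mono
  by_contra! hcon
  obtain ⟨⟨a, ha, hqa⟩, ⟨b, hb, hqb⟩, r, hr, hr0⟩ := hcon
  have hqa : φ < q a := lt_of_le_of_ne (h.2 a ha.1) hqa.symm
  have hqb : q b < φ + 2 * Real.pi := lt_of_le_of_ne (hq.le_of_lt_add_one h hb.2) hqb
  refine hr0 (le_antisymm ?_ (hq.height_nonneg_Icc h hr))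
  -- Up to `t` the height never decreases, so it vanishes throughout. Right after `a` the angle
  -- exceeds `φ`, and to gain no height it must already be at least `φ + π`. Then the height rises
  -- up to `a` and falls after `a`, where it is zero, so it is nowhere positive. The other case is
  -- the mirror image, with `b` in the role of `a`.
  rcases le_total (q t) (φ + Real.pi) with h1 | h1
  · have hsa : height q φ s a = 0 := by
      refine le_antisymm ?_ (hq.height_nonneg_Icc h ⟨ha.1.le, (ha.2.le.trans ht.2)⟩)
      have := height_nonneg ha.2.le (φ := φ) fun u hu =>
        ⟨hqa.le.trans (hm hu.1.le), (hm hu.2.le).trans h1⟩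
      linarith [height_add hm φ s a t]
    have hat : height q φ a t = 0 := by linarith [height_add hm φ s a t]
    have hpi : ∀ c ∈ Ioo a t, φ + Real.pi ≤ q c := by
      intro c hc
      by_contra! hlt
      have h2 := height_pos hm hc.1 (φ := φ) fun u hu =>
        ⟨hqa.trans_le (hm hu.1.le), (hm hu.2.le).trans_lt hlt⟩
      have h3 := height_nonneg hc.2.le (φ := φ) fun u hu =>
        ⟨hqa.le.trans (hm (hc.1.le.trans hu.1.le)), (hm hu.2.le).trans h1⟩
      linarith [height_add hm φ a c t]
    have hpi' : ∀ c, a < c → φ + Real.pi ≤ q c := by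
      intro c hc
      obtain ⟨d, hd⟩ := exists_between (lt_min hc ha.2)
      exact (hpi d ⟨hd.1, hd.2.trans_le (min_le_right _ _)⟩).trans
        (hm (hd.2.le.trans (min_le_left _ _)))
    rcases le_total r a with hra | hra
    · have := height_nonneg hra (φ := φ) fun u hu =>
        ⟨h.2 u (hr.1.trans_lt hu.1), (hm (hu.2.le.trans ha.2.le)).trans h1⟩
      linarith [height_add hm φ s r a]
    · have := height_nonpos hra (φ := φ) fun u hu =>
        ⟨hpi' u hu.1, hq.le_of_lt_add_one h (hu.2.trans_le hr.2)⟩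
      linarith [height_add hm φ s a r]
  · have hsb : height q φ s b = 0 := by
      refine le_antisymm ?_ (hq.height_nonneg_Icc h ⟨(ht.1.trans hb.1.le), hb.2.le⟩)
      have := height_nonpos hb.1.le (φ := φ) fun u hu =>
        ⟨h1.trans (hm hu.1.le), (hm hu.2.le).trans hqb.le⟩
      linarith [height_add hm φ s t b]
    have htb : height q φ t b = 0 := by linarith [height_add hm φ s t b]
    have hpi : ∀ c ∈ Ioo t b, q c ≤ φ + Real.pi := by
      intro c hc
      by_contra! hlt
      have h2 := height_neg hm hc.2 (φ := φ) fun u hu =>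
        ⟨hlt.trans_le (hm hu.1.le), (hm hu.2.le).trans_lt hqb⟩
      have h3 := height_nonpos hc.1.le (φ := φ) fun u hu =>
        ⟨h1.trans (hm hu.1.le), (hm (hu.2.le.trans hc.2.le)).trans hqb.le⟩
      linarith [height_add hm φ t c b]
    have hpi' : ∀ c < b, q c ≤ φ + Real.pi := by
      intro c hc
      obtain ⟨d, hd⟩ := exists_between (max_lt hc hb.1)
      exact (hm ((le_max_left _ _).trans hd.1.le)).trans
        (hpi d ⟨(le_max_right _ _).trans_lt hd.1, hd.2⟩)
    rcases le_total r b with hrb | hrb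
    · have := height_nonneg hrb (φ := φ) fun u hu =>
        ⟨h.2 u (hr.1.trans_lt hu.1), hpi' u hu.2⟩
      linarith [height_add hm φ s r b]
    · have := height_nonpos hrb (φ := φ) fun u hu =>
        ⟨h1.trans (hm (hb.1.le.trans hu.1.le)), hq.le_of_lt_add_one h (hu.2.trans_le hr.2)⟩
      linarith [height_add hm φ s b r]

end IsTurning

/-! ### Compact hulls, supporting lines and faces of convex sets in the plane. -/

theorem isCompact_convexHull {E : Type*} [NormedAddCommGroup E] [NormedSpace ℝ E]
    [FiniteDimensional ℝ E] {A : Set E} (hA : IsCompact A) : IsCompact (convexHull ℝ A) := by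
  rcases A.eq_empty_or_nonempty with rfl | ⟨a, ha⟩
  · simp
  -- By Carathéodory's theorem, `n` points suffice in each convex combination, so the hull is a
  -- continuous image of a compact set. Shorter combinations are padded with weight `0` at the point
  -- `a`.
  set n := Module.finrank ℝ E + 1
  have hcomp : IsCompact ((fun p : (Fin n → ℝ) × (Fin n → E) => ∑ k, p.1 k • p.2 k) ''
      (stdSimplex ℝ (Fin n) ×ˢ univ.pi fun _ => A)) :=
    ((isCompact_stdSimplex ℝ (Fin n)).prod (isCompact_univ_pi fun _ => hA)).image (by fun_prop)
  convert hcomp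
  refine Subset.antisymm (fun x hx => ?_) ?_
  · obtain ⟨ι, _, z, w, hz, hind, hw, hw1, rfl⟩ := eq_pos_convex_span_of_mem_convexHull hx
    have hcard : Fintype.card ι ≤ Fintype.card (Fin n) := by
      rw [Fintype.card_fin]
      exact hind.card_le_finrank_succ.trans
        (Nat.add_le_add_right (Submodule.finrank_le _) 1)
    obtain ⟨e⟩ := Function.Embedding.nonempty_of_card_le hcard
    have hex : ∀ k ∉ range e, Function.extend e w 0 k = 0 := fun k hk =>
      Function.extend_apply' _ _ _ hk
    refine ⟨(Function.extend e w 0, Function.extend e z fun _ => a), ⟨⟨fun k => ?_, ?_⟩, ?_⟩, ?_⟩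
    · by_cases hk : k ∈ range e
      · obtain ⟨i, rfl⟩ := hk
        simpa [e.injective.extend_apply] using (hw i).le
      · exact (hex k hk).ge
    · rw [← hw1]
      exact (Fintype.sum_of_injective e e.injective _ _ hex fun i =>
        (e.injective.extend_apply _ _ _).symm).symm
    · intro k _
      by_cases hk : k ∈ range e
      · obtain ⟨i, rfl⟩ := hk
        simpa [e.injective.extend_apply] using hz (mem_range_self i)
      · simpa [Function.extend_apply' _ _ _ hk] using ha
    · refine (Fintype.sum_of_injective e e.injective _ _ (fun k hk => ?_) fun i => ?_).symm
      · simp [hex k hk]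
      · simp [e.injective.extend_apply]
  · rintro _ ⟨⟨w, z⟩, ⟨hw, hz⟩, rfl⟩
    exact (convex_convexHull ℝ A).sum_mem (fun k _ => hw.1 k) hw.2
      fun k _ => subset_convexHull ℝ A (hz k (mem_univ k))

theorem exists_eq_mul_im (f : ℂ →ₗ[ℝ] ℝ) (hf : f ≠ 0) :
    ∃ c > 0, ∃ φ : ℝ, ∀ x, f x = c * (Complex.exp (-φ * Complex.I) * x).im := by
  have hfx : ∀ x : ℂ, f x = x.re * f 1 + x.im * f Complex.I := by
    intro x
    have : x = x.re • (1 : ℂ) + x.im • Complex.I := by simp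
    conv_lhs => rw [this, map_add, map_smul, map_smul, smul_eq_mul, smul_eq_mul]
  -- In real coordinates `Im (exp (-iφ) x) = cos φ * x.im - sin φ * x.re`; so `z` must have real
  -- part `f I`, imaginary part `-f 1` and argument `φ`.
  set z : ℂ := ⟨f Complex.I, -f 1⟩
  have hz : z ≠ 0 := by
    intro hz
    have h1 : f Complex.I = 0 := congrArg Complex.re hz
    have h2 : -f 1 = 0 := congrArg Complex.im hz
    apply hf
    ext x
    rw [hfx, h1, neg_eq_zero.1 h2]
    simp
  refine ⟨‖z‖, norm_pos_iff.2 hz, z.arg, fun x => ?_⟩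
  have h1 : ‖z‖ * Real.cos z.arg = f Complex.I := Complex.norm_mul_cos_arg z
  have h2 : ‖z‖ * Real.sin z.arg = -f 1 := Complex.norm_mul_sin_arg z
  rw [← Complex.ofReal_neg, Complex.mul_im, Complex.exp_ofReal_mul_I_re,
    Complex.exp_ofReal_mul_I_im, Real.cos_neg, Real.sin_neg, hfx]
  linear_combination (-x.im) * h1 + x.re * h2

theorem im_exp_add_pi_mul (φ : ℝ) (x : ℂ) :
    (Complex.exp (-(φ + Real.pi : ℝ) * Complex.I) * x).im =
      -(Complex.exp (-φ * Complex.I) * x).im := by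
  have : (-((φ + Real.pi : ℝ) : ℂ) * Complex.I) = -(φ * Complex.I) - Real.pi * Complex.I := by
    push_cast
    ring
  rw [this, Complex.exp_sub_pi_mul_I, neg_mul (φ : ℂ)]
  simp only [Complex.mul_im, Complex.neg_re, Complex.neg_im]
  ring

/-- A small move of length `ε` perpendicular to the line, towards it, stays in `C` and lowers the
height by exactly `ε`. -/
theorem lt_im_of_mem_interior {C : Set ℂ} {p : ℂ} (hp : p ∈ interior C) {φ m : ℝ}
    (h : ∀ x ∈ C, m ≤ (Complex.exp (-φ * Complex.I) * x).im) :
    m < (Complex.exp (-φ * Complex.I) * p).im := by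
  have hc : Tendsto (fun ε : ℝ => p - ε * (Complex.I * Complex.exp (φ * Complex.I))) (𝓝[>] 0)
      (𝓝 p) := by
    have : Continuous fun ε : ℝ => p - ε * (Complex.I * Complex.exp (φ * Complex.I)) := by
      fun_prop
    simpa using (this.tendsto 0).mono_left nhdsWithin_le_nhds
  obtain ⟨ε, hε, hε0⟩ := ((hc.eventually (mem_interior_iff_mem_nhds.1 hp)).and
    self_mem_nhdsWithin).exists
  have h1 := h _ hε
  have h2 : Complex.exp (-φ * Complex.I) * (p - ε * (Complex.I * Complex.exp (φ * Complex.I))) =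
      Complex.exp (-φ * Complex.I) * p - ε * Complex.I := by
    have : Complex.exp (-φ * Complex.I) * Complex.exp (φ * Complex.I) = 1 := by
      rw [← Complex.exp_add]
      simp
    linear_combination (-ε * Complex.I) * this
  rw [h2, Complex.sub_im, Complex.im_ofReal_mul, Complex.I_im, mul_one] at h1
  have : (0 : ℝ) < ε := hε0
  linarith

theorem exists_im_eq_zero_of_interior_eq_empty {C : Set ℂ} (hC : Convex ℝ C) (h0 : 0 ∈ C)
    (hi : interior C = ∅) : ∃ φ : ℝ, ∀ x ∈ C, (Complex.exp (-φ * Complex.I) * x).im = 0 := by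
  have hspan : Submodule.span ℝ C < ⊤ := by
    refine lt_top_iff_ne_top.2 fun htop => ?_
    have : affineSpan ℝ C = ⊤ := by
      apply SetLike.coe_injective
      have := affineSpan_insert_zero (k := ℝ) C
      rwa [insert_eq_of_mem h0, htop] at this
    have := hC.interior_nonempty_iff_affineSpan_eq_top.2 this
    simp [hi] at this
  obtain ⟨f, hf, hle⟩ := Submodule.exists_le_ker_of_lt_top _ hspan
  obtain ⟨c, hc, φ, h⟩ := exists_eq_mul_im f hf
  refine ⟨φ, fun x hx => ?_⟩
  have : f x = 0 := hle (Submodule.subset_span hx)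
  rw [h] at this
  exact (mul_eq_zero.1 this).resolve_left hc.ne'

/-- Hahn–Banach separates `p` from the open interior; the inequality extends to `C` because a convex
set with interior points lies in the closure of its interior. -/
theorem exists_supporting_angle {C : Set ℂ} (hC : Convex ℝ C) (hi : (interior C).Nonempty) {p : ℂ}
    (hp : p ∉ interior C) :
    ∃ φ : ℝ, ∀ x ∈ C, (Complex.exp (-φ * Complex.I) * p).im ≤
      (Complex.exp (-φ * Complex.I) * x).im := by
  obtain ⟨f, hf⟩ := geometric_hahn_banach_open_point hC.interior isOpen_interior hp
  have hle : ∀ x ∈ C, f x ≤ f p := by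
    have hcl : closure (interior C) ⊆ {x | f x ≤ f p} :=
      closure_minimal (fun x hx => (hf x hx).le) (isClosed_le f.continuous continuous_const)
    intro x hx
    apply hcl
    rw [hC.closure_interior_eq_closure_of_nonempty_interior hi]
    exact subset_closure hx
  have hne : (-f : ℂ →L[ℝ] ℝ).toLinearMap ≠ 0 := by
    intro h0
    obtain ⟨y, hy⟩ := hi
    have h1 : ∀ x, f x = 0 := fun x => by
      have := congrArg (fun g : ℂ →ₗ[ℝ] ℝ => g x) h0
      simpa using this
    have := hf y hy
    simp [h1] at this
  obtain ⟨c, hc, φ, h⟩ := exists_eq_mul_im _ hne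
  refine ⟨φ, fun x hx => ?_⟩
  have h1 := h x
  have h2 := h p
  simp only [ContinuousLinearMap.coe_coe, neg_apply] at h1 h2
  have := hle x hx
  exact le_of_mul_le_mul_left (by linarith) hc

/-- A point of the convex hull at which an affine function is minimal lies in the convex hull of
the points where that minimum is attained. -/
theorem mem_convexHull_face {E : Type*} [AddCommGroup E] [Module ℝ E] {A : Set E} (f : E →ₗ[ℝ] ℝ)
    {m : ℝ} (hA : ∀ x ∈ A, m ≤ f x) {p : E} (hp : p ∈ convexHull ℝ A) (hpm : f p = m) :
    p ∈ convexHull ℝ (A ∩ {x | f x = m}) := by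
  have hface : ∀ x ∈ convexHull ℝ (A ∩ {x | f x = m}), f x = m := by
    intro x hx
    refine convexHull_min (t := {x | f x = m}) inter_subset_right ?_ hx
    exact (convex_hyperplane f.isLinear m)
  -- The open half-space together with the hull of the face is convex and contains `A`, hence
  -- contains the whole hull; a point at height `m` can only be in the second piece.
  have hconv : Convex ℝ ({x | m < f x} ∪ convexHull ℝ (A ∩ {x | f x = m})) := by
    rw [convex_iff_forall_pos]
    rintro x hx y hy a b ha hb hab
    have hmm : a * m + b * m = m := by rw [← add_mul, hab, one_mul]
    have key : f (a • x + b • y) = a * f x + b * f y := by simp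
    have hge : ∀ x ∈ {x | m < f x} ∪ convexHull ℝ (A ∩ {x | f x = m}), m ≤ f x := by
      rintro x (hx | hx)
      · exact (show m < f x from hx).le
      · exact (hface x hx).ge
    rcases hx with hx | hx
    · left
      rw [mem_ofPred_eq, key]
      have h1 : m < f x := hx
      nlinarith [hge y hy]
    · rcases hy with hy | hy
      · left
        rw [mem_ofPred_eq, key]
        have h1 : m < f y := hy
        nlinarith [hface x hx]
      · right
        exact convex_convexHull ℝ _ hx hy ha.le hb.le hab
  have : p ∈ {x | m < f x} ∪ convexHull ℝ (A ∩ {x | f x = m}) := by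
    refine convexHull_min (fun x hx => ?_) hconv hp
    rcases (hA x hx).lt_or_eq with h | h
    · exact Or.inl h
    · exact Or.inr (subset_convexHull ℝ _ ⟨hx, h.symm⟩)
  rcases this with h | h
  · exact absurd hpm (ne_of_gt h)
  · exact h

/-- The real linear form `x ↦ Im (exp (-iφ) x)`. -/
def imForm (φ : ℝ) : ℂ →ₗ[ℝ] ℝ :=
  Complex.imLm ∘ₗ LinearMap.mulLeft ℝ (Complex.exp (-φ * Complex.I))

theorem imForm_apply (φ : ℝ) (x : ℂ) : imForm φ x = (Complex.exp (-φ * Complex.I) * x).im := rfl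

/-! ### The curve as the boundary of its convex hull. -/

namespace IsTurning

variable {q : ℝ → ℝ} (hq : IsTurning q)

include hq

theorem add_int (u : ℝ) (n : ℤ) : q (u + n) = q u + n * (2 * Real.pi) := by
  have h : Function.Periodic (fun u => q u - u * (2 * Real.pi)) 1 := by
    intro u
    simp only [hq.add_one]
    ring
  have := h.int_mul n u
  simp only [mul_one] at this
  linarith

/-- Every direction has a tangent line. The supremum picks the earliest point of contact, and the
strict inequality to its left later excludes that the curve arrives at this point along the line. -/
theorem exists_isTangent (φ : ℝ) : ∃ s, (∀ u < s, q u < φ) ∧ ∀ u, s < u → φ ≤ q u := by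
  have hpi := Real.two_pi_pos
  have hlow : ∃ u, q u < φ := by
    obtain ⟨n, hn⟩ := exists_nat_gt ((q 0 - φ) / (2 * Real.pi))
    refine ⟨0 + ((-n : ℤ) : ℝ), ?_⟩
    rw [hq.add_int]
    rw [div_lt_iff₀ hpi] at hn
    push_cast
    linarith
  have hup : ∃ b, φ ≤ q b := by
    obtain ⟨n, hn⟩ := exists_nat_gt ((φ - q 0) / (2 * Real.pi))
    refine ⟨0 + ((n : ℤ) : ℝ), ?_⟩
    rw [hq.add_int]
    rw [div_lt_iff₀ hpi] at hn
    push_cast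
    linarith
  obtain ⟨b, hb⟩ := hup
  have hbdd : BddAbove {u | q u < φ} := by
    refine ⟨b, fun u hu => ?_⟩
    by_contra! h
    exact absurd (hb.trans (hq.mono h.le)) (not_le.2 hu)
  refine ⟨sSup {u | q u < φ}, fun u hu => ?_, fun u hu => ?_⟩
  · obtain ⟨v, hv, huv⟩ := exists_lt_of_lt_csSup hlow hu
    exact (hq.mono huv.le).trans_lt hv
  · by_contra! h
    exact absurd (le_csSup hbdd h) (not_le.2 hu)

omit hq in
theorem convex_body : Convex ℝ (body q) := convex_convexHull ℝ _

omit hq in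
theorem path_mem_body (t : ℝ) : path q t ∈ body q := subset_convexHull ℝ _ (mem_range_self t)

omit hq in
theorem zero_mem_body : (0 : ℂ) ∈ body q := by
  have := path_mem_body (q := q) 0
  simpa [path] using this

theorem range_path_eq_image_Icc : range (path q) = path q '' Icc 0 1 := by
  refine Subset.antisymm ?_ (image_subset_range _ _)
  rw [hq.range_path 0, zero_add]
  exact image_mono Ico_subset_Icc_self

theorem isCompact_body : IsCompact (body q) := by
  rw [body, hq.range_path_eq_image_Icc]
  exact isCompact_convexHull (isCompact_Icc.image (continuous_path hq.mono))

theorem path_notMem_interior (t : ℝ) : path q t ∉ interior (body q) := by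
  intro h
  have := lt_im_of_mem_interior h (φ := q t) (m := (Complex.exp (-(q t) * Complex.I) *
    path q t).im) fun x hx => by
      have := hq.im_nonneg (isTangent_self hq.mono t) hx
      rw [mul_sub, Complex.sub_im] at this
      linarith
  exact lt_irrefl _ this

theorem range_path_subset_frontier : range (path q) ⊆ frontier (body q) := by
  rintro _ ⟨t, rfl⟩
  exact ⟨subset_closure (path_mem_body t), hq.path_notMem_interior t⟩

/-- A flat curve has its hull in one line, and an interior point would lie strictly on both sides of
it. -/
theorem not_flat (hi : (interior (body q)).Nonempty) {φ s : ℝ} (hs : IsTangent q φ s) :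
    ¬ ∀ r ∈ Icc s (s + 1), height q φ s r = 0 := by
  intro h
  obtain ⟨p, hp⟩ := hi
  have hle : ∀ x ∈ body q, -(Complex.exp (-φ * Complex.I) * path q s).im ≤
      (Complex.exp (-(φ + Real.pi : ℝ) * Complex.I) * x).im := by
    intro x hx
    rw [im_exp_add_pi_mul, neg_le_neg_iff]
    refine convexHull_min (t := {x | imForm φ x ≤ imForm φ (path q s)}) ?_
      (convex_halfSpace_le (imForm φ).isLinear _) hx
    rw [hq.range_path s]
    rintro _ ⟨t, ht, rfl⟩
    have h2 := im_exp_mul_path_sub hq.mono φ s t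
    rw [h t ⟨ht.1, ht.2.le⟩, mul_sub, Complex.sub_im] at h2
    simp only [mem_ofPred_eq, imForm_apply]
    linarith
  have h1 := lt_im_of_mem_interior hp hle
  have h2 := lt_im_of_mem_interior hp (φ := φ) (m := (Complex.exp (-φ * Complex.I) * path q s).im)
    fun x hx => by
      have := hq.im_nonneg hs hx
      rw [mul_sub, Complex.sub_im] at this
      linarith
  rw [im_exp_add_pi_mul] at h1
  linarith

/-- A double point has height zero over its own tangent line. Then one of the two arcs between its
two parameters is straight, which is absurd since it would have nonzero displacement, or the curve
is flat. -/
theorem injOn_path (hi : (interior (body q)).Nonempty) (a : ℝ) :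
    InjOn (path q) (Ico a (a + 1)) := by
  have key : ∀ s t, s < t → t < s + 1 → path q s ≠ path q t := by
    intro s t hst hts heq
    have hT := isTangent_self hq.mono s
    have h0 : height q (q s) s t = 0 := by
      rw [← im_exp_mul_path_sub hq.mono, heq]
      simp
    have hne : ∀ x : ℝ, Complex.exp (x * Complex.I) ≠ 0 := fun x => Complex.exp_ne_zero _
    rcases hq.eq_or_eq_or_flat hT ⟨hst.le, hts.le⟩ h0 with h | h | h
    · have := path_sub_of_eq hq.mono hst.le h
      rw [heq, sub_self, eq_comm, mul_eq_zero] at this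
      have := this.resolve_right (hne _)
      norm_cast at this
      linarith
    · have := path_sub_of_eq hq.mono hts.le h
      rw [hq.path_add_one, heq, sub_self, eq_comm, mul_eq_zero] at this
      have := this.resolve_right (hne _)
      norm_cast at this
      linarith
    · exact hq.not_flat hi hT h
  intro s hs t ht heq
  rcases lt_trichotomy s t with h | h | h
  · exact absurd heq (key s t h (by linarith [ht.2, hs.1]))
  · exact h
  · exact absurd heq.symm (key t s h (by linarith [hs.2, ht.1]))

theorem frontier_subset_range (hi : (interior (body q)).Nonempty) :
    frontier (body q) ⊆ range (path q) := by
  intro p hp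
  have hpC : p ∈ body q := hq.isCompact_body.isClosed.frontier_subset hp
  obtain ⟨φ, hφ⟩ := exists_supporting_angle convex_body hi hp.2
  obtain ⟨s, hs1, hs2⟩ := hq.exists_isTangent φ
  have hs : IsTangent q φ s := ⟨fun u hu => (hs1 u hu).le, hs2⟩
  have hm : ∀ x ∈ range (path q), imForm φ (path q s) ≤ imForm φ x := by
    intro x hx
    have := hq.im_nonneg hs (subset_convexHull ℝ _ hx)
    rw [mul_sub, Complex.sub_im] at this
    simp only [imForm_apply]
    linarith
  have hpm : imForm φ p = imForm φ (path q s) := by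
    refine le_antisymm (hφ _ (path_mem_body s)) ?_
    have := hq.im_nonneg hs hpC
    rw [mul_sub, Complex.sub_im] at this
    simp only [imForm_apply]
    linarith
  have hface := mem_convexHull_face (imForm φ) hm hpC hpm
  -- The curve leaves the supporting line for good at `c = sSup T`. The points of the curve on that
  -- line form the segment `path q '' Icc s c`; being convex already, it contains `p`.
  set T : Set ℝ := {t ∈ Icc s (s + 1) | ∀ u ∈ Ioo s t, q u = φ} with hT
  have hsT : s ∈ T := ⟨⟨le_rfl, by linarith⟩, fun u hu => absurd (hu.1.trans hu.2) (lt_irrefl _)⟩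
  have hTb : BddAbove T := ⟨s + 1, fun t ht => ht.1.2⟩
  set c := sSup T
  have hsc : s ≤ c := le_csSup hTb hsT
  have hc : ∀ u ∈ Ioo s c, q u = φ := by
    intro u hu
    obtain ⟨t, ht, hut⟩ := exists_lt_of_lt_csSup ⟨s, hsT⟩ hu.2
    exact ht.2 u ⟨hu.1, hut⟩
  have hpath : ∀ t ∈ Icc s c, path q t = path q s + (t - s : ℝ) * Complex.exp (φ * Complex.I) := by
    intro t ht
    rw [← path_sub_of_eq hq.mono ht.1 fun u hu => hc u ⟨hu.1, hu.2.trans_le ht.2⟩]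
    ring
  have hsub : range (path q) ∩ {x | imForm φ x = imForm φ (path q s)} ⊆ path q '' Icc s c := by
    rintro _ ⟨hx, hx2⟩
    rw [hq.range_path s] at hx
    obtain ⟨t, ht, rfl⟩ := hx
    have h0 : height q φ s t = 0 := by
      rw [← im_exp_mul_path_sub hq.mono, mul_sub, Complex.sub_im, ← imForm_apply, ← imForm_apply]
      exact sub_eq_zero.2 hx2
    rcases hq.eq_or_eq_or_flat hs ⟨ht.1, ht.2.le⟩ h0 with h | h | h
    · exact ⟨t, ⟨ht.1, le_csSup hTb ⟨⟨ht.1, ht.2.le⟩, h⟩⟩, rfl⟩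
    -- Here the curve would come back to `path q s` along the line at the end of the period, against
    -- the strict choice of `s`.
    · exfalso
      obtain ⟨u, hu⟩ := exists_between ht.2
      have h1 := h u hu
      have h2 := hs1 (u - 1) (by linarith [hu.2])
      have h3 := hq.add_one (u - 1)
      rw [sub_add_cancel] at h3
      linarith
    · exact absurd h (hq.not_flat hi hs)
  have hconv : Convex ℝ (path q '' Icc s c) := by
    have : path q '' Icc s c =
        (AffineMap.lineMap (path q s) (path q s + Complex.exp (φ * Complex.I)) : ℝ →ᵃ[ℝ] ℂ) ''
          Icc 0 (c - s) := by
      ext x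
      constructor
      · rintro ⟨t, ht, rfl⟩
        refine ⟨t - s, ⟨by linarith [ht.1], by linarith [ht.2]⟩, ?_⟩
        rw [hpath t ht, AffineMap.lineMap_apply]
        simp [add_comm]
      · rintro ⟨r, hr, rfl⟩
        refine ⟨r + s, ⟨by linarith [hr.1], by linarith [hr.2]⟩, ?_⟩
        rw [hpath _ ⟨by linarith [hr.1], by linarith [hr.2]⟩, AffineMap.lineMap_apply]
        simp [add_comm]
    rw [this]
    exact (convex_Icc _ _).affine_image _
  exact image_subset_range _ _ (convexHull_min hsub hconv hface)

theorem frontier_body (hi : (interior (body q)).Nonempty) : frontier (body q) = range (path q) :=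
  Subset.antisymm (hq.frontier_subset_range hi) hq.range_path_subset_frontier

end IsTurning

/-! ### Length of the curve and perimeter of its hull. -/

theorem edist_le_hausdorffMeasure_image {X : Type*} [MetricSpace X] [MeasurableSpace X]
    [BorelSpace X] {γ : ℝ → X} {a b : ℝ} (hab : a < b) (hγ : ContinuousOn γ (Icc a b)) :
    edist (γ a) (γ b) ≤ μH[1] (γ '' Ico a b) := by
  -- The distance to `γ a` does not increase lengths, and by connectedness it takes all values from
  -- `0` up to the distance of the endpoints. Half-open intervals suffice, and they make consecutive
  -- pieces of an injective curve disjoint.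
  set f : X → ℝ := fun x => dist x (γ a)
  have hf : LipschitzWith 1 f := LipschitzWith.dist_left (γ a)
  have hcont : ContinuousOn (f ∘ γ) (Icc a b) := hf.continuous.comp_continuousOn hγ
  have hconn : (f ∘ γ '' Ico a b).OrdConnected :=
    (isPreconnected_Ico.image _ (hcont.mono Ico_subset_Icc_self)).ordConnected
  have hsub : Ico 0 (dist (γ b) (γ a)) ⊆ f ∘ γ '' Ico a b := by
    rintro d ⟨hd0, hd⟩
    have hb : ContinuousWithinAt (f ∘ γ) (Iio b) b :=
      (hcont b (right_mem_Icc.2 hab.le)).mono_of_mem_nhdsWithin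
        (mem_of_superset (Ico_mem_nhdsLT hab) Ico_subset_Icc_self)
    obtain ⟨t, htd, ht⟩ := ((hb.eventually (lt_mem_nhds hd)).and (Ico_mem_nhdsLT hab)).exists
    exact hconn.out ⟨a, left_mem_Ico.2 hab, dist_self _⟩ ⟨t, ht, rfl⟩ ⟨hd0, htd.le⟩
  calc edist (γ a) (γ b) = volume (Ico 0 (dist (γ b) (γ a))) := by
        rw [Real.volume_Ico, sub_zero, edist_comm, edist_dist]
    _ ≤ volume (f '' (γ '' Ico a b)) := measure_mono (by rwa [← image_comp])
    _ = μH[1] (f '' (γ '' Ico a b)) := by rw [hausdorffMeasure_real]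
    _ ≤ μH[1] (γ '' Ico a b) := by
        simpa using hf.hausdorffMeasure_image_le zero_le_one (γ '' Ico a b)

theorem sum_edist_le_hausdorffMeasure_image {X : Type*} [MetricSpace X] [MeasurableSpace X]
    [BorelSpace X] {γ : ℝ → X} (hγ : Continuous γ) {t : ℕ → ℝ} (ht : StrictMono t) (n : ℕ)
    (hinj : InjOn γ (Ico (t 0) (t n))) :
    ∑ j ∈ Finset.range n, edist (γ (t j)) (γ (t (j + 1))) ≤ μH[1] (γ '' Ico (t 0) (t n)) := by
  have hsub : ∀ j ∈ Finset.range n, Ico (t j) (t (j + 1)) ⊆ Ico (t 0) (t n) := fun j hj =>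
    Ico_subset_Ico (ht.monotone (Nat.zero_le _)) (ht.monotone (Finset.mem_range.1 hj))
  calc ∑ j ∈ Finset.range n, edist (γ (t j)) (γ (t (j + 1)))
      ≤ ∑ j ∈ Finset.range n, μH[1] (γ '' Ico (t j) (t (j + 1))) :=
        Finset.sum_le_sum fun j _ =>
          edist_le_hausdorffMeasure_image (ht (Nat.lt_succ_self j)) hγ.continuousOn
    _ = μH[1] (⋃ j ∈ Finset.range n, γ '' Ico (t j) (t (j + 1))) := by
        refine (measure_biUnion_finset ?_ fun j hj => ?_).symm
        · intro i hi j hj hij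
          refine Set.disjoint_left.2 ?_
          rintro _ ⟨x, hx, rfl⟩ ⟨y, hy, hxy⟩
          rw [hinj (hsub j hj hy) (hsub i hi hx) hxy] at hy
          exact Set.disjoint_left.1 (ht.monotone.pairwise_disjoint_on_Ico_succ hij) hx hy
        · exact measurableSet_Ico.image_of_continuousOn_injOn hγ.continuousOn
            (hinj.mono (hsub j hj))
    _ ≤ μH[1] (γ '' Ico (t 0) (t n)) :=
        measure_mono (iUnion₂_subset fun j hj => image_mono (hsub j hj))

theorem one_sub_le_cos {x : ℝ} (hx : 0 ≤ x) : 1 - x ≤ Real.cos x := by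
  rcases le_total x 2 with h | h
  · have := Real.one_sub_sq_div_two_le_cos (x := x)
    nlinarith
  · linarith [Real.neg_one_le_cos x]

/-- A chord is at least as long as its projection on the initial tangent, where the speed is `cos (q
u - q s)`. The loss is length times turning, so it telescopes over a uniform subdivision. -/
theorem le_dist_path {q : ℝ → ℝ} (hq : Monotone q) {s t : ℝ} (hst : s ≤ t) :
    (t - s) * (1 - (q t - q s)) ≤ dist (path q s) (path q t) := by
  have h1 : (Complex.exp (-(q s) * Complex.I) * (path q t - path q s)).re =
      ∫ u in s..t, Real.cos (q u - q s) := by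
    rw [exp_mul_path_sub hq]
    have h := Complex.reCLM.intervalIntegral_comp_comm
      (intervalIntegrable_exp (q := fun u => q u - q s) (fun a b h => by simpa using hq h) s t)
    simp only [Complex.reCLM_apply, Complex.exp_ofReal_mul_I_re] at h
    exact h.symm
  have h2 : (t - s) * (1 - (q t - q s)) ≤ ∫ u in s..t, Real.cos (q u - q s) := by
    have : (t - s) * (1 - (q t - q s)) = ∫ _ in s..t, (1 - (q t - q s)) := by
      rw [intervalIntegral.integral_const, smul_eq_mul]
    rw [this]
    refine intervalIntegral.integral_mono_on hst (by simp) ?_ fun u hu => ?_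
    · exact intervalIntegrable_of_bound
        (Real.measurable_cos.comp (hq.measurable.sub_const _)).aestronglyMeasurable 1
        (fun _ => Real.abs_cos_le_one _) s t
    · have := one_sub_le_cos (sub_nonneg.2 (hq hu.1))
      linarith [hq hu.2]
  rw [← h1] at h2
  refine h2.trans ((Complex.re_le_norm _).trans ?_)
  rw [norm_mul, ← Complex.ofReal_neg, Complex.norm_exp_ofReal_mul_I, one_mul, dist_comm,
    dist_eq_norm]

namespace IsTurning

variable {q : ℝ → ℝ} (hq : IsTurning q)

include hq

theorem hausdorffMeasure_range_path (hi : (interior (body q)).Nonempty) :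
    μH[1] (range (path q)) = 1 := by
  refine le_antisymm ?_ ?_
  · rw [hq.range_path_eq_image_Icc]
    refine ((lipschitzWith_path hq.mono).hausdorffMeasure_image_le zero_le_one _).trans ?_
    simp [hausdorffMeasure_real]
  have hn : ∀ n : ℕ, ENNReal.ofReal (1 - 2 * Real.pi / (n + 1 : ℕ)) ≤ μH[1] (range (path q)) := by
    intro n
    have hpos : (0 : ℝ) < (n + 1 : ℕ) := by positivity
    have ht : StrictMono fun j : ℕ => (j : ℝ) / (n + 1 : ℕ) := fun i j hij => by
      have : (i : ℝ) < j := by exact_mod_cast hij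
      exact div_lt_div_of_pos_right this hpos
    have h := sum_edist_le_hausdorffMeasure_image (continuous_path hq.mono) ht (n + 1) (by
      have := hq.injOn_path hi 0
      rwa [zero_add, ← div_self hpos.ne', ← zero_div ((n + 1 : ℕ) : ℝ), ← Nat.cast_zero] at this)
    refine le_trans ?_ (h.trans (measure_mono (image_subset_range _ _)))
    -- Each of the `n + 1` pieces has length `1 / (n + 1)`, and the turnings add up to `2π`; the
    -- inscribed polygon thus misses at most `2π / (n + 1)`.
    have hsum : 1 - 2 * Real.pi / (n + 1 : ℕ) ≤ ∑ j ∈ Finset.range (n + 1),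
        dist (path q (j / (n + 1 : ℕ))) (path q ((j + 1 : ℕ) / (n + 1 : ℕ))) := by
      have hle : ∀ j ∈ Finset.range (n + 1), 1 / (n + 1 : ℕ) -
          (q ((j + 1 : ℕ) / (n + 1 : ℕ)) - q (j / (n + 1 : ℕ))) / (n + 1 : ℕ) ≤
          dist (path q (j / (n + 1 : ℕ))) (path q ((j + 1 : ℕ) / (n + 1 : ℕ))) := by
        intro j _
        refine le_trans (le_of_eq ?_) (le_dist_path hq.mono (ht (Nat.lt_succ_self j)).le)
        push_cast
        field_simp
        ring
      refine le_trans (le_of_eq ?_) (Finset.sum_le_sum hle)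
      rw [Finset.sum_sub_distrib, ← Finset.sum_div, ← Finset.sum_div,
        Finset.sum_range_sub (fun j : ℕ => q (j / (n + 1 : ℕ)))]
      have := hq.add_one 0
      rw [zero_add] at this
      rw [div_self hpos.ne', Nat.cast_zero, zero_div, this]
      simp only [Finset.sum_const, Finset.card_range, nsmul_eq_mul, mul_one]
      rw [div_self hpos.ne', add_sub_cancel_left]
    refine (ENNReal.ofReal_le_ofReal hsum).trans (le_of_eq ?_)
    rw [ENNReal.ofReal_sum_of_nonneg fun _ _ => dist_nonneg]
    simp only [edist_dist]
  have hlim : Tendsto (fun n : ℕ => ENNReal.ofReal (1 - 2 * Real.pi / (n + 1 : ℕ))) atTop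
      (𝓝 (ENNReal.ofReal (1 - 0))) := by
    refine ENNReal.tendsto_ofReal (tendsto_const_nhds.sub ?_)
    exact (tendsto_const_div_atTop_nhds_zero_nat (2 * Real.pi)).comp (tendsto_add_atTop_nat 1)
  simpa using le_of_tendsto' hlim hn

theorem hausdorffMeasure_body (hi : interior (body q) = ∅) : μH[1] (body q) = 2⁻¹ := by
  obtain ⟨φ, hφ⟩ := exists_im_eq_zero_of_interior_eq_empty convex_body zero_mem_body hi
  have hm := hq.mono
  have hflat : ∀ a b, height q φ a b = 0 := fun a b => by
    rw [← im_exp_mul_path_sub hm, mul_sub, Complex.sub_im, hφ _ (path_mem_body b),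
      hφ _ (path_mem_body a), sub_zero]
  obtain ⟨s, hs1, hs2⟩ := hq.exists_isTangent φ
  obtain ⟨c, hc1, hc2⟩ := hq.exists_isTangent (φ + Real.pi)
  have hpi := Real.pi_pos
  have hsc : s ≤ c := by
    by_contra! h
    obtain ⟨u, hu⟩ := exists_between h
    linarith [hs1 u hu.2, hc2 u hu.1]
  have hlt : ∀ u < s + 1, q u < φ + 2 * Real.pi := fun u hu => by
    have := hq.add_one (u - 1)
    rw [sub_add_cancel] at this
    linarith [hs1 (u - 1) (by linarith)]
  have hcs : c ≤ s + 1 := by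
    by_contra! h
    obtain ⟨u, hu⟩ := exists_between h
    have := hq.add_one (u - 1)
    rw [sub_add_cancel] at this
    linarith [hs2 (u - 1) (by linarith [hu.1]), hc1 u hu.2]
  -- An angle strictly between `φ` and `φ + π` on an interval would produce height. So the curve
  -- goes out in direction `φ`, then back in direction `φ + π`.
  have h1 : ∀ u ∈ Ioo s c, q u = φ := by
    intro u hu
    refine le_antisymm ?_ (hs2 u hu.1)
    by_contra! h
    exact (height_pos hm hu.2 (φ := φ) fun v hv =>
      ⟨h.trans_le (hm hv.1.le), hc1 v hv.2⟩).ne' (hflat _ _)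
  have h2 : ∀ u ∈ Ioo c (s + 1), q u = φ + Real.pi := by
    intro u hu
    refine le_antisymm ?_ (hc2 u hu.1)
    by_contra! h
    exact (height_neg hm hu.2 (φ := φ) fun v hv =>
      ⟨h.trans_le (hm hv.1.le), hlt v hv.2⟩).ne (hflat _ _)
  have hexp : Complex.exp ((φ + Real.pi : ℝ) * Complex.I) = -Complex.exp (φ * Complex.I) := by
    rw [Complex.ofReal_add, add_mul, Complex.exp_add, Complex.exp_pi_mul_I, mul_neg_one]
  have hp1 : ∀ t ∈ Icc s c, path q t = path q s + (t - s : ℝ) * Complex.exp (φ * Complex.I) :=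
    fun t ht => by
      rw [← path_sub_of_eq hm ht.1 fun u hu => h1 u ⟨hu.1, hu.2.trans_le ht.2⟩]
      ring
  have hp2 : ∀ t ∈ Icc c (s + 1),
      path q t = path q c - (t - c : ℝ) * Complex.exp (φ * Complex.I) := fun t ht => by
    have := path_sub_of_eq hm ht.1 fun u hu => h2 u ⟨hu.1, hu.2.trans_le ht.2⟩
    rw [hexp] at this
    linear_combination this
  -- The curve closes, so the way out is as long as the way back.
  have hc : c = s + 1 / 2 := by
    have h3 := hp2 (s + 1) ⟨hcs, le_rfl⟩
    rw [hq.path_add_one, hp1 c ⟨hsc, le_rfl⟩] at h3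
    have h4 : ((2 * c - 2 * s - 1 : ℝ) : ℂ) * Complex.exp (φ * Complex.I) = 0 := by
      push_cast at h3 ⊢
      linear_combination -h3
    have h5 := (mul_eq_zero.1 h4).resolve_right (Complex.exp_ne_zero _)
    norm_cast at h5
    linarith
  have hpc : path q c = path q s + (1 / 2 : ℝ) * Complex.exp (φ * Complex.I) := by
    rw [hp1 c ⟨hsc, le_rfl⟩, hc, add_sub_cancel_left]
  have hseg : body q = segment ℝ (path q s) (path q c) := by
    refine Subset.antisymm (convexHull_min ?_ (convex_segment _ _))
      (convex_body.segment_subset (path_mem_body s) (path_mem_body c))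
    have hmem : ∀ r ∈ Icc (0 : ℝ) (1 / 2), path q s + (r : ℂ) * Complex.exp (φ * Complex.I) ∈
        segment ℝ (path q s) (path q c) := by
      intro r hr
      rw [segment_eq_image']
      refine ⟨2 * r, ⟨by linarith [hr.1], by linarith [hr.2]⟩, ?_⟩
      rw [hpc]
      simp only [Complex.real_smul]
      push_cast
      ring
    rw [hq.range_path s]
    rintro _ ⟨t, ht, rfl⟩
    rcases le_total t c with htc | htc
    · rw [hp1 t ⟨ht.1, htc⟩]
      exact hmem _ ⟨by linarith [ht.1], by linarith⟩
    · have : path q t = path q s + (s + 1 - t : ℝ) * Complex.exp (φ * Complex.I) := by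
        rw [hp2 t ⟨htc, ht.2.le⟩, hpc, hc]
        push_cast
        ring
      rw [this]
      exact hmem _ ⟨by linarith [ht.2], by linarith⟩
  rw [hseg, hausdorffMeasure_segment, hpc, edist_dist, dist_self_add_right,
    norm_mul, Complex.norm_exp_ofReal_mul_I]
  rw [Complex.norm_real, Real.norm_of_nonneg (by norm_num), mul_one, one_div,
    ENNReal.ofReal_inv_of_pos two_pos]
  simp

theorem perimeter_body : perimeter (body q) = 1 := by
  unfold perimeter
  split_ifs with hi
  · rw [hq.frontier_body hi, hq.hausdorffMeasure_range_path hi]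
  · rw [hq.hausdorffMeasure_body (not_nonempty_iff_eq_empty.1 hi)]
    exact ENNReal.mul_inv_cancel (by simp) (by simp)

end IsTurning

/-! ### Green's formula for the area of the hull. -/

/-- The area enclosed by the closed curve of tangent angle `q`, by Green's formula. -/
def enclosedArea (q : ℝ → ℝ) : ℝ := ∫ t in (0 : ℝ)..1, -height q (q t) 0 t / 2

/-- The point `y` is the radial projection of `x` from `p`, with `r` the gauge of `C` centred at
`p`. This gives surjectivity, up to a null set, of polar coordinates around `p`. -/
theorem exists_frontier_of_mem_interior {C : Set ℂ} (hC : Convex ℝ C) (hcomp : IsCompact C)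
    {p x : ℂ} (hp : p ∈ interior C) (hx : x ∈ interior C) (hxp : x ≠ p) :
    ∃ y ∈ frontier C, ∃ r ∈ Ioo (0 : ℝ) 1, x = p + r * (y - p) := by
  set e : ℂ ≃ₜ ℂ := Homeomorph.addLeft p
  set D : Set ℂ := e ⁻¹' C with hD
  have hDc : Convex ℝ D := hC.translate_preimage_right p
  have hD0 : D ∈ 𝓝 (0 : ℂ) := by
    rw [← mem_interior_iff_mem_nhds, hD, ← e.preimage_interior]
    simpa [e] using hp
  have hDb : Bornology.IsVonNBounded ℝ D :=
    (NormedSpace.isVonNBounded_iff ℝ).2 (e.isCompact_preimage.2 hcomp).isBounded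
  set g := gauge D (x - p)
  have hg0 : 0 < g := (gauge_pos (absorbent_nhds_zero hD0) hDb).2 (sub_ne_zero.2 hxp)
  have hg1 : g < 1 := by
    refine (gauge_lt_one_iff_mem_interior hDc hD0).2 ?_
    rw [hD, ← e.preimage_interior]
    simpa [e] using hx
  have hfr : g⁻¹ • (x - p) ∈ frontier D := by
    refine (gauge_eq_one_iff_mem_frontier hDc hD0).1 ?_
    rw [gauge_smul_of_nonneg (inv_nonneg.2 hg0.le), smul_eq_mul]
    exact inv_mul_cancel₀ hg0.ne'
  rw [hD, ← e.preimage_frontier] at hfr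
  refine ⟨p + g⁻¹ • (x - p), hfr, g, ⟨hg0, hg1⟩, ?_⟩
  have : (g : ℂ) ≠ 0 := by exact_mod_cast hg0.ne'
  rw [Complex.real_smul, add_sub_cancel_left]
  push_cast
  field_simp
  ring

theorem add_mul_sub_mem_interior {C : Set ℂ} (hC : Convex ℝ C) {p y : ℂ} (hp : p ∈ interior C)
    (hy : y ∈ C) {r : ℝ} (hr : r ∈ Ico (0 : ℝ) 1) : p + r * (y - p) ∈ interior C := by
  have := hC.add_smul_sub_mem_interior hy hp (t := 1 - r) ⟨by linarith [hr.2], by linarith [hr.1]⟩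
  convert this using 1
  rw [Complex.real_smul]
  push_cast
  ring

theorem hasDerivAt_path {q : ℝ → ℝ} (hq : Monotone q) {t : ℝ} (ht : ContinuousAt q t) :
    HasDerivAt (path q) (Complex.exp ((q t : ℂ) * Complex.I)) t := by
  refine intervalIntegral.integral_hasDerivAt_right (intervalIntegrable_exp hq _ _)
    (measurable_exp_mul_I hq).stronglyMeasurable.stronglyMeasurableAtFilter ?_
  have : Continuous fun x : ℝ => Complex.exp ((x : ℂ) * Complex.I) := by fun_prop
  exact this.continuousAt.comp ht

theorem volume_segment_eq_zero (x y : ℂ) : volume (segment ℝ x y) = 0 := by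
  have h : segment ℝ x y ⊆ AffineSubspace.mk' x (Submodule.span ℝ {y - x}) := by
    rw [segment_eq_image']
    rintro _ ⟨t, -, rfl⟩
    rw [SetLike.mem_coe, AffineSubspace.mem_mk']
    simpa using Submodule.smul_mem _ t (Submodule.mem_span_singleton_self (y - x))
  refine measure_mono_null h (Measure.addHaar_affineSubspace _ _ fun htop => ?_)
  have h1 := congrArg AffineSubspace.direction htop
  rw [AffineSubspace.direction_mk', AffineSubspace.direction_top] at h1
  have h2 := finrank_span_le_card (R := ℝ) ({y - x} : Set ℂ)
  rw [h1, finrank_top, Complex.finrank_real_complex] at h2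
  simp at h2

theorem im_exp_mul (φ : ℝ) (x : ℂ) : (Complex.exp (-φ * Complex.I) * x).im =
    Real.cos φ * x.im - Real.sin φ * x.re := by
  rw [← Complex.ofReal_neg, Complex.mul_im, Complex.exp_ofReal_mul_I_re,
    Complex.exp_ofReal_mul_I_im, Real.cos_neg, Real.sin_neg]
  ring

namespace IsTurning

variable {q : ℝ → ℝ} (hq : IsTurning q)

include hq

theorem integral_cos : ∫ t in (0 : ℝ)..1, Real.cos (q t) = 0 := by
  have h := Complex.reCLM.intervalIntegral_comp_comm (intervalIntegrable_exp hq.mono 0 1)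
  rw [hq.closed] at h
  simpa [Complex.exp_ofReal_mul_I_re] using h

theorem integral_sin : ∫ t in (0 : ℝ)..1, Real.sin (q t) = 0 := by
  have h := Complex.imCLM.intervalIntegral_comp_comm (intervalIntegrable_exp hq.mono 0 1)
  rw [hq.closed] at h
  simpa [Complex.exp_ofReal_mul_I_im] using h

omit hq in
theorem path_zero : path q 0 = 0 := intervalIntegral.integral_same

theorem neg_height_zero (t : ℝ) :
    -height q (q t) 0 t = Real.sin (q t) * (path q t).re - Real.cos (q t) * (path q t).im := by
  rw [← im_exp_mul_path_sub hq.mono, path_zero, sub_zero, im_exp_mul]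
  ring

/-- Green's integral does not depend on the base point, because the cosine and the sine of the
tangent angle integrate to zero. -/
theorem integral_height_sub (p : ℂ) :
    ∫ t in (0 : ℝ)..1, -(Complex.exp (-(q t) * Complex.I) * (path q t - p)).im =
      2 * enclosedArea q := by
  have hm := hq.mono.measurable
  have hc := continuous_path hq.mono
  have hI : ∀ f : ℝ → ℝ, Measurable f → (∀ x, ‖f x‖ ≤ 1) → ∀ g : ℝ → ℝ, Continuous g →
      IntervalIntegrable (fun t => f t * g t) volume 0 1 := fun f hf hb g hg =>
    (intervalIntegrable_of_bound hf.aestronglyMeasurable 1 hb 0 1).mul_continuousOn hg.continuousOn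
  have hs : ∀ g : ℝ → ℝ, Continuous g →
      IntervalIntegrable (fun t => Real.sin (q t) * g t) volume 0 1 := hI _ (Real.measurable_sin.comp hm) (fun _ => Real.abs_sin_le_one _)
  have hcs : ∀ g : ℝ → ℝ, Continuous g →
      IntervalIntegrable (fun t => Real.cos (q t) * g t) volume 0 1 := hI _ (Real.measurable_cos.comp hm) (fun _ => Real.abs_cos_le_one _)
  have hre : Continuous fun t => (path q t).re := Complex.continuous_re.comp hc
  have him : Continuous fun t => (path q t).im := Complex.continuous_im.comp hc
  have h1 : ∀ t, -(Complex.exp (-(q t) * Complex.I) * (path q t - p)).im =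
      (Real.sin (q t) * (path q t).re - Real.cos (q t) * (path q t).im) +
      (Real.cos (q t) * p.im - Real.sin (q t) * p.re) := by
    intro t
    rw [im_exp_mul, Complex.sub_im, Complex.sub_re]
    ring
  simp only [enclosedArea, hq.neg_height_zero, h1]
  rw [intervalIntegral.integral_div, mul_div_cancel₀ _ two_ne_zero,
    intervalIntegral.integral_add ((hs _ hre).sub (hcs _ him))
      ((hcs _ continuous_const).sub (hs _ continuous_const)),
    intervalIntegral.integral_sub (hcs _ continuous_const) (hs _ continuous_const)]
  simp [hq.integral_cos, hq.integral_sin]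

theorem volume_body_of_interior_nonempty (hi : (interior (body q)).Nonempty) :
    volume (body q) = ENNReal.ofReal (enclosedArea q) := by
  obtain ⟨p, hp⟩ := hi
  have hi : (interior (body q)).Nonempty := ⟨p, hp⟩
  have hC : Convex ℝ (body q) := convex_body
  -- Polar coordinates `(r, t) ↦ p + r (path q t - p)`, restricted to the continuity points of `q`,
  -- where the curve is differentiable. The Jacobian is `r * J t`, with `J t` the height of `p` over
  -- the tangent line at `t`, so the integral is `1/2` times twice the enclosed area.
  set T : Set ℝ := Ico 0 1 ∩ {t | ContinuousAt q t} with hT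
  have hbad : {t | ¬ ContinuousAt q t}.Countable := hq.mono.countable_not_continuousAt
  have hTm : MeasurableSet T := by
    refine measurableSet_Ico.inter ?_
    have := hbad.measurableSet.compl
    simpa [compl_ofPred] using this
  set s : Set (ℝ × ℝ) := Ioo 0 1 ×ˢ T with hs
  have hsm : MeasurableSet s := measurableSet_Ioo.prod hTm
  set F : ℝ × ℝ → ℂ := fun x => p + x.1 * (path q x.2 - p) with hF
  set Φ : ℝ × ℝ → ℝ × ℝ := fun x =>
    (p.re + x.1 * ((path q x.2).re - p.re), p.im + x.1 * ((path q x.2).im - p.im)) with hΦ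
  have hΦF : ∀ x, Φ x = Complex.measurableEquivRealProd (F x) := fun x => by
    rw [Complex.measurableEquivRealProd_apply]
    simp [hΦ, hF]
  set Φ' : ℝ × ℝ → ℝ × ℝ →L[ℝ] ℝ × ℝ := fun x =>
    (Matrix.toLin (Module.Basis.finTwoProd ℝ) (Module.Basis.finTwoProd ℝ)
      !![(path q x.2).re - p.re, x.1 * Real.cos (q x.2);
        (path q x.2).im - p.im, x.1 * Real.sin (q x.2)]).toContinuousLinearMap with hΦ'
  set J : ℝ → ℝ := fun t => -(Complex.exp (-(q t) * Complex.I) * (path q t - p)).im with hJ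
  have hdet : ∀ x, (Φ' x).det = x.1 * J x.2 := by
    intro x
    rw [hΦ', LinearMap.det_toContinuousLinearMap, LinearMap.det_toLin, Matrix.det_fin_two_of, hJ]
    simp only [im_exp_mul, Complex.sub_re, Complex.sub_im]
    ring
  have hJ0 : ∀ t, 0 ≤ J t := by
    intro t
    have := hq.im_nonneg (isTangent_self hq.mono t) (interior_subset hp)
    rw [hJ]
    simp only
    rw [← neg_sub p, mul_neg, Complex.neg_im, neg_neg]
    exact this
  have hJm : Measurable J := by
    have h1 : Measurable fun t => Complex.exp (-(q t) * Complex.I) :=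
      Complex.measurable_exp.comp
        ((Complex.measurable_ofReal.comp hq.mono.measurable).neg.mul_const _)
    exact (Complex.measurable_im.comp
      (h1.mul ((continuous_path hq.mono).measurable.sub_const _))).neg
  have hderiv : ∀ x ∈ s, HasFDerivWithinAt Φ (Φ' x) s x := by
    rintro x ⟨-, -, hx⟩
    refine HasFDerivAt.hasFDerivWithinAt ?_
    have hZ := hasDerivAt_path hq.mono (t := x.2) hx
    have hre : HasDerivAt (fun t => (path q t).re) (Real.cos (q x.2)) x.2 := by
      have := Complex.reCLM.hasFDerivAt.comp_hasDerivAt x.2 hZ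
      simpa [Complex.exp_ofReal_mul_I_re, Function.comp_def] using this
    have him : HasDerivAt (fun t => (path q t).im) (Real.sin (q x.2)) x.2 := by
      have := Complex.imCLM.hasFDerivAt.comp_hasDerivAt x.2 hZ
      simpa [Complex.exp_ofReal_mul_I_im, Function.comp_def] using this
    rw [hΦ']
    simp only
    rw [Matrix.toLin_finTwoProd_toContinuousLinearMap]
    have h1 := ((hasFDerivAt_fst (𝕜 := ℝ) (p := x)).mul
      ((hre.comp_hasFDerivAt x (hasFDerivAt_snd (𝕜 := ℝ) (p := x))).sub_const p.re)).const_add p.re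
    have h2 := ((hasFDerivAt_fst (𝕜 := ℝ) (p := x)).mul
      ((him.comp_hasFDerivAt x (hasFDerivAt_snd (𝕜 := ℝ) (p := x))).sub_const p.im)).const_add p.im
    convert h1.prodMk h2 using 2 <;>
    · ext <;> simp [hΦ]
  have hinjF : InjOn F s := by
    rintro ⟨r, t⟩ ⟨hr, ht, -⟩ ⟨r', t'⟩ ⟨hr', ht', -⟩ h
    have key : ∀ {r t r' t' : ℝ}, r ∈ Ioo (0 : ℝ) 1 → r' ∈ Ioo (0 : ℝ) 1 →
        p + r * (path q t - p) = p + r' * (path q t' - p) → ¬ r < r' := by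
      intro r t r' t' hr hr' h hlt
      -- If `r < r'`, the boundary point with parameter `t'` would lie strictly between the interior
      -- point `p` and a point of the body.
      refine hq.path_notMem_interior t' ?_
      have h2 : path q t' = p + (r / r' : ℝ) * (path q t - p) := by
        have : (r' : ℂ) ≠ 0 := by exact_mod_cast hr'.1.ne'
        push_cast
        field_simp
        linear_combination -h
      rw [h2]
      exact add_mul_sub_mem_interior hC hp (path_mem_body t)
        ⟨div_nonneg hr.1.le hr'.1.le, (div_lt_one hr'.1).2 hlt⟩
    have hrr : r = r' := le_antisymm (not_lt.1 (key hr' hr h.symm)) (not_lt.1 (key hr hr' h))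
    subst hrr
    have hr0 : (r : ℂ) ≠ 0 := by exact_mod_cast hr.1.ne'
    have : path q t = path q t' := by
      have := mul_left_cancel₀ hr0 (add_left_cancel h)
      simpa using this
    have h01 := hq.injOn_path hi 0
    rw [zero_add] at h01
    exact Prod.ext rfl (h01 ht ht' this)
  have hinj : InjOn Φ s := fun x hx y hy h =>
    hinjF hx hy (Complex.measurableEquivRealProd.injective (by rw [← hΦF, ← hΦF, h]))
  have himage : Φ '' s = Complex.measurableEquivRealProd '' (F '' s) := by
    rw [image_image]
    exact image_congr fun x _ => hΦF x
  have hvol : volume (body q) = volume (Φ '' s) := by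
    have h1 : volume (Φ '' s) = volume (F '' s) := by
      rw [himage, ← Complex.volume_preserving_equiv_real_prod.measure_preimage_equiv,
        preimage_image_eq _ Complex.measurableEquivRealProd.injective]
    rw [h1]
    refine le_antisymm ?_ (measure_mono ?_)
    -- The coordinates miss only the boundary, the centre and the countably many segments towards
    -- discontinuities of `q`, all of them null.
    · have hsub : body q ⊆ F '' s ∪ (frontier (body q) ∪ ({p} ∪
          ⋃ t ∈ {t | ¬ ContinuousAt q t}, segment ℝ p (path q t))) := by
        intro x hx
        by_cases hxi : x ∈ interior (body q)
        swap
        · exact Or.inr (Or.inl ⟨subset_closure hx, hxi⟩)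
        by_cases hxp : x = p
        · exact Or.inr (Or.inr (Or.inl hxp))
        obtain ⟨y, hy, r, hr, rfl⟩ :=
          exists_frontier_of_mem_interior hC hq.isCompact_body hp hxi hxp
        have hy' := hq.frontier_subset_range hi hy
        rw [hq.range_path 0, zero_add] at hy'
        obtain ⟨t, ht, rfl⟩ := hy'
        by_cases hct : ContinuousAt q t
        · exact Or.inl ⟨(r, t), ⟨hr, ht, hct⟩, rfl⟩
        · refine Or.inr (Or.inr (Or.inr (mem_iUnion₂.2 ⟨t, hct, ?_⟩)))
          rw [segment_eq_image']
          exact ⟨r, ⟨hr.1.le, hr.2.le⟩, by simp⟩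
      refine (measure_mono hsub).trans ((measure_union_le _ _).trans (le_of_eq ?_))
      rw [measure_union_null (hC.addHaar_frontier volume) (measure_union_null (by simp)
        ((measure_biUnion_null_iff hbad).2 fun t _ => volume_segment_eq_zero _ _)), add_zero]
    · rintro _ ⟨⟨r, t⟩, ⟨hr, -⟩, rfl⟩
      exact interior_subset (add_mul_sub_mem_interior hC hp (path_mem_body t) ⟨hr.1.le, hr.2⟩)
  have hTae : T =ᵐ[volume] Ioc (0 : ℝ) 1 := by
    have h1 : T =ᵐ[volume] (Ico 0 1 : Set ℝ) := by
      refine inter_ae_eq_left_of_ae_eq_univ ?_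
      rw [ae_eq_univ]
      exact hbad.measure_zero volume
    exact h1.trans Ico_ae_eq_Ioc
  have hJI : IntegrableOn J (Ioc 0 1) := by
    have hb : ∃ K, ∀ t ∈ Ioc (0 : ℝ) 1, ‖J t‖ ≤ K := by
      obtain ⟨K, hK⟩ := (isCompact_Icc (a := (0 : ℝ)) (b := 1)).exists_bound_of_continuousOn
        ((continuous_path hq.mono).sub continuous_const (g := fun _ => p)).continuousOn
      refine ⟨K, fun t ht => ?_⟩
      rw [hJ]
      simp only
      rw [norm_neg]
      refine (Complex.abs_im_le_norm _).trans ?_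
      rw [norm_mul, ← Complex.ofReal_neg, Complex.norm_exp_ofReal_mul_I, one_mul]
      exact hK t ⟨ht.1.le, ht.2⟩
    obtain ⟨K, hK⟩ := hb
    exact Measure.integrableOn_of_bounded (by simp) hJm.aestronglyMeasurable
      ((ae_restrict_iff' measurableSet_Ioc).2 (ae_of_all _ hK))
  have hJint : ∫⁻ t in T, ENNReal.ofReal (J t) = ENNReal.ofReal (2 * enclosedArea q) := by
    rw [Measure.restrict_congr_set hTae, ← hq.integral_height_sub p,
      intervalIntegral.integral_of_le zero_le_one,
      ofReal_integral_eq_lintegral_ofReal hJI (ae_of_all _ hJ0)]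
  have hrint : ∫⁻ r in Ioo (0 : ℝ) 1, ENNReal.ofReal r = ENNReal.ofReal (1 / 2) := by
    rw [Measure.restrict_congr_set Ioo_ae_eq_Ioc, ← ofReal_integral_eq_lintegral_ofReal,
      ← intervalIntegral.integral_of_le zero_le_one]
    · simp
    · exact (intervalIntegrable_iff_integrableOn_Ioc_of_le zero_le_one).1 (by simp)
    · exact (ae_restrict_iff' measurableSet_Ioc).2 (ae_of_all _ fun x hx => hx.1.le)
  rw [hvol, ← lintegral_abs_det_fderiv_eq_addHaar_image volume hsm hderiv hinj]
  have h1 : ∫⁻ x in s, ENNReal.ofReal |(Φ' x).det| =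
      ∫⁻ x in s, ENNReal.ofReal x.1 * ENNReal.ofReal (J x.2) := by
    refine setLIntegral_congr_fun hsm fun x hx => ?_
    have h0 : 0 ≤ x.1 := hx.1.1.le
    rw [hdet, abs_of_nonneg (mul_nonneg h0 (hJ0 _)), ENNReal.ofReal_mul h0]
  rw [h1, hs, Measure.volume_eq_prod, ← Measure.prod_restrict,
    lintegral_prod_mul (f := fun r => ENNReal.ofReal r) (g := fun t => ENNReal.ofReal (J t))
      (by fun_prop) (by fun_prop), hrint, hJint,
    ← ENNReal.ofReal_mul (by norm_num)]
  congr 1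
  ring

theorem volume_body : volume (body q) = ENNReal.ofReal (enclosedArea q) := by
  rcases (interior (body q)).eq_empty_or_nonempty with hi | hi
  swap
  · exact hq.volume_body_of_interior_nonempty hi
  have h0 : volume (body q) = 0 := by
    have := (convex_body (q := q)).addHaar_frontier volume
    rwa [hq.isCompact_body.isClosed.frontier_eq, hi, sdiff_empty] at this
  obtain ⟨φ, hφ⟩ := exists_im_eq_zero_of_interior_eq_empty convex_body zero_mem_body hi
  have hsin : ∀ t, ContinuousAt q t → Real.sin (q t - φ) = 0 := by
    intro t ht
    have h1 := Complex.imCLM.hasFDerivAt.comp_hasDerivAt t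
      ((hasDerivAt_path hq.mono ht).const_mul (Complex.exp (-φ * Complex.I)))
    have h2 : (Complex.imCLM ∘ fun y => Complex.exp (-φ * Complex.I) * path q y) =
        fun _ => (0 : ℝ) := funext fun y => hφ _ (path_mem_body y)
    rw [h2] at h1
    have h3 := h1.unique (hasDerivAt_const t (0 : ℝ))
    rw [Complex.imCLM_apply, im_exp_mul, Complex.exp_ofReal_mul_I_im,
      Complex.exp_ofReal_mul_I_re] at h3
    rw [Real.sin_sub]
    linarith
  -- Position and tangent are both parallel to the line that contains the body, for almost every
  -- parameter; their cross product is the integrand.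
  have harea : enclosedArea q = 0 := by
    refine intervalIntegral.integral_zero_ae ?_
    filter_upwards [hq.mono.countable_not_continuousAt.ae_notMem volume] with t ht _
    have h1 := hsin t (not_not.1 ht)
    have h2 := hφ _ (path_mem_body t)
    rw [im_exp_mul] at h2
    rw [Real.sin_sub] at h1
    rw [hq.neg_height_zero]
    have h3 := Real.sin_sq_add_cos_sq φ
    have : Real.sin (q t) * (path q t).re - Real.cos (q t) * (path q t).im = 0 := by
      have e1 : Real.sin (q t) * (path q t).re - Real.cos (q t) * (path q t).im =
        (Real.sin (q t) * Real.cos φ - Real.cos (q t) * Real.sin φ) *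
          (Real.cos φ * (path q t).re + Real.sin φ * (path q t).im) -
        (Real.cos (q t) * Real.cos φ + Real.sin (q t) * Real.sin φ) *
          (Real.cos φ * (path q t).im - Real.sin φ * (path q t).re) := by
        linear_combination (-(Real.sin (q t) * (path q t).re -
          Real.cos (q t) * (path q t).im)) * h3
      rw [e1, h1, h2]
      ring
    rw [this, zero_div]
  rw [h0, harea, ENNReal.ofReal_zero]

end IsTurning

/-! ### Fourier expansion of the area and the bound `1 / (4π)`. -/

/-- The kernel whose double integral against the edge-direction measure is the area. -/
def areaKernel (d : ℝ) : ℝ := (1 - d / Real.pi) * Real.sin d / 4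

theorem continuous_areaKernel : Continuous areaKernel := by
  unfold areaKernel
  fun_prop

theorem areaKernel_two_pi_sub (d : ℝ) : areaKernel (2 * Real.pi - d) = areaKernel d := by
  have := Real.pi_ne_zero
  rw [areaKernel, areaKernel, Real.sin_two_pi_sub]
  field_simp
  ring

theorem integral_exp_mul_areaKernel {n : ℤ} (hn : n ^ 2 ≠ 1) :
    ∫ x in (0 : ℝ)..(2 * Real.pi), Complex.exp (-(n * x * Complex.I)) * (areaKernel x : ℂ) =
      -1 / (2 * ((n : ℂ) ^ 2 - 1)) := by
  have hpi : (Real.pi : ℂ) ≠ 0 := by exact_mod_cast Real.pi_ne_zero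
  have hn' : (n : ℂ) ^ 2 - 1 ≠ 0 := by
    rw [sub_ne_zero]
    exact_mod_cast hn
  set N : ℂ := (n : ℂ) with hN
  have hE : ∀ x : ℝ, HasDerivAt (fun x : ℝ => Complex.exp (-(N * x * Complex.I)))
      (-(N * Complex.I) * Complex.exp (-(N * x * Complex.I))) x := by
    intro x
    have h1 : HasDerivAt (fun x : ℝ => -(N * (x : ℂ) * Complex.I)) (-(N * Complex.I)) x := by
      have := ((Complex.ofRealCLM.hasDerivAt (x := x)).const_mul N).mul_const Complex.I
      simp only [Complex.ofRealCLM_apply, Complex.ofReal_one, mul_one] at this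
      exact this.neg
    simpa [mul_comm] using h1.cexp
  have hsin : ∀ x : ℝ, HasDerivAt (fun x : ℝ => Complex.sin x) (Complex.cos x) x := fun x =>
    (Complex.hasDerivAt_sin x).comp_ofReal
  have hcos : ∀ x : ℝ, HasDerivAt (fun x : ℝ => Complex.cos x) (-Complex.sin x) x := fun x =>
    (Complex.hasDerivAt_cos x).comp_ofReal
  have hlin : ∀ x : ℝ, HasDerivAt (fun x : ℝ => 1 - (x : ℂ) / Real.pi) (-(1 / Real.pi)) x := by
    intro x
    simpa using ((Complex.ofRealCLM.hasDerivAt (x := x)).div_const (Real.pi : ℂ)).const_sub 1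
  -- The kernel `k` satisfies `k'' = -k - cos / (2π)`. Hence `exp (-iNx) (k' + iNk)` has derivative
  -- `exp (-iNx) ((N² - 1) k - cos / (2π))`, and the last bracket absorbs the cosine.
  set G : ℝ → ℂ := fun x => Complex.exp (-(N * x * Complex.I)) *
    (((1 - (x : ℂ) / Real.pi) * Complex.cos x - 1 / Real.pi * Complex.sin x) / 4 +
      N * Complex.I * ((1 - (x : ℂ) / Real.pi) * Complex.sin x / 4) -
      1 / (2 * Real.pi * (N ^ 2 - 1)) * (Complex.sin x - N * Complex.I * Complex.cos x)) /
      (N ^ 2 - 1) with hG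
  have hderiv : ∀ x : ℝ, HasDerivAt G
      (Complex.exp (-(N * x * Complex.I)) * (areaKernel x : ℂ)) x := by
    intro x
    have h1 := (hE x).mul ((((((hlin x).mul (hcos x)).sub ((hsin x).const_mul
      (1 / (Real.pi : ℂ)))).div_const 4).add ((((hlin x).mul (hsin x)).div_const 4).const_mul
      (N * Complex.I))).sub (((hsin x).sub ((hcos x).const_mul (N * Complex.I))).const_mul
      (1 / (2 * Real.pi * (N ^ 2 - 1)))))
    refine (h1.div_const (N ^ 2 - 1)).congr_deriv ?_
    simp only [Pi.mul_apply, Pi.sub_apply, Pi.add_apply, areaKernel]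
    push_cast
    have hI : Complex.I ^ 2 = -1 := Complex.I_sq
    field_simp
    ring_nf
    simp only [hI]
    ring
  rw [intervalIntegral.integral_eq_sub_of_hasDerivAt (fun x _ => hderiv x)]
  · have h2 : Complex.exp (-(N * ((2 * Real.pi : ℝ) : ℂ) * Complex.I)) = 1 := by
      rw [hN, Complex.exp_eq_one_iff]
      exact ⟨-n, by push_cast; ring⟩
    have h3 : Complex.cos ((2 * Real.pi : ℝ) : ℂ) = 1 := by
      rw [← Complex.ofReal_cos, Real.cos_two_pi, Complex.ofReal_one]
    have h4 : Complex.sin ((2 * Real.pi : ℝ) : ℂ) = 0 := by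
      rw [← Complex.ofReal_sin, Real.sin_two_pi, Complex.ofReal_zero]
    simp only [hG, h2, h3, h4]
    simp only [Complex.ofReal_zero, mul_zero, zero_mul, neg_zero, Complex.exp_zero,
      Complex.cos_zero, Complex.sin_zero, zero_div, sub_zero]
    push_cast
    field_simp
    ring
  · refine Continuous.intervalIntegrable ?_ _ _
    exact Continuous.mul (by fun_prop) (Complex.continuous_ofReal.comp continuous_areaKernel)

/-- The cosine coefficients of `areaKernel` on `[0, 2π]`. -/
theorem exists_areaKernel_hasSum : ∃ c : ℤ → ℝ, Summable (fun n => |c n|) ∧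
    c 0 = 1 / (4 * Real.pi) ∧ (∀ n : ℤ, n ≠ 0 → n ≠ 1 → n ≠ -1 → c n ≤ 0) ∧
    ∀ d ∈ Icc 0 (2 * Real.pi), HasSum (fun n : ℤ => c n * Real.cos (n * d)) (areaKernel d) := by
  have hpi := Real.pi_pos
  have : Fact (0 < 2 * Real.pi) := ⟨Real.two_pi_pos⟩
  set f : ℝ → ℂ := fun x => (areaKernel x : ℂ)
  have hf0 : areaKernel 0 = 0 := by simp [areaKernel]
  have hf2 : areaKernel (2 * Real.pi) = 0 := by simp [areaKernel]
  set F : C(AddCircle (2 * Real.pi), ℂ) := ⟨AddCircle.liftIco (2 * Real.pi) 0 f,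
    AddCircle.liftIco_zero_continuous (by simp [f, hf0, hf2])
      (Complex.continuous_ofReal.comp continuous_areaKernel).continuousOn⟩ with hF
  have hFd : ∀ d ∈ Icc 0 (2 * Real.pi), F (d : AddCircle (2 * Real.pi)) = areaKernel d := by
    intro d hd
    rcases hd.2.lt_or_eq with h | h
    · exact AddCircle.liftIco_zero_coe_apply (f := f) ⟨hd.1, h⟩
    · rw [h, AddCircle.coe_period, hf2, ← hf0]
      exact AddCircle.liftIco_zero_coe_apply (f := f) ⟨le_rfl, Real.two_pi_pos⟩
  -- The coefficients are negative except at `0`, where the sign of `n² - 1` changes. Those of index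
  -- `±1` need not be known, as the corresponding moments vanish.
  have hcoef : ∀ n : ℤ, n ^ 2 ≠ 1 →
      fourierCoeff F n = ((-1 / (4 * Real.pi * ((n : ℝ) ^ 2 - 1)) : ℝ) : ℂ) := by
    intro n hn
    have h1 : fourierCoeff F n = fourierCoeffOn (by rw [zero_add]; exact Real.two_pi_pos :
        (0 : ℝ) < 0 + 2 * Real.pi) f n := fourierCoeff_liftIco_eq f n
    rw [h1, fourierCoeffOn_eq_integral]
    have h2 : ∀ x : ℝ, fourier (-n) (x : AddCircle (0 + 2 * Real.pi - 0)) • f x =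
        Complex.exp (-(n * x * Complex.I)) * (areaKernel x : ℂ) := by
      intro x
      rw [fourier_coe_apply, smul_eq_mul]
      congr 2
      push_cast
      have : (Real.pi : ℂ) ≠ 0 := by exact_mod_cast hpi.ne'
      rw [zero_add, sub_zero]
      field_simp
    simp only [h2]
    rw [zero_add, integral_exp_mul_areaKernel hn, Complex.real_smul]
    have hn' : (n : ℂ) ^ 2 - 1 ≠ 0 := by
      rw [sub_ne_zero]
      exact_mod_cast hn
    have : (Real.pi : ℂ) ≠ 0 := by exact_mod_cast hpi.ne'
    push_cast
    rw [sub_zero]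
    field_simp
    norm_num
  have hsq : ∀ n : ℤ, n ≠ 1 → n ≠ -1 → n ^ 2 ≠ 1 := by
    intro n h1 h2 h3
    rcases sq_eq_one_iff.1 h3 with h | h
    exacts [h1 h, h2 h]
  have hge : ∀ n : ℤ, n ≠ 0 → n ≠ 1 → n ≠ -1 → (4 : ℝ) ≤ (n : ℝ) ^ 2 := by
    intro n h0 h1 h2
    have h3 : (2 : ℤ) ≤ |n| := by
      by_contra! h
      have := abs_lt.1 h
      omega
    have h4 : (2 : ℤ) ^ 2 ≤ n ^ 2 := by
      rw [← sq_abs n]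
      exact pow_le_pow_left₀ (by norm_num) h3 2
    exact_mod_cast h4
  have hsum : Summable fun n : ℤ => ‖fourierCoeff F n‖ := by
    refine Summable.of_norm_bounded_eventually
      (g := fun n : ℤ => 1 / (n : ℝ) ^ 2) (Real.summable_one_div_int_pow.2 one_lt_two) ?_
    have hfin : ({-1, 0, 1} : Set ℤ).Finite := toFinite _
    filter_upwards [hfin.compl_mem_cofinite] with n hn
    simp only [mem_compl_iff, mem_insert_iff, mem_singleton_iff, not_or] at hn
    have h4 := hge n hn.2.1 hn.2.2 hn.1
    rw [hcoef n (hsq n hn.2.2 hn.1), norm_norm, Complex.norm_real, Real.norm_eq_abs, abs_div,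
      abs_neg, abs_one, abs_of_pos (by nlinarith [Real.pi_gt_three])]
    refine one_div_le_one_div_of_le (by linarith) ?_
    nlinarith [Real.pi_gt_three]
  refine ⟨fun n => (fourierCoeff F n).re, ?_, ?_, ?_, ?_⟩
  · exact hsum.of_nonneg_of_le (fun n => abs_nonneg _) fun n => Complex.abs_re_le_norm _
  · simp only
    rw [hcoef 0 (by norm_num), Complex.ofReal_re]
    norm_num
  · intro n h0 h1 h2
    simp only
    rw [hcoef n (hsq n h1 h2), Complex.ofReal_re]
    have := hge n h0 h1 h2
    exact div_nonpos_of_nonpos_of_nonneg (by norm_num) (by nlinarith)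
  · intro d hd
    have key : ∀ d ∈ Icc 0 (2 * Real.pi), HasSum
        (fun n : ℤ => fourierCoeff F n * Complex.exp (n * d * Complex.I)) (areaKernel d) := by
      intro d hd
      have := has_pointwise_sum_fourier_series_of_summable hsum.of_norm
        (d : AddCircle (2 * Real.pi))
      rw [hFd d hd] at this
      convert! this using 2 with n
      rw [fourier_coe_apply, smul_eq_mul]
      congr 2
      have : (Real.pi : ℂ) ≠ 0 := by exact_mod_cast hpi.ne'
      push_cast
      field_simp
    have h1 := key d hd
    -- Averaging the series at `d` and at `2π - d` cancels the sines and leaves a cosine series.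
    have h2 := key (2 * Real.pi - d) ⟨by linarith [hd.2], by linarith [hd.1]⟩
    rw [areaKernel_two_pi_sub] at h2
    have h3 := Complex.hasSum_re ((h1.add h2).div_const 2)
    convert! h3 using 2 with n
    · have h4 : Complex.exp (n * ((2 * Real.pi - d : ℝ) : ℂ) * Complex.I) =
          Complex.exp (-(n * d) * Complex.I) := by
        have : (n * ((2 * Real.pi - d : ℝ) : ℂ) * Complex.I) =
            n * (2 * Real.pi * Complex.I) + -(n * d) * Complex.I := by
          push_cast
          ring
        rw [this, Complex.exp_add, Complex.exp_int_mul_two_pi_mul_I, one_mul]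
      have h5 : fourierCoeff F n * Complex.exp (n * d * Complex.I) +
          fourierCoeff F n * Complex.exp (n * ((2 * Real.pi - d : ℝ) : ℂ) * Complex.I) =
          fourierCoeff F n * ((Real.cos (n * d) : ℝ) : ℂ) * 2 := by
        rw [h4, Complex.ofReal_cos, ← mul_add, Complex.cos]
        push_cast
        ring
      rw [h5, mul_div_cancel_right₀ _ two_ne_zero, Complex.re_mul_ofReal]
    · rw [add_self_div_two, Complex.ofReal_re]

/-- The `n`-th Fourier coefficient of the edge-direction measure of the curve of tangent
angle `q`. -/
def moment (q : ℝ → ℝ) (n : ℤ) : ℂ :=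
  ∫ u in (0 : ℝ)..1, Complex.exp (((n * q u : ℝ) : ℂ) * Complex.I)

theorem intervalIntegrable_comp {q : ℝ → ℝ} (hq : Measurable q) {f : ℝ → ℝ} (hf : Measurable f)
    (hb : ∀ x, |f x| ≤ 1) (a b : ℝ) : IntervalIntegrable (fun u => f (q u)) volume a b :=
  intervalIntegrable_of_bound (hf.comp hq).aestronglyMeasurable 1 (fun _ => hb _) a b

theorem moment_eq {q : ℝ → ℝ} (hq : Measurable q) (n : ℤ) :
    moment q n = ⟨∫ u in (0 : ℝ)..1, Real.cos (n * q u), ∫ u in (0 : ℝ)..1, Real.sin (n * q u)⟩ := by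
  have hI : IntervalIntegrable (fun u => Complex.exp (((n * q u : ℝ) : ℂ) * Complex.I))
      volume 0 1 :=
    intervalIntegrable_of_bound (Complex.measurable_exp.comp
      ((Complex.measurable_ofReal.comp (hq.const_mul _)).mul_const _)).aestronglyMeasurable 1
      (fun _ => norm_exp_ofReal_mul_I_le _) 0 1
  apply Complex.ext
  · have h := Complex.reCLM.intervalIntegral_comp_comm hI
    simp only [Complex.reCLM_apply, Complex.exp_ofReal_mul_I_re] at h
    exact h.symm
  · have h := Complex.imCLM.intervalIntegral_comp_comm hI
    simp only [Complex.imCLM_apply, Complex.exp_ofReal_mul_I_im] at h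
    exact h.symm

theorem areaKernel_abs (d : ℝ) :
    areaKernel |d| = Real.sin |d| / 4 - d * Real.sin d / (4 * Real.pi) := by
  have := Real.pi_ne_zero
  rcases abs_cases d with h | h
  · rw [h.1, areaKernel]
    field_simp
  · rw [h.1, areaKernel, Real.sin_neg]
    field_simp
    ring

namespace IsTurning

variable {q : ℝ → ℝ} (hq : IsTurning q)

include hq

omit hq in
theorem moment_zero : moment q 0 = 1 := by simp [moment]

theorem moment_one : moment q 1 = 0 := by
  rw [moment_eq hq.mono.measurable]
  simp only [Int.cast_one, one_mul, hq.integral_cos, hq.integral_sin]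
  rfl

theorem moment_neg_one : moment q (-1) = 0 := by
  rw [moment_eq hq.mono.measurable]
  simp only [Int.cast_neg, Int.cast_one, neg_mul, one_mul, Real.cos_neg, Real.sin_neg,
    intervalIntegral.integral_neg, hq.integral_cos, hq.integral_sin, neg_zero]
  rfl

theorem abs_sub_mem {s t : ℝ} (hs : s ∈ Icc (0 : ℝ) 1) (ht : t ∈ Icc (0 : ℝ) 1) :
    |q t - q s| ∈ Icc 0 (2 * Real.pi) := by
  have h := hq.add_one 0
  rw [zero_add] at h
  have h1 := hq.mono hs.1
  have h2 := hq.mono hs.2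
  have h3 := hq.mono ht.1
  have h4 := hq.mono ht.2
  exact ⟨abs_nonneg _, abs_le.2 ⟨by linarith, by linarith⟩⟩

theorem integral_sin_sub (t : ℝ) : ∫ s in (0 : ℝ)..1, Real.sin (q s - q t) = 0 := by
  have := hq.height_add_one (q t) 0
  rwa [zero_add] at this

/-- The sign inside the absolute value changes at `s = t`, and the two pieces are equal because the
height over a full period is zero. -/
theorem integral_sin_abs {t : ℝ} (ht : t ∈ Icc (0 : ℝ) 1) :
    ∫ s in (0 : ℝ)..1, Real.sin |q t - q s| = -2 * height q (q t) 0 t := by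
  have hm := hq.mono
  have hI : ∀ a b, IntervalIntegrable (fun s => Real.sin |q t - q s|) volume a b := fun a b =>
    intervalIntegrable_comp hm.measurable (f := fun x => Real.sin |q t - x|)
      (by fun_prop) (fun _ => Real.abs_sin_le_one _) a b
  rw [← intervalIntegral.integral_add_adjacent_intervals (hI 0 t) (hI t 1)]
  have h1 : ∫ s in (0 : ℝ)..t, Real.sin |q t - q s| = -height q (q t) 0 t := by
    rw [height, ← intervalIntegral.integral_neg]
    refine intervalIntegral.integral_congr fun s hs => ?_
    rw [uIcc_of_le ht.1] at hs
    rw [abs_of_nonneg (sub_nonneg.2 (hm hs.2)), ← Real.sin_neg, neg_sub]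
  have h2 : ∫ s in t..1, Real.sin |q t - q s| = height q (q t) t 1 := by
    rw [height]
    refine intervalIntegral.integral_congr fun s hs => ?_
    rw [uIcc_of_le ht.2] at hs
    rw [abs_sub_comm, abs_of_nonneg (sub_nonneg.2 (hm hs.1))]
  have h3 := height_add hm (q t) 0 t 1
  have h4 := hq.height_add_one (q t) 0
  rw [zero_add] at h4
  rw [h1, h2]
  linarith

/-- The term in which `q t` stands outside a sine or cosine is multiplied by `∫ sin (q s - q t) ds =
0`. What remains integrates to zero over `t`. -/
theorem integral_sub_mul_sin : ∃ a b : ℝ, ∀ t,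
    ∫ s in (0 : ℝ)..1, (q t - q s) * Real.sin (q t - q s) =
      a * Real.cos (q t) + b * Real.sin (q t) := by
  have hm := hq.mono
  have hqI : IntervalIntegrable q volume 0 1 := (hm.monotoneOn _).intervalIntegrable
  have hI : ∀ f : ℝ → ℝ, Measurable f → (∀ x, |f x| ≤ 1) →
      IntervalIntegrable (fun s => q s * f (q s)) volume 0 1 := by
    intro f hf hb
    refine hqI.mono_fun (hm.measurable.mul (hf.comp hm.measurable)).aestronglyMeasurable
      (ae_of_all _ fun s => ?_)
    simp only [norm_mul, Real.norm_eq_abs]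
    exact mul_le_of_le_one_right (abs_nonneg _) (hb _)
  have hc := hI Real.cos Real.measurable_cos Real.abs_cos_le_one
  have hs := hI Real.sin Real.measurable_sin Real.abs_sin_le_one
  refine ⟨∫ s in (0 : ℝ)..1, q s * Real.sin (q s), -∫ s in (0 : ℝ)..1, q s * Real.cos (q s),
    fun t => ?_⟩
  have h1 : ∀ s, (q t - q s) * Real.sin (q t - q s) =
      -q t * Real.sin (q s - q t) + (Real.cos (q t) * (q s * Real.sin (q s)) -
        Real.sin (q t) * (q s * Real.cos (q s))) := by
    intro s
    rw [← neg_sub (q s) (q t), Real.sin_neg, Real.sin_sub]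
    ring
  simp only [h1]
  rw [intervalIntegral.integral_add ((intervalIntegrable_sin hm _ _ _).const_mul _)
    ((hs.const_mul _).sub (hc.const_mul _)), intervalIntegral.integral_sub (hs.const_mul _)
    (hc.const_mul _), intervalIntegral.integral_const_mul, intervalIntegral.integral_const_mul,
    intervalIntegral.integral_const_mul, hq.integral_sin_sub]
  ring

/-- Green's formula alone gives the kernel `sin d / 4`. The correction `-d sin d / (4π)` costs
nothing on closed curves and makes the kernel symmetric under `d ↦ 2π - d`, that is, a pure cosine
series. -/
theorem enclosedArea_eq_integral_areaKernel :
    enclosedArea q = ∫ t in (0 : ℝ)..1, ∫ s in (0 : ℝ)..1, areaKernel |q t - q s| := by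
  have hm := hq.mono
  obtain ⟨a, b, hab⟩ := hq.integral_sub_mul_sin
  have hin : ∀ t ∈ Icc (0 : ℝ) 1, ∫ s in (0 : ℝ)..1, areaKernel |q t - q s| =
      -height q (q t) 0 t / 2 - (a * Real.cos (q t) + b * Real.sin (q t)) / (4 * Real.pi) := by
    intro t ht
    simp only [areaKernel_abs]
    rw [intervalIntegral.integral_sub, intervalIntegral.integral_div,
      intervalIntegral.integral_div, hab, hq.integral_sin_abs ht]
    · ring
    · exact (intervalIntegrable_comp hm.measurable (f := fun x => Real.sin |q t - x|)
        (by fun_prop) (fun _ => Real.abs_sin_le_one _) 0 1).div_const _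
    · refine IntervalIntegrable.div_const ?_ _
      refine IntervalIntegrable.mono_fun (f := fun s => q t - q s)
        (intervalIntegrable_const.sub (hm.monotoneOn _).intervalIntegrable)
        ((hm.measurable.const_sub _).mul (Real.measurable_sin.comp
          (hm.measurable.const_sub _))).aestronglyMeasurable (ae_of_all _ fun s => ?_)
      simp only [norm_mul]
      exact mul_le_of_le_one_right (norm_nonneg _) (Real.abs_sin_le_one _)
  have hc := intervalIntegrable_comp hm.measurable Real.measurable_cos Real.abs_cos_le_one 0 1
  have hs := intervalIntegrable_comp hm.measurable Real.measurable_sin Real.abs_sin_le_one 0 1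
  have hH : IntervalIntegrable (fun t => -height q (q t) 0 t / 2) volume 0 1 := by
    simp only [hq.neg_height_zero]
    have hp := continuous_path hm
    exact ((hs.mul_continuousOn (Complex.continuous_re.comp hp).continuousOn).sub
      (hc.mul_continuousOn (Complex.continuous_im.comp hp).continuousOn)).div_const _
  rw [intervalIntegral.integral_congr (g := fun t => -height q (q t) 0 t / 2 -
    (a * Real.cos (q t) + b * Real.sin (q t)) / (4 * Real.pi))
    fun t ht => hin t (by rwa [uIcc_of_le zero_le_one] at ht),
    intervalIntegral.integral_sub hH (((hc.const_mul a).add (hs.const_mul b)).div_const _),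
    intervalIntegral.integral_div (4 * Real.pi), intervalIntegral.integral_add (hc.const_mul a) (hs.const_mul b),
    intervalIntegral.integral_const_mul, intervalIntegral.integral_const_mul, hq.integral_cos,
    hq.integral_sin, enclosedArea]
  simp

/-- Each `cos (n (q t - q s))` splits by the addition formula, so its double integral is the sum of
the squares of the real and imaginary parts of the moment. Absolute summability allows both termwise
integrations. -/
theorem hasSum_enclosedArea {c : ℤ → ℝ} (hc : Summable fun n => |c n|)
    (h : ∀ d ∈ Icc 0 (2 * Real.pi), HasSum (fun n : ℤ => c n * Real.cos (n * d)) (areaKernel d)) :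
    HasSum (fun n => c n * ‖moment q n‖ ^ 2) (enclosedArea q) := by
  have hm := hq.mono.measurable
  have hcos : ∀ n : ℤ, Measurable fun s => Real.cos (n * q s) := fun n =>
    Real.measurable_cos.comp (hm.const_mul _)
  have hsin : ∀ n : ℤ, Measurable fun s => Real.sin (n * q s) := fun n =>
    Real.measurable_sin.comp (hm.const_mul _)
  have hIc : ∀ n : ℤ, IntervalIntegrable (fun s => Real.cos (n * q s)) volume 0 1 := fun n =>
    intervalIntegrable_of_bound (hcos n).aestronglyMeasurable 1 (fun _ => Real.abs_cos_le_one _) 0 1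
  have hIs : ∀ n : ℤ, IntervalIntegrable (fun s => Real.sin (n * q s)) volume 0 1 := fun n =>
    intervalIntegrable_of_bound (hsin n).aestronglyMeasurable 1 (fun _ => Real.abs_sin_le_one _) 0 1
  set A : ℤ → ℝ := fun n => ∫ s in (0 : ℝ)..1, Real.cos (n * q s) with hA
  set B : ℤ → ℝ := fun n => ∫ s in (0 : ℝ)..1, Real.sin (n * q s) with hB
  have hexp : ∀ (n : ℤ) (s t : ℝ), Real.cos (n * |q t - q s|) =
      Real.cos (n * q t) * Real.cos (n * q s) + Real.sin (n * q t) * Real.sin (n * q s) := by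
    intro n s t
    rw [← Real.cos_sub, ← mul_sub]
    rcases abs_choice (q t - q s) with h | h <;> rw [h]
    rw [mul_neg, Real.cos_neg]
  have hbound : ∀ (n : ℤ) (x : ℝ), ‖c n * Real.cos x‖ ≤ |c n| := fun n x => by
    rw [norm_mul]
    exact mul_le_of_le_one_right (abs_nonneg _) (Real.abs_cos_le_one _)
  have hinner : ∀ t ∈ Icc (0 : ℝ) 1, HasSum
      (fun n => c n * (Real.cos (n * q t) * A n + Real.sin (n * q t) * B n))
      (∫ s in (0 : ℝ)..1, areaKernel |q t - q s|) := by
    intro t ht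
    have h1 := intervalIntegral.hasSum_integral_of_dominated_convergence (μ := volume) (a := 0)
      (b := 1) (F := fun (n : ℤ) s => c n * Real.cos (n * |q t - q s|))
      (f := fun s => areaKernel |q t - q s|) (fun n _ => |c n|)
      (fun n => by
        simp only [hexp]
        exact (((hcos n).const_mul _).add ((hsin n).const_mul _)).const_mul _
          |>.aestronglyMeasurable)
      (fun n => ae_of_all _ fun s _ => hbound n _)
      (ae_of_all _ fun _ _ => hc) intervalIntegrable_const
      (ae_of_all _ fun s hs => h _ (hq.abs_sub_mem (by
        rw [uIoc_of_le zero_le_one] at hs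
        exact ⟨hs.1.le, hs.2⟩) ht))
    convert! h1 using 2 with n
    simp only [hexp]
    rw [intervalIntegral.integral_const_mul, intervalIntegral.integral_add
      ((hIc n).const_mul _) ((hIs n).const_mul _), intervalIntegral.integral_const_mul,
      intervalIntegral.integral_const_mul]
  have hAB : ∀ n : ℤ, ∀ t, ‖c n * (Real.cos (n * q t) * A n + Real.sin (n * q t) * B n)‖ ≤
      2 * |c n| := by
    intro n t
    have hA1 : ‖A n‖ ≤ 1 * |1 - 0| := intervalIntegral.norm_integral_le_of_norm_le_const
      fun _ _ => Real.abs_cos_le_one _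
    have hB1 : ‖B n‖ ≤ 1 * |1 - 0| := intervalIntegral.norm_integral_le_of_norm_le_const
      fun _ _ => Real.abs_sin_le_one _
    rw [sub_zero, abs_one, mul_one] at hA1 hB1
    rw [norm_mul, mul_comm, Real.norm_eq_abs (c n)]
    refine mul_le_mul_of_nonneg_right ?_ (abs_nonneg _)
    refine (norm_add_le _ _).trans ?_
    rw [norm_mul, norm_mul]
    have e1 := mul_le_one₀ (Real.abs_cos_le_one (n * q t)) (norm_nonneg (A n)) hA1
    have e2 := mul_le_one₀ (Real.abs_sin_le_one (n * q t)) (norm_nonneg (B n)) hB1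
    simp only [Real.norm_eq_abs] at e1 e2 ⊢
    linarith
  have houter := intervalIntegral.hasSum_integral_of_dominated_convergence (μ := volume) (a := 0)
    (b := 1) (F := fun (n : ℤ) t => c n * (Real.cos (n * q t) * A n + Real.sin (n * q t) * B n))
    (f := fun t => ∫ s in (0 : ℝ)..1, areaKernel |q t - q s|) (fun n _ => 2 * |c n|)
    (fun n => (((hcos n).mul_const _).add ((hsin n).mul_const _)).const_mul _
      |>.aestronglyMeasurable)
    (fun n => ae_of_all _ fun t _ => hAB n t)
    (ae_of_all _ fun _ _ => hc.mul_left 2) intervalIntegrable_const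
    (ae_of_all _ fun t ht => hinner t (by
      rw [uIoc_of_le zero_le_one] at ht
      exact ⟨ht.1.le, ht.2⟩))
  rw [hq.enclosedArea_eq_integral_areaKernel]
  convert! houter using 2 with n
  rw [intervalIntegral.integral_const_mul, intervalIntegral.integral_add
    ((hIc n).mul_const _) ((hIs n).mul_const _), intervalIntegral.integral_mul_const,
    intervalIntegral.integral_mul_const, moment_eq hm, ← Complex.normSq_eq_norm_sq,
    Complex.normSq_mk]

/-- The area is monotone under shrinking the Fourier coefficients of the edge-direction measure. -/
theorem enclosedArea_le_of_moment_le {q' : ℝ → ℝ} (hq' : IsTurning q')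
    (h : ∀ n, ‖moment q' n‖ ≤ ‖moment q n‖) : enclosedArea q ≤ enclosedArea q' := by
  obtain ⟨c, hc, -, hneg, hk⟩ := exists_areaKernel_hasSum
  refine hasSum_le (fun n => ?_) (hq.hasSum_enclosedArea hc hk) (hq'.hasSum_enclosedArea hc hk)
  by_cases h0 : n = 0
  · rw [h0, moment_zero, moment_zero]
  by_cases h1 : n = 1
  · rw [h1, hq.moment_one, hq'.moment_one]
  by_cases h2 : n = -1
  · rw [h2, hq.moment_neg_one, hq'.moment_neg_one]
  exact mul_le_mul_of_nonpos_left (pow_le_pow_left₀ (norm_nonneg _) (h n) 2) (hneg n h0 h1 h2)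

theorem enclosedArea_le : enclosedArea q ≤ 1 / (4 * Real.pi) := by
  obtain ⟨c, hc, hc0, hneg, hk⟩ := exists_areaKernel_hasSum
  refine hasSum_le (fun n => ?_) (hq.hasSum_enclosedArea hc hk)
    (hasSum_single (f := fun n : ℤ => if n = 0 then 1 / (4 * Real.pi) else 0) 0
      fun n hn => if_neg hn)
  by_cases h0 : n = 0
  · simp [h0, moment_zero, hc0]
  rw [if_neg h0]
  by_cases h1 : n = 1
  · simp [h1, hq.moment_one]
  by_cases h2 : n = -1
  · simp [h2, hq.moment_neg_one]
  exact mul_nonpos_of_nonpos_of_nonneg (hneg n h0 h1 h2) (sq_nonneg _)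

theorem volume_body_le : volume (body q) ≤ ENNReal.ofReal (1 / (4 * Real.pi)) := by
  rw [hq.volume_body]
  exact ENNReal.ofReal_le_ofReal hq.enclosedArea_le

end IsTurning

/-! ### From measures on the circle to tangent angles. -/

/-- The extension to `ℝ` of a function on `[0, 1)`, gaining `2π` over each period. -/
def turnExtend (q : ℝ → ℝ) (u : ℝ) : ℝ := q (Int.fract u) + 2 * Real.pi * ⌊u⌋

theorem turnExtend_of_mem {q : ℝ → ℝ} {u : ℝ} (hu : u ∈ Ico (0 : ℝ) 1) : turnExtend q u = q u := by
  rw [turnExtend, Int.fract_eq_self.2 hu, Int.floor_eq_zero_iff.2 hu]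
  simp

theorem integral_turnExtend {q : ℝ → ℝ} (f : ℝ → ℂ) {t : ℝ} (ht : t ∈ Icc (0 : ℝ) 1) :
    ∫ u in (0 : ℝ)..t, f (turnExtend q u) = ∫ u in (0 : ℝ)..t, f (q u) := by
  rw [intervalIntegral.integral_of_le ht.1, intervalIntegral.integral_of_le ht.1,
    ← restrict_Ioo_eq_restrict_Ioc]
  refine setIntegral_congr_fun measurableSet_Ioo fun u hu => ?_
  simp only [turnExtend_of_mem (q := q) ⟨hu.1.le, hu.2.trans_le ht.2⟩]

/-- The total variation bound `hb` is what keeps the extension nondecreasing across the integers. -/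
theorem isTurning_turnExtend {q : ℝ → ℝ} (hm : MonotoneOn q (Ico 0 1))
    (hb : ∀ s ∈ Ico (0 : ℝ) 1, ∀ t ∈ Ico (0 : ℝ) 1, q t ≤ q s + 2 * Real.pi)
    (hc : ∫ u in (0 : ℝ)..1, Complex.exp ((q u : ℂ) * Complex.I) = 0) :
    IsTurning (turnExtend q) where
  mono := by
    intro a b hab
    have ha : Int.fract a ∈ Ico (0 : ℝ) 1 := ⟨Int.fract_nonneg a, Int.fract_lt_one a⟩
    have hb' : Int.fract b ∈ Ico (0 : ℝ) 1 := ⟨Int.fract_nonneg b, Int.fract_lt_one b⟩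
    rcases (Int.floor_mono hab).lt_or_eq with h | h
    · have h1 : (⌊a⌋ : ℝ) + 1 ≤ ⌊b⌋ := by exact_mod_cast h
      have h2 := hb _ hb' _ ha
      have := Real.pi_pos
      unfold turnExtend
      nlinarith
    · unfold turnExtend
      rw [h]
      refine add_le_add_left (hm ha hb' ?_) _
      rw [Int.fract, Int.fract, h]
      linarith
  add_one u := by
    unfold turnExtend
    rw [Int.fract_add_one, Int.floor_add_one]
    push_cast
    ring
  closed := by
    rw [integral_turnExtend (fun x => Complex.exp ((x : ℂ) * Complex.I)) (right_mem_Icc.2 zero_le_one)]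
    exact hc

instance : Fact (0 < 2 * Real.pi) := ⟨Real.two_pi_pos⟩

/-- The representative in `[0, 2π)` of a point of the circle. -/
def angle (x : Torus) : ℝ := AddCircle.equivIco (2 * Real.pi) 0 x

theorem coe_angle (x : Torus) : (angle x : Torus) = x := by
  have := (AddCircle.equivIco (2 * Real.pi) 0).symm_apply_apply x
  exact this

theorem angle_mem (x : Torus) : angle x ∈ Ico 0 (2 * Real.pi) := by
  have := (AddCircle.equivIco (2 * Real.pi) 0 x).2
  exact ⟨this.1, this.2.trans_eq (zero_add _)⟩

theorem angle_coe {s : ℝ} (hs : s ∈ Ico 0 (2 * Real.pi)) : angle (s : Torus) = s := by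
  have h := AddCircle.coe_equivIco_mk_apply (𝕜 := ℝ) (2 * Real.pi) s
  rw [angle, h]
  rw [Int.fract_eq_self.2 ⟨div_nonneg hs.1 Real.two_pi_pos.le,
    (div_lt_one Real.two_pi_pos).2 hs.2⟩]
  field_simp

theorem angle_coe_le {s : ℝ} (hs : 0 ≤ s) : angle (s : Torus) ≤ s := by
  rcases lt_or_ge s (2 * Real.pi) with h | h
  · exact (angle_coe ⟨hs, h⟩).le
  · exact (angle_mem _).2.le.trans h

theorem measurable_angle : Measurable angle :=
  measurable_subtype_coe.comp (AddCircle.measurableEquivIco (2 * Real.pi) 0).measurable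

theorem image_coe_Icc (x : ℝ) :
    (fun s : ℝ => (s : Torus)) '' Icc 0 x = angle ⁻¹' Iic x := by
  ext y
  constructor
  · rintro ⟨s, hs, rfl⟩
    exact (angle_coe_le hs.1).trans hs.2
  · intro hy
    exact ⟨angle y, ⟨(angle_mem y).1, hy⟩, coe_angle y⟩

section Quantile

variable (ν : Measure Torus) [IsProbabilityMeasure ν]

instance : IsProbabilityMeasure (ν.map angle) :=
  Measure.isProbabilityMeasure_map measurable_angle.aemeasurable

theorem cdf_eq (x : ℝ) : cdf ν x = ProbabilityTheory.cdf (ν.map angle) x := by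
  rw [ProbabilityTheory.cdf_eq_real, cdf, image_coe_Icc,
    map_measureReal_apply measurable_angle measurableSet_Iic]

theorem cdf_two_pi : cdf ν (2 * Real.pi) = 1 := by
  have : angle ⁻¹' Iic (2 * Real.pi) = univ := eq_univ_of_forall fun x => (angle_mem x).2.le
  rw [cdf, image_coe_Icc, this, probReal_univ]

omit [IsProbabilityMeasure ν] in
theorem quantile_nonneg (u : ℝ) : 0 ≤ quantile ν u := Real.sInf_nonneg fun _ hx => hx.1

/-- The Galois connection between quantile and distribution function, from right continuity. For `u
≤ 1` the set whose infimum is taken contains `2π`, so the infimum is not the default value of the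
empty set. -/
theorem quantile_le_iff {u x : ℝ} (hu : u ≤ 1) (hx : 0 ≤ x) :
    quantile ν u ≤ x ↔ u ≤ cdf ν x := by
  have hne : {x : ℝ | 0 ≤ x ∧ u ≤ cdf ν x}.Nonempty :=
    ⟨2 * Real.pi, Real.two_pi_pos.le, by rwa [cdf_two_pi]⟩
  constructor
  · intro h
    rw [cdf_eq]
    have hr : Tendsto (ProbabilityTheory.cdf (ν.map angle)) (𝓝[>] x)
        (𝓝 (ProbabilityTheory.cdf (ν.map angle) x)) :=
      ((ProbabilityTheory.cdf (ν.map angle)).right_continuous x).mono_left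
        (nhdsWithin_mono x Ioi_subset_Ici_self)
    refine ge_of_tendsto hr ?_
    filter_upwards [self_mem_nhdsWithin] with y hy
    obtain ⟨z, hz, hzy⟩ := exists_lt_of_csInf_lt hne (h.trans_lt hy)
    have h1 := hz.2
    rw [cdf_eq] at h1
    exact h1.trans (ProbabilityTheory.monotone_cdf _ hzy.le)
  · intro h
    exact csInf_le ⟨0, fun _ hz => hz.1⟩ ⟨hx, h⟩

theorem monotoneOn_quantile : MonotoneOn (quantile ν) (Iic 1) := by
  intro u hu v hv huv
  rw [quantile_le_iff ν hu (quantile_nonneg ν v)]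
  exact huv.trans ((quantile_le_iff ν hv (quantile_nonneg ν v)).1 le_rfl)

theorem quantile_le_two_pi {u : ℝ} (hu : u ≤ 1) : quantile ν u ≤ 2 * Real.pi := by
  rw [quantile_le_iff ν hu Real.two_pi_pos.le, cdf_two_pi]
  exact hu

theorem aemeasurable_quantile : AEMeasurable (quantile ν) (volume.restrict (Ioc 0 1)) :=
  aemeasurable_restrict_of_monotoneOn measurableSet_Ioc
    ((monotoneOn_quantile ν).mono Ioc_subset_Iic_self)

theorem map_quantile : (volume.restrict (Ioc 0 1)).map (quantile ν) = ν.map angle := by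
  have : IsProbabilityMeasure (volume.restrict (Ioc (0 : ℝ) 1)) := ⟨by simp⟩
  have : IsProbabilityMeasure ((volume.restrict (Ioc (0 : ℝ) 1)).map (quantile ν)) :=
    Measure.isProbabilityMeasure_map (aemeasurable_quantile ν)
  refine Measure.ext_of_Iic _ _ fun x => ?_
  rw [Measure.map_apply_of_aemeasurable (aemeasurable_quantile ν) measurableSet_Iic]
  rcases lt_or_ge x 0 with hx | hx
  · have h1 : quantile ν ⁻¹' Iic x = ∅ :=
      eq_empty_of_forall_notMem fun u hu => absurd (hx.trans_le (quantile_nonneg ν u)) (not_lt.2 hu)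
    have h2 : angle ⁻¹' Iic x = ∅ :=
      eq_empty_of_forall_notMem fun u hu => absurd (hx.trans_le (angle_mem u).1) (not_lt.2 hu)
    rw [h1, Measure.map_apply measurable_angle measurableSet_Iic, h2]
    simp
  · rw [Measure.restrict_apply' measurableSet_Ioc]
    have h1 : quantile ν ⁻¹' Iic x ∩ Ioc 0 1 = Ioc 0 (cdf ν x) := by
      ext u
      simp only [mem_inter_iff, mem_preimage, mem_Iic, mem_Ioc]
      constructor
      · rintro ⟨h, h0, h1⟩
        exact ⟨h0, (quantile_le_iff ν h1 hx).1 h⟩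
      · rintro ⟨h0, h⟩
        have h1 : u ≤ 1 := h.trans measureReal_le_one
        exact ⟨(quantile_le_iff ν h1 hx).2 h, h0, h1⟩
    rw [h1, Real.volume_Ioc, sub_zero, cdf_eq, ProbabilityTheory.ofReal_cdf]

theorem integral_quantile {f : ℝ → ℂ} (hf : Continuous f) :
    ∫ u in (0 : ℝ)..1, f (quantile ν u) = ∫ x, f (angle x) ∂ν := by
  rw [intervalIntegral.integral_of_le zero_le_one,
    ← integral_map (aemeasurable_quantile ν) hf.aestronglyMeasurable, map_quantile,
    integral_map measurable_angle.aemeasurable hf.aestronglyMeasurable]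

omit [IsProbabilityMeasure ν] in
theorem fourier_eq_exp (n : ℤ) (x : Torus) :
    fourier n x = Complex.exp (((n * angle x : ℝ) : ℂ) * Complex.I) := by
  conv_lhs => rw [← coe_angle x]
  rw [fourier_coe_apply]
  congr 1
  have : (Real.pi : ℂ) ≠ 0 := by exact_mod_cast Real.pi_ne_zero
  push_cast
  field_simp

/-- The tangent angle of the curve of `ν`, on the whole real line. -/
def turning : ℝ → ℝ := turnExtend (quantile ν)

/-- Lebesgue measure on `(0, 1]` is carried by the quantile function to the measure itself, so
moments of the curve are Fourier coefficients of `ν`. -/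
theorem moment_turning (n : ℤ) : moment (turning ν) n = ∫ x, fourier n x ∂ν := by
  simp only [fourier_eq_exp]
  rw [moment, turning, integral_turnExtend
    (fun x => Complex.exp (((n * x : ℝ) : ℂ) * Complex.I)) (right_mem_Icc.2 zero_le_one)]
  exact integral_quantile ν (f := fun x => Complex.exp (((n * x : ℝ) : ℂ) * Complex.I))
    (by fun_prop)

end Quantile

theorem mem_M0_iff {ν : Measure Torus} :
    ν ∈ M0 ↔ IsProbabilityMeasure ν ∧ ∫ x, (fourier 1 x : ℂ) ∂ν = 0 := by
  simp only [fourier_one]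
  rfl

theorem isTurning_turning {ν : Measure Torus} (hν : ν ∈ M0) : IsTurning (turning ν) := by
  obtain ⟨_, h1⟩ := mem_M0_iff.1 hν
  refine isTurning_turnExtend ((monotoneOn_quantile ν).mono fun u hu => hu.2.le)
    (fun s _ t ht => ?_) ?_
  · linarith [quantile_le_two_pi ν ht.2.le, quantile_nonneg ν s]
  · rw [← h1, ← moment_turning, moment, turning, integral_turnExtend
      (fun x => Complex.exp ((((1 : ℤ) * x : ℝ) : ℂ) * Complex.I)) (right_mem_Icc.2 zero_le_one)]
    simp

theorem curve_eq_path (ν : Measure Torus) {t : ℝ} (ht : t ∈ Icc (0 : ℝ) 1) :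
    curve ν t = path (turning ν) t :=
  (integral_turnExtend (fun x => Complex.exp ((x : ℂ) * Complex.I)) ht).symm

theorem region_eq_body {ν : Measure Torus} (hν : ν ∈ M0) : region ν = body (turning ν) := by
  rw [region, boundaryCurve, body, (isTurning_turning hν).range_path_eq_image_Icc]
  congr 1
  exact image_congr fun t ht => curve_eq_path ν ht

/-! ### Effect of rotation and symmetrisation on Fourier coefficients. -/

theorem measurable_rotate (θ : ℝ) : Measurable fun x : Torus => x + (θ : Torus) :=
  (continuous_id.add continuous_const).measurable

theorem measurable_reflect :
    Measurable fun x : Torus => ((2 * Real.pi : ℝ) : Torus) - x :=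
  (continuous_sub_left _).measurable

instance isProbabilityMeasure_rotate (θ : ℝ) (ν : Measure Torus) [IsProbabilityMeasure ν] :
    IsProbabilityMeasure (rotate θ ν) :=
  Measure.isProbabilityMeasure_map (measurable_rotate θ).aemeasurable

instance isProbabilityMeasure_reflect (ν : Measure Torus) [IsProbabilityMeasure ν] :
    IsProbabilityMeasure (reflect ν) :=
  Measure.isProbabilityMeasure_map measurable_reflect.aemeasurable

instance isProbabilityMeasure_symm (ν : Measure Torus) [IsProbabilityMeasure ν] :
    IsProbabilityMeasure (symm ν) := by
  constructor
  rw [symm, Measure.smul_apply, Measure.add_apply, measure_univ, measure_univ, smul_eq_mul,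
    one_add_one_eq_two]
  exact ENNReal.inv_mul_cancel (by simp) (by simp)

theorem fourier_add_arg (n : ℤ) (x y : Torus) : (fourier n (x + y) : ℂ) =
    fourier n x * fourier n y := by
  simp only [fourier_apply, zsmul_add, AddCircle.toCircle_add, Circle.coe_mul]

theorem integral_fourier_rotate (θ : ℝ) (ν : Measure Torus) (n : ℤ) :
    ∫ x, (fourier n x : ℂ) ∂(rotate θ ν) = (∫ x, (fourier n x : ℂ) ∂ν) * fourier n (θ : Torus) := by
  rw [rotate, integral_map (measurable_rotate θ).aemeasurable
    (fourier n).continuous.aestronglyMeasurable, ← integral_mul_const]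
  simp only [fourier_add_arg]

theorem integral_fourier_reflect (ν : Measure Torus) (n : ℤ) :
    ∫ x, (fourier n x : ℂ) ∂(reflect ν) = starRingEnd ℂ (∫ x, (fourier n x : ℂ) ∂ν) := by
  rw [reflect, integral_map measurable_reflect.aemeasurable
    (fourier n).continuous.aestronglyMeasurable, ← integral_conj]
  congr 1
  ext x
  rw [AddCircle.coe_period, zero_sub, fourier_apply, smul_neg, ← neg_smul, ← fourier_apply,
    fourier_neg]

theorem integrable_fourier (ν : Measure Torus) [IsFiniteMeasure ν] (n : ℤ) :
    Integrable (fun x => (fourier n x : ℂ)) ν :=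
  Integrable.of_bound (fourier n).continuous.aestronglyMeasurable 1
    (ae_of_all _ fun x => by rw [fourier_apply, Circle.norm_coe])

theorem integral_fourier_symm (ν : Measure Torus) [IsProbabilityMeasure ν] (n : ℤ) :
    ∫ x, (fourier n x : ℂ) ∂(symm ν) = ((∫ x, (fourier n x : ℂ) ∂ν).re : ℂ) := by
  rw [symm, integral_smul_measure, integral_add_measure (integrable_fourier ν n)
    (integrable_fourier _ n), integral_fourier_reflect, Complex.add_conj]
  simp

/-- The new coefficient is the real part of the old one times a phase. This single estimate carries
the growth of the area and, for `n = 1`, the stability of `M0`. -/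
theorem norm_integral_fourier_symm_le (ν : Measure Torus) [IsProbabilityMeasure ν] (θ : ℝ)
    (n : ℤ) : ‖∫ x, (fourier n x : ℂ) ∂(symm (rotate θ ν))‖ ≤ ‖∫ x, (fourier n x : ℂ) ∂ν‖ := by
  rw [integral_fourier_symm, integral_fourier_rotate, Complex.norm_real, Real.norm_eq_abs]
  refine (Complex.abs_re_le_norm _).trans ?_
  rw [norm_mul, fourier_apply, Circle.norm_coe, mul_one]

theorem symm_rotate_mem_M0 {ν : Measure Torus} (hν : ν ∈ M0) (θ : ℝ) :
    symm (rotate θ ν) ∈ M0 := by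
  obtain ⟨_, h1⟩ := mem_M0_iff.1 hν
  refine mem_M0_iff.2 ⟨inferInstance, norm_le_zero_iff.1 ?_⟩
  simpa only [h1, norm_zero] using norm_integral_fourier_symm_le ν θ 1

theorem perimeter_region {ν : Measure Torus} (hν : ν ∈ M0) : perimeter (region ν) = 1 := by
  rw [region_eq_body hν, (isTurning_turning hν).perimeter_body]

theorem volume_region_le {ν : Measure Torus} (hν : ν ∈ M0) (θ : ℝ) :
    volume (region ν) ≤ volume (region (symm (rotate θ ν))) := by
  have hν' := symm_rotate_mem_M0 hν θ
  have hP : IsProbabilityMeasure ν := hν.1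
  rw [region_eq_body hν, region_eq_body hν', (isTurning_turning hν).volume_body,
    (isTurning_turning hν').volume_body]
  refine ENNReal.ofReal_le_ofReal ((isTurning_turning hν).enclosedArea_le_of_moment_le
    (isTurning_turning hν') fun n => ?_)
  rw [moment_turning, moment_turning]
  exact norm_integral_fourier_symm_le ν θ n

/-! ### The disc, and the Hausdorff distance to it. -/

theorem isTurning_two_pi_mul : IsTurning fun u => 2 * Real.pi * u where
  mono := fun a b h => mul_le_mul_of_nonneg_left h Real.two_pi_pos.le
  add_one u := by ring
  closed := by
    have h : ∀ u : ℝ, Complex.exp (((2 * Real.pi * u : ℝ) : ℂ) * Complex.I) =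
        Complex.exp (2 * Real.pi * Complex.I * u) := fun u => by
      congr 1
      push_cast
      ring
    simp only [h]
    rw [integral_exp_mul_complex (by simp [Real.pi_ne_zero])]
    simp

theorem path_two_pi_mul (t : ℝ) : path (fun u => 2 * Real.pi * u) t =
    Complex.I / (2 * Real.pi) +
      -Complex.I / (2 * Real.pi) * Complex.exp (((2 * Real.pi * t : ℝ) : ℂ) * Complex.I) := by
  have h : ∀ u : ℝ, Complex.exp (((2 * Real.pi * u : ℝ) : ℂ) * Complex.I) =
      Complex.exp (2 * Real.pi * Complex.I * u) := fun u => by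
    congr 1
    push_cast
    ring
  have hpi : (Real.pi : ℂ) ≠ 0 := by exact_mod_cast Real.pi_ne_zero
  rw [path]
  simp only [h]
  rw [integral_exp_mul_complex (by simp [Real.pi_ne_zero])]
  have hI := Complex.I_sq
  field_simp
  simp only [hI]
  simp
  ring

theorem body_two_pi_mul : body (fun u => 2 * Real.pi * u) = unitPerimeterDisc := by
  have hpi : (Real.pi : ℂ) ≠ 0 := by exact_mod_cast Real.pi_ne_zero
  have hpos := Real.pi_pos
  have hnorm : ‖-Complex.I / (2 * Real.pi : ℂ)‖ = 1 / (2 * Real.pi) := by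
    simp [abs_of_pos hpos]
  rw [body, unitPerimeterDisc, ← convexHull_sphere_eq_closedBall _ (by positivity)]
  congr 1
  ext z
  rw [mem_sphere_iff_norm]
  constructor
  · rintro ⟨t, rfl⟩
    rw [path_two_pi_mul, add_sub_cancel_left, norm_mul, Complex.norm_exp_ofReal_mul_I, hnorm,
      mul_one]
  · intro hz
    set w : ℂ := (z - Complex.I / (2 * Real.pi)) / (-Complex.I / (2 * Real.pi)) with hw
    have hne : (-Complex.I / (2 * Real.pi : ℂ)) ≠ 0 := by simp [hpi]
    have hw1 : ‖w‖ = 1 := by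
      rw [hw, norm_div, hz, hnorm]
      exact div_self (by positivity)
    refine ⟨w.arg / (2 * Real.pi), ?_⟩
    have h1 := Complex.norm_mul_exp_arg_mul_I w
    rw [hw1, Complex.ofReal_one, one_mul] at h1
    rw [path_two_pi_mul, mul_div_cancel₀ _ Real.two_pi_pos.ne', h1, hw, mul_div_cancel₀ _ hne]
    ring

theorem perimeter_unitPerimeterDisc : perimeter unitPerimeterDisc = 1 := by
  rw [← body_two_pi_mul]
  exact isTurning_two_pi_mul.perimeter_body

theorem volume_unitPerimeterDisc :
    volume unitPerimeterDisc = ENNReal.ofReal (1 / (4 * Real.pi)) := by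
  have hpos := Real.pi_pos
  rw [unitPerimeterDisc, Complex.volume_closedBall, ← ENNReal.ofReal_pow (by positivity),
    ← ENNReal.ofReal_coe_nnreal, ← ENNReal.ofReal_mul (by positivity), NNReal.coe_real_pi]
  congr 1
  field_simp
  norm_num

theorem exists_dist_le_of_mem_convexHull {E : Type*} [NormedAddCommGroup E] [NormedSpace ℝ E]
    {A B : Set E} {ε : ℝ} (h : ∀ x ∈ A, ∃ y ∈ B, dist x y ≤ ε) {x : E}
    (hx : x ∈ convexHull ℝ A) : ∃ y ∈ convexHull ℝ B, dist x y ≤ ε := by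
  refine convexHull_min (t := {x | ∃ y ∈ convexHull ℝ B, dist x y ≤ ε}) (fun x hx => ?_) ?_ hx
  · obtain ⟨y, hy, hxy⟩ := h x hx
    exact ⟨y, subset_convexHull ℝ B hy, hxy⟩
  · rintro x ⟨y, hy, hxy⟩ x' ⟨y', hy', hxy'⟩ a b ha hb hab
    refine ⟨a • y + b • y', convex_convexHull ℝ B hy hy' ha hb hab, ?_⟩
    rw [dist_eq_norm] at *
    have : a • x + b • x' - (a • y + b • y') = a • (x - y) + b • (x' - y') := by
      simp only [smul_sub]
      abel
    rw [this]
    refine (norm_add_le _ _).trans ?_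
    rw [norm_smul, norm_smul, Real.norm_of_nonneg ha, Real.norm_of_nonneg hb]
    calc a * ‖x - y‖ + b * ‖x' - y'‖ ≤ a * ε + b * ε := by gcongr
      _ = ε := by rw [← add_mul, hab, one_mul]

theorem norm_exp_sub_exp_le (a b : ℝ) : ‖Complex.exp ((a : ℂ) * Complex.I) -
    Complex.exp ((b : ℂ) * Complex.I)‖ ≤ |a - b| := by
  have h : Complex.exp ((a : ℂ) * Complex.I) - Complex.exp ((b : ℂ) * Complex.I) =
      Complex.exp ((b : ℂ) * Complex.I) * (Complex.exp (Complex.I * ((a - b : ℝ) : ℂ)) - 1) := by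
    rw [mul_sub, ← Complex.exp_add, mul_one]
    congr 2
    push_cast
    ring
  rw [h, norm_mul, Complex.norm_exp_ofReal_mul_I, one_mul]
  exact Real.norm_exp_I_mul_ofReal_sub_one_le

theorem intervalIntegrable_abs_sub {q p : ℝ → ℝ} (hq : Monotone q) (hp : Monotone p) (a b : ℝ) :
    IntervalIntegrable (fun u => |q u - p u|) volume a b :=
  ((hq.monotoneOn _).intervalIntegrable.sub (hp.monotoneOn _).intervalIntegrable).abs

/-- Points of equal arc length on the two curves are at most the L¹ distance of the angles apart,
since `x ↦ exp (ix)` is 1-Lipschitz; convex hulls inherit the bound. -/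
theorem hausdorffDist_body_le {q p : ℝ → ℝ} (hq : IsTurning q) (hp : IsTurning p) :
    Metric.hausdorffDist (body q) (body p) ≤ ∫ u in (0 : ℝ)..1, |q u - p u| := by
  set ε := ∫ u in (0 : ℝ)..1, |q u - p u| with hε
  have hdist : ∀ t ∈ Icc (0 : ℝ) 1, dist (path q t) (path p t) ≤ ε := by
    intro t ht
    rw [dist_eq_norm, path, path, ← intervalIntegral.integral_sub (intervalIntegrable_exp hq.mono _ _)
      (intervalIntegrable_exp hp.mono _ _)]
    refine (intervalIntegral.norm_integral_le_of_norm_le ht.1 (ae_of_all _ fun u _ =>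
      norm_exp_sub_exp_le (q u) (p u)) (intervalIntegrable_abs_sub hq.mono hp.mono _ _)).trans ?_
    exact intervalIntegral.integral_mono_interval le_rfl ht.1 ht.2
      (ae_of_all _ fun _ => abs_nonneg _) (intervalIntegrable_abs_sub hq.mono hp.mono _ _)
  have hε0 : 0 ≤ ε := dist_nonneg.trans (hdist 0 (left_mem_Icc.2 zero_le_one))
  refine Metric.hausdorffDist_le_of_mem_dist hε0 (fun x hx => ?_) fun x hx => ?_
  · refine exists_dist_le_of_mem_convexHull (fun x hx => ?_) hx
    rw [hq.range_path_eq_image_Icc] at hx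
    obtain ⟨t, ht, rfl⟩ := hx
    exact ⟨_, mem_range_self t, hdist t ht⟩
  · refine exists_dist_le_of_mem_convexHull (fun x hx => ?_) hx
    rw [hp.range_path_eq_image_Icc] at hx
    obtain ⟨t, ht, rfl⟩ := hx
    exact ⟨_, mem_range_self t, by rw [dist_comm]; exact hdist t ht⟩

/-- Bounding the integrand pointwise would give `2π (b - a)²`. Pairing `u` with its mirror image `a
+ b - u` and using that `q` is nondecreasing halves this. -/
theorem integral_abs_sub_two_pi_mul_cell {q : ℝ → ℝ} (hq : Monotone q) {a b : ℝ} (hab : a ≤ b)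
    (h : ∀ u ∈ Ioo a b, q u ∈ Icc (2 * Real.pi * a) (2 * Real.pi * b)) :
    ∫ u in a..b, |q u - 2 * Real.pi * u| ≤ Real.pi * (b - a) ^ 2 := by
  have hpi := Real.pi_pos
  set f : ℝ → ℝ := fun u => |q u - 2 * Real.pi * u|
  have hf : ∀ a b, IntervalIntegrable f volume a b :=
    intervalIntegrable_abs_sub hq isTurning_two_pi_mul.mono
  have hrefl : ∫ u in a..b, f (a + b - u) = ∫ u in a..b, f u := by
    rw [intervalIntegral.integral_comp_sub_left]
    simp
  have hf' : IntervalIntegrable (fun u => f (a + b - u)) volume a b := by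
    simpa using (hf b a).comp_sub_left (a + b)
  have hpair : ∀ u v, u ∈ Ioo a b → v ∈ Ioo a b → u + v = a + b → u ≤ v →
      f u + f v ≤ 2 * Real.pi * (b - a) := by
    intro u v hu hv huv hle
    have h1 := h u hu
    have h2 := h v hv
    have h3 := hq hle
    have h4 : 2 * Real.pi * u ≤ 2 * Real.pi * v := by gcongr
    have h5 : 2 * Real.pi * u + 2 * Real.pi * v = 2 * Real.pi * a + 2 * Real.pi * b := by
      rw [← mul_add, huv, mul_add]
    have h6 : 2 * Real.pi * a ≤ 2 * Real.pi * u := by gcongr; exact hu.1.le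
    have h7 : 2 * Real.pi * v ≤ 2 * Real.pi * b := by gcongr; exact hv.2.le
    simp only [f, mul_sub]
    rcases abs_cases (q u - 2 * Real.pi * u) with e1 | e1 <;>
    rcases abs_cases (q v - 2 * Real.pi * v) with e2 | e2 <;>
    rw [e1.1, e2.1] <;> linarith [h1.1, h1.2, h2.1, h2.2]
  have hmono := intervalIntegral.integral_mono_on_of_le_Ioo hab ((hf a b).add hf')
    (intervalIntegrable_const (c := 2 * Real.pi * (b - a))) fun u hu => by
      have hv : a + b - u ∈ Ioo a b := ⟨by linarith [hu.2], by linarith [hu.1]⟩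
      rcases le_total u (a + b - u) with hle | hle
      · exact hpair u _ hu hv (by ring) hle
      · have := hpair _ u hv hu (by ring) hle
        rw [add_comm] at this
        exact this
  rw [intervalIntegral.integral_add (hf a b) hf', hrefl, intervalIntegral.integral_const,
    smul_eq_mul] at hmono
  nlinarith

theorem integral_abs_sub_two_pi_mul_le {q : ℝ → ℝ} (hq : Monotone q) {M : ℕ} (hM : 0 < M)
    (h : ∀ j < M, ∀ u ∈ Ioo ((j : ℝ) / M) ((j + 1 : ℕ) / M),
      q u ∈ Icc (2 * Real.pi * (j / M)) (2 * Real.pi * ((j + 1 : ℕ) / M))) :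
    ∫ u in (0 : ℝ)..1, |q u - 2 * Real.pi * u| ≤ Real.pi / M := by
  have hM' : (0 : ℝ) < M := by exact_mod_cast hM
  have hsum := intervalIntegral.sum_integral_adjacent_intervals
    (f := fun u => |q u - 2 * Real.pi * u|) (μ := volume) (a := fun j : ℕ => (j : ℝ) / M) (n := M)
    fun j _ => intervalIntegrable_abs_sub hq isTurning_two_pi_mul.mono _ _
  rw [Nat.cast_zero, zero_div, div_self hM'.ne'] at hsum
  rw [← hsum]
  have hle : ∀ j ∈ Finset.range M, ∫ u in ((j : ℝ) / M)..((j + 1 : ℕ) / M),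
      |q u - 2 * Real.pi * u| ≤ Real.pi / M ^ 2 := by
    intro j hj
    have hab : (j : ℝ) / M ≤ (j + 1 : ℕ) / M := by
      gcongr
      exact Nat.le_succ j
    refine (integral_abs_sub_two_pi_mul_cell hq hab (h j (Finset.mem_range.1 hj))).trans
      (le_of_eq ?_)
    push_cast
    field_simp
    ring
  refine (Finset.sum_le_sum hle).trans (le_of_eq ?_)
  rw [Finset.sum_const, Finset.card_range, nsmul_eq_mul]
  field_simp

theorem hausdorffDist_region_le {ν : Measure Torus} (hν : ν ∈ M0) {M : ℕ} (hM : 0 < M)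
    (h : ∀ j : ℕ, 0 < j → j ≤ M → cdf ν (2 * Real.pi * (j / M)) = j / M) :
    Metric.hausdorffDist (region ν) unitPerimeterDisc ≤ Real.pi / M := by
  have hP : IsProbabilityMeasure ν := hν.1
  have hT := isTurning_turning hν
  have hM' : (0 : ℝ) < M := by exact_mod_cast hM
  have hpi := Real.pi_pos
  rw [region_eq_body hν, ← body_two_pi_mul]
  refine (hausdorffDist_body_le hT isTurning_two_pi_mul).trans
    (integral_abs_sub_two_pi_mul_le hT.mono hM fun j hj u hu => ?_)
  have hj1 : ((j + 1 : ℕ) : ℝ) / M ≤ 1 := by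
    rw [div_le_one hM']
    exact_mod_cast hj
  have hu0 : 0 < u := lt_of_le_of_lt (by positivity) hu.1
  have hu1 : u < 1 := hu.2.trans_le hj1
  have hq : turning ν u = quantile ν u := turnExtend_of_mem ⟨hu0.le, hu1⟩
  rw [hq]
  constructor
  -- In the first cell the lower bound is just nonnegativity; nothing is assumed about an atom at
  -- `0`.
  · rcases Nat.eq_zero_or_pos j with rfl | hj0
    · simpa using quantile_nonneg ν u
    · by_contra! hlt
      have h1 := (quantile_le_iff ν hu1.le (by positivity)).1 hlt.le
      rw [h j hj0 hj.le] at h1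
      exact absurd hu.1 (not_lt.2 h1)
  · rw [quantile_le_iff ν hu1.le (by positivity), h (j + 1) (Nat.succ_pos j) hj]
    exact hu.2.le

/-! ### Dihedral symmetry after successive symmetrisations. -/

theorem rotate_rotate (a b : ℝ) (ν : Measure Torus) :
    rotate a (rotate b ν) = rotate (b + a) ν := by
  rw [rotate, rotate, rotate, Measure.map_map (measurable_rotate a) (measurable_rotate b)]
  congr 1
  ext x
  simp [add_assoc]

theorem rotate_two_pi (ν : Measure Torus) : rotate (2 * Real.pi) ν = ν := by
  simp [rotate, AddCircle.coe_period]

theorem reflect_rotate (a : ℝ) (ν : Measure Torus) :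
    reflect (rotate a ν) = rotate (-a) (reflect ν) := by
  rw [rotate, rotate, reflect, reflect, Measure.map_map measurable_reflect (measurable_rotate a),
    Measure.map_map (measurable_rotate (-a)) measurable_reflect]
  congr 1
  ext x
  simp only [Function.comp_apply, AddCircle.coe_neg]
  abel

theorem reflect_reflect (ν : Measure Torus) : reflect (reflect ν) = ν := by
  rw [reflect, reflect, Measure.map_map measurable_reflect measurable_reflect]
  have : ((fun x => ((2 * Real.pi : ℝ) : Torus) - x) ∘ fun x => ((2 * Real.pi : ℝ) : Torus) - x) =
      id := by
    ext x
    simp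
  rw [this, Measure.map_id]

theorem reflect_symm (ν : Measure Torus) : reflect (symm ν) = symm ν := by
  conv_lhs => rw [symm, reflect, Measure.map_smul, Measure.map_add _ _ measurable_reflect,
    ← reflect, ← reflect, reflect_reflect, add_comm]
  rfl

/-- For a reflection-invariant measure the symmetrisation is the average of the rotations by `θ` and
`-θ`; a turn by `2θ` exchanges the two when `4θ` is a period. The period is halved. -/
theorem rotate_symm_rotate {ν : Measure Torus} (hν : reflect ν = ν) {θ : ℝ}
    (h : rotate (4 * θ) ν = ν) :
    rotate (2 * θ) (symm (rotate θ ν)) = symm (rotate θ ν) := by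
  have h1 : symm (rotate θ ν) = (2 : ℝ≥0∞)⁻¹ • (rotate θ ν + rotate (-θ) ν) := by
    rw [symm, reflect_rotate, hν]
  have h2 : rotate (2 * θ) (rotate θ ν) = rotate (-θ) ν := by
    conv_rhs => rw [← h, rotate_rotate]
    rw [rotate_rotate]
    congr 1
    ring
  have h3 : rotate (2 * θ) (rotate (-θ) ν) = rotate θ ν := by
    rw [rotate_rotate]
    congr 1
    ring
  rw [h1]
  conv_lhs => rw [rotate, Measure.map_smul, Measure.map_add _ _ (measurable_rotate _), ← rotate,
    ← rotate, h2, h3, add_comm]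

/-- The dyadic multiples of `π` carry no mass. -/
def NoDyadicAtom (ν : Measure Torus) : Prop :=
  ∀ (m : ℕ) (i : ℤ), ν {((i * Real.pi / 2 ^ m : ℝ) : Torus)} = 0

theorem rotate_singleton (θ : ℝ) (ν : Measure Torus) (x : Torus) :
    rotate θ ν {x} = ν {x - (θ : Torus)} := by
  rw [rotate, Measure.map_apply (measurable_rotate θ) (measurableSet_singleton x)]
  congr 1
  ext y
  simp only [mem_preimage, mem_singleton_iff, eq_sub_iff_add_eq]

theorem reflect_singleton (ν : Measure Torus) (x : Torus) : reflect ν {x} = ν {-x} := by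
  rw [reflect, Measure.map_apply measurable_reflect (measurableSet_singleton x)]
  congr 1
  ext y
  rw [AddCircle.coe_period]
  simp

theorem NoDyadicAtom.symm {ν : Measure Torus} (h : NoDyadicAtom ν) : NoDyadicAtom (symm ν) := by
  intro m i
  have h1 : -((i * Real.pi / 2 ^ m : ℝ) : Torus) = (((-i : ℤ) * Real.pi / 2 ^ m : ℝ) : Torus) := by
    rw [← AddCircle.coe_neg]
    congr 1
    push_cast
    ring
  rw [CCS.symm, Measure.smul_apply, Measure.add_apply, reflect_singleton, h m i, h1, h m (-i)]
  simp

theorem NoDyadicAtom.rotate {ν : Measure Torus} (h : NoDyadicAtom ν) (k : ℕ) :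
    NoDyadicAtom (rotate (Real.pi / 2 ^ k) ν) := by
  intro m i
  rw [rotate_singleton]
  have h1 : ((i * Real.pi / 2 ^ m : ℝ) : Torus) - ((Real.pi / 2 ^ k : ℝ) : Torus) =
      (((i * 2 ^ k - 2 ^ m : ℤ) * Real.pi / 2 ^ (m + k) : ℝ) : Torus) := by
    rw [← AddCircle.coe_sub]
    congr 1
    push_cast
    rw [pow_add]
    field_simp
  rw [h1]
  exact h _ _

theorem countable_atoms (ν : Measure Torus) [IsProbabilityMeasure ν] :
    {x | ν {x} ≠ 0}.Countable := by
  have := Measure.countable_meas_pos_of_disjoint_iUnion (μ := ν) (As := fun x : Torus => {x})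
    (fun x => measurableSet_singleton x) fun x y hxy => by
      simpa [Function.onFun] using hxy
  simpa [pos_iff_ne_zero] using this

/-- Atoms and dyadic multiples of `π` are countable, hence so are the angles that bring one onto the
other. -/
theorem exists_noDyadicAtom_rotate (ν : Measure Torus) [IsProbabilityMeasure ν] :
    ∃ θ ∈ Icc (0 : ℝ) (2 * Real.pi), NoDyadicAtom (rotate θ ν) := by
  set G : Set Torus := range fun p : ℕ × ℤ => ((p.2 * Real.pi / 2 ^ p.1 : ℝ) : Torus)
  have hS : (image2 (fun g a => g - a) G {x | ν {x} ≠ 0}).Countable :=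
    (countable_range _).image2 (countable_atoms ν) _
  have hbad : (Ico (0 : ℝ) (2 * Real.pi) ∩ {θ : ℝ | (θ : Torus) ∈
      image2 (fun g a => g - a) G {x | ν {x} ≠ 0}}).Countable := by
    refine MapsTo.countable_of_injOn (f := fun θ : ℝ => (θ : Torus)) (fun θ hθ => hθ.2) ?_ hS
    intro a ha b hb hab
    rw [← angle_coe ha.1, ← angle_coe hb.1]
    exact congrArg angle hab
  obtain ⟨θ, hθ, hgood⟩ : ∃ θ ∈ Ico (0 : ℝ) (2 * Real.pi), (θ : Torus) ∉
      image2 (fun g a => g - a) G {x | ν {x} ≠ 0} := by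
    by_contra! hcon
    replace hbad : (Ico (0 : ℝ) (2 * Real.pi)).Countable :=
      hbad.mono (subset_inter Subset.rfl hcon)
    have := hbad.measure_zero volume
    simp at this
    linarith [Real.pi_pos]
  refine ⟨θ, Ico_subset_Icc_self hθ, fun m i => ?_⟩
  rw [rotate_singleton]
  by_contra hne
  exact hgood ⟨_, ⟨(m, i), rfl⟩, _, hne, by simp⟩

/-- The bound on `a + 3 * c` keeps both arcs inside `[0, 2π)`, so that no wrap-around occurs. -/
theorem measureReal_arc_add_two {ν : Measure Torus} {c : ℝ} (h : rotate (2 * c) ν = ν) {a : ℝ}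
    (ha : 0 ≤ a) (hc : 0 ≤ c) (hac : a + 3 * c ≤ 2 * Real.pi) :
    ν.real (angle ⁻¹' Ico (a + 2 * c) (a + 3 * c)) = ν.real (angle ⁻¹' Ico a (a + c)) := by
  conv_lhs => rw [← h, rotate, map_measureReal_apply (measurable_rotate _)
    (measurable_angle measurableSet_Ico)]
  congr 1
  ext x
  simp only [mem_preimage]
  constructor
  · intro hx
    have h1 : x = ((angle (x + ((2 * c : ℝ) : Torus)) - 2 * c : ℝ) : Torus) := by
      rw [AddCircle.coe_sub, coe_angle, add_sub_cancel_right]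
    rw [h1, angle_coe ⟨by linarith [hx.1], by linarith [hx.2]⟩]
    exact ⟨by linarith [hx.1], by linarith [hx.2]⟩
  · intro hx
    have h1 : x + ((2 * c : ℝ) : Torus) = ((angle x + 2 * c : ℝ) : Torus) := by
      rw [AddCircle.coe_add, coe_angle]
    rw [h1, angle_coe ⟨by linarith [hx.1], by linarith [hx.2]⟩]
    exact ⟨by linarith [hx.1], by linarith [hx.2]⟩

/-- The reflection exchanges open and closed ends of arcs, so the endpoints must be null. -/
theorem measureReal_arc_reflect {ν : Measure Torus} [IsProbabilityMeasure ν]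
    (h : reflect ν = ν) {c : ℝ}
    (h0 : ν {((0 : ℝ) : Torus)} = 0) (h1 : ν {(c : Torus)} = 0) :
    ν.real (angle ⁻¹' Ico (2 * Real.pi - c) (2 * Real.pi)) = ν.real (angle ⁻¹' Ico 0 c) := by
  conv_lhs => rw [← h, reflect, map_measureReal_apply measurable_reflect
    (measurable_angle measurableSet_Ico)]
  refine measureReal_congr ?_
  have hae : ∀ᵐ x ∂ν, x ≠ ((0 : ℝ) : Torus) ∧ x ≠ (c : Torus) :=
    (measure_eq_zero_iff_ae_notMem.1 h0).and (measure_eq_zero_iff_ae_notMem.1 h1)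
  filter_upwards [hae] with x hx
  have hx0 : angle x ≠ 0 := fun h => hx.1 (by rw [← h, coe_angle])
  have hxc : angle x ≠ c := fun h => hx.2 (by rw [← h, coe_angle])
  have hm := angle_mem x
  have h2 : ((2 * Real.pi : ℝ) : Torus) - x = ((2 * Real.pi - angle x : ℝ) : Torus) := by
    rw [AddCircle.coe_sub, coe_angle]
  have h3 : angle (((2 * Real.pi : ℝ) : Torus) - x) = 2 * Real.pi - angle x := by
    rw [h2, angle_coe ⟨by linarith [hm.2], by linarith [lt_of_le_of_ne hm.1 hx0.symm]⟩]
  refine propext ?_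
  change angle (((2 * Real.pi : ℝ) : Torus) - x) ∈ Ico (2 * Real.pi - c) (2 * Real.pi) ↔
    angle x ∈ Ico 0 c
  rw [h3]
  constructor
  · rintro ⟨h4, h5⟩
    exact ⟨hm.1, lt_of_le_of_ne (by linarith) hxc⟩
  · rintro ⟨h4, h5⟩
    exact ⟨by linarith, by linarith [lt_of_le_of_ne hm.1 hx0.symm]⟩

/-- The distribution function of a measure with dihedral symmetry takes its mean values at the
multiples of half the angle of the rotational symmetry. -/
theorem cdf_of_dihedral {ν : Measure Torus} [IsProbabilityMeasure ν] {N : ℕ} (hN : 0 < N)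
    (hrefl : reflect ν = ν) (hrot : rotate (2 * Real.pi / N) ν = ν)
    (hatom : ∀ i : ℕ, ν {((Real.pi * i / N : ℝ) : Torus)} = 0) {j : ℕ}
    (hjN : j ≤ 2 * N) : cdf ν (Real.pi * j / N) = j / (2 * N) := by
  have hpi := Real.pi_pos
  have hN' : (0 : ℝ) < N := by exact_mod_cast hN
  set c : ℝ := Real.pi / N with hc
  have hc0 : 0 < c := by positivity
  have hNc : N * c = Real.pi := by rw [hc]; field_simp
  have hcoe : ∀ i : ℕ, Real.pi * i / N = i * c := fun i => by rw [hc]; ring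
  simp only [hcoe] at hatom ⊢
  have hrot' : rotate (2 * c) ν = ν := by
    rw [hc, ← mul_div_assoc]
    exact hrot
  -- The mass of the `i`-th of `2N` equal arcs. Rotation identifies arcs of the same parity, and
  -- reflection identifies the last arc, of odd index `2N - 1`, with the first one. All arcs then
  -- have mass `1 / (2N)`.
  set m : ℕ → ℝ := fun i => ν.real (angle ⁻¹' Ico (i * c) (i * c + c)) with hm
  have hstep : ∀ i, i + 3 ≤ 2 * N → m (i + 2) = m i := by
    intro i hi
    have hi' : (i : ℝ) + 3 ≤ 2 * N := by exact_mod_cast hi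
    have := measureReal_arc_add_two hrot' (a := i * c) (by positivity) hc0.le (by
      nlinarith)
    simp only [hm]
    rw [← this]
    congr 3 <;> push_cast <;> ring
  have hpair : ∀ i, i < N → m (2 * i) = m 0 ∧ m (2 * i + 1) = m 1 := by
    intro i
    induction i with
    | zero => simp
    | succ i ih =>
      intro hi
      obtain ⟨h1, h2⟩ := ih (by omega)
      exact ⟨(hstep (2 * i) (by omega)).trans h1, (hstep (2 * i + 1) (by omega)).trans h2⟩
  have h10 : m 1 = m 0 := by
    obtain ⟨-, h1⟩ := hpair (N - 1) (by omega)
    have h2 := measureReal_arc_reflect hrefl (by simpa using hatom 0) (by simpa using hatom 1)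
    rw [← h1]
    simp only [hm]
    have e : ((2 * (N - 1) + 1 : ℕ) : ℝ) * c = 2 * Real.pi - c := by
      rw [Nat.cast_add, Nat.cast_mul, Nat.cast_sub hN]
      push_cast
      linear_combination 2 * hNc
    rw [e, sub_add_cancel, h2]
    simp
  have hall : ∀ i < 2 * N, m i = m 0 := by
    intro i hi
    rcases Nat.even_or_odd' i with ⟨r, rfl | rfl⟩
    · exact (hpair r (by omega)).1
    · rw [(hpair r (by omega)).2, h10]
  have hIio : ∀ i ≤ 2 * N, ν.real (angle ⁻¹' Iio (i * c)) = i * m 0 := by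
    intro i
    induction i with
    | zero =>
      intro _
      have : angle ⁻¹' Iio (((0 : ℕ) : ℝ) * c) = ∅ := by
        ext x
        simpa using (angle_mem x).1
      rw [this]
      simp
    | succ i ih =>
      intro hi
      have hu : angle ⁻¹' Iio (((i + 1 : ℕ) : ℝ) * c) =
          angle ⁻¹' Iio (i * c) ∪ angle ⁻¹' Ico (i * c) (i * c + c) := by
        rw [← preimage_union, Iio_union_Ico_eq_Iio (by linarith)]
        congr 2
        push_cast
        ring
      rw [hu, measureReal_union (Disjoint.preimage _ (by
          rw [Set.disjoint_left]
          intro y hy hy'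
          exact absurd hy (not_lt.2 hy'.1))) (measurable_angle measurableSet_Ico), ih (by omega),
        show ν.real (angle ⁻¹' Ico (i * c) (i * c + c)) = m i from rfl, hall i (by omega)]
      push_cast
      ring
  have hm0 : m 0 = 1 / (2 * N) := by
    have h1 := hIio (2 * N) le_rfl
    have h2 : angle ⁻¹' Iio (((2 * N : ℕ) : ℝ) * c) = univ := by
      refine eq_univ_of_forall fun x => ?_
      have := (angle_mem x).2
      rw [mem_preimage, mem_Iio]
      push_cast
      linarith
    rw [h2, probReal_univ] at h1
    push_cast at h1
    field_simp
    linarith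
  have hlast : cdf ν (j * c) = ν.real (angle ⁻¹' Iio (j * c)) := by
    rw [cdf, image_coe_Icc]
    refine measureReal_congr ?_
    filter_upwards [measure_eq_zero_iff_ae_notMem.1 (hatom j)] with x hx
    have hxc : angle x ≠ j * c := fun h => hx (by rw [mem_singleton_iff, ← h, coe_angle])
    exact propext ⟨fun h => lt_of_le_of_ne h hxc, fun h => (show angle x < j * c from h).le⟩
  rw [hlast, hIio j hjN, hm0]
  ring

theorem symmIter_mem_M0 {ν : Measure Torus} (hν : ν ∈ M0) (θ : ℕ → ℝ) (k : ℕ) :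
    symmIter ν θ k ∈ M0 := by
  induction k with
  | zero => exact hν
  | succ k ih => exact symm_rotate_mem_M0 ih _

theorem exists_hausdorffDist_region_symmIter_le {ν : Measure Torus} (hν : ν ∈ M0) :
    ∃ θ : ℕ → ℝ, (∀ j, θ j ∈ Icc (0 : ℝ) (2 * Real.pi)) ∧ ∀ k,
      Metric.hausdorffDist (region (symmIter ν θ k)) unitPerimeterDisc ≤
        (1 / 2 : ℝ) ^ k * Real.pi := by
  have hP : IsProbabilityMeasure ν := hν.1
  have hpi := Real.pi_pos
  obtain ⟨θ₁, hθ₁, hatom⟩ := exists_noDyadicAtom_rotate ν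
  -- Only the first angle depends on `ν`. The value at `0` is never used by `symmIter`.
  set θ : ℕ → ℝ := fun j => if j = 1 then θ₁ else Real.pi / 2 ^ (j - 1) with hθ
  refine ⟨θ, fun j => ?_, fun k => ?_⟩
  · simp only [hθ]
    split_ifs
    · exact hθ₁
    · refine ⟨by positivity, (div_le_self hpi.le (one_le_pow₀ one_le_two)).trans (by linarith)⟩
  have hinv : ∀ k, reflect (symmIter ν θ (k + 1)) = symmIter ν θ (k + 1) ∧
      rotate (2 * Real.pi / (2 ^ k : ℕ)) (symmIter ν θ (k + 1)) = symmIter ν θ (k + 1) ∧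
      NoDyadicAtom (symmIter ν θ (k + 1)) := by
    intro k
    refine ⟨reflect_symm _, ?_⟩
    induction k with
    | zero =>
      refine ⟨by simp [rotate_two_pi], ?_⟩
      exact hatom.symm
    | succ k ih =>
      have hk : θ (k + 1 + 1) = Real.pi / 2 ^ (k + 1) := by simp [hθ]
      rw [symmIter, hk]
      refine ⟨?_, (ih.2.rotate _).symm⟩
      have := rotate_symm_rotate (ν := symmIter ν θ (k + 1)) (reflect_symm _)
        (θ := Real.pi / 2 ^ (k + 1)) (by
          convert ih.1 using 2
          push_cast
          rw [pow_succ]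
          field_simp
          norm_num)
      convert this using 2
      push_cast
      ring
  have hmem := symmIter_mem_M0 hν θ k
  have hPk : IsProbabilityMeasure (symmIter ν θ k) := hmem.1
  refine (hausdorffDist_region_le hmem (M := 2 ^ k) (by positivity) fun j hj hjk => ?_).trans
    (le_of_eq ?_)
  · cases k with
    -- Without any symmetrisation there is a single cell, and the only condition is total mass one.
    | zero =>
      have : j = 1 := by
        rw [pow_zero] at hjk
        omega
      subst this
      simp [cdf_two_pi]
    | succ k =>
      -- After `k + 1` steps there are `2^k` rotations; with the reflection they control the
      -- distribution function at `2^(k+1)` points.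
      obtain ⟨h1, h2, h3⟩ := hinv k
      have := cdf_of_dihedral (N := 2 ^ k) (j := j) (by positivity) h1 h2 (fun i => by
        have := h3 k i
        convert this using 4
        push_cast
        ring) (by rwa [pow_succ, mul_comm] at hjk)
      convert this using 2
      · push_cast
        rw [pow_succ]
        field_simp
      · push_cast
        ring
  · push_cast
    rw [one_div, inv_pow, div_eq_inv_mul]

/-! ### Isoperimetric inequality for convex polygons. -/

/-- A step function following the values of `φ`, with jumps at the points `T (i + 1)`, `i < n`. -/
def stepAngle (φ T : ℕ → ℝ) (n : ℕ) (t : ℝ) : ℝ :=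
  φ ((Finset.range n).filter fun i => T (i + 1) ≤ t).card

theorem monotone_stepAngle {φ : ℕ → ℝ} (hφ : Monotone φ) (T : ℕ → ℝ) (n : ℕ) :
    Monotone (stepAngle φ T n) := fun _ _ hst =>
  hφ (Finset.card_le_card fun i hi => by
    rw [Finset.mem_filter] at hi ⊢
    exact ⟨hi.1, hi.2.trans hst⟩)

theorem stepAngle_eq (φ : ℕ → ℝ) {T : ℕ → ℝ} (hT : StrictMono T) {n j : ℕ} (hj : j < n) {t : ℝ}
    (ht : t ∈ Ico (T j) (T (j + 1))) : stepAngle φ T n t = φ j := by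
  have : ((Finset.range n).filter fun i => T (i + 1) ≤ t) = Finset.range j := by
    ext i
    rw [Finset.mem_filter, Finset.mem_range, Finset.mem_range]
    constructor
    · rintro ⟨-, h⟩
      by_contra! hij
      exact absurd (h.trans_lt ht.2) (not_lt.2 (hT.monotone (by omega)))
    · intro h
      exact ⟨h.trans hj, (hT.monotone h).trans ht.1⟩
  rw [stepAngle, this, Finset.card_range]

theorem stepAngle_le {φ : ℕ → ℝ} (hφ : Monotone φ) (T : ℕ → ℝ) (n : ℕ) (t : ℝ) :
    stepAngle φ T n t ≤ φ n :=
  hφ ((Finset.card_filter_le _ _).trans (Finset.card_range n).le)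

theorem volume_image_add_mul (z : ℂ) (L : ℝ) (S : Set ℂ) :
    volume ((fun x => z + L * x) '' S) = ENNReal.ofReal (L ^ 2) * volume S := by
  have h : (fun x : ℂ => z + L * x) '' S = (fun x => z + x) '' (L • S) := by
    rw [← image_smul, image_image]
    simp only [Complex.real_smul]
  rw [h, image_add_left, measure_preimage_add, Measure.addHaar_smul, Complex.finrank_real_complex,
    abs_of_nonneg (sq_nonneg L)]

/-- The isoperimetric inequality for a polygon whose edges turn counterclockwise, once around. -/
theorem volume_convexHull_polygon_le {n : ℕ} {z : ℕ → ℂ} (hz : Function.Periodic z n)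
    (hn : 0 < n) {φ : ℕ → ℝ} (hφ : Monotone φ) (hφn : φ n ≤ φ 0 + 2 * Real.pi)
    (hne : ∀ j, z (j + 1) ≠ z j)
    (hedge : ∀ j, z (j + 1) - z j = dist (z j) (z (j + 1)) * Complex.exp (φ j * Complex.I)) :
    volume (convexHull ℝ (range z)) ≤ ENNReal.ofReal
      ((∑ j ∈ Finset.range n, dist (z j) (z (j + 1))) ^ 2) * ENNReal.ofReal (1 / (4 * Real.pi)) := by
  set l : ℕ → ℝ := fun j => dist (z j) (z (j + 1)) with hl
  have hlpos : ∀ j, 0 < l j := fun j => dist_pos.2 (hne j).symm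
  set L : ℝ := ∑ j ∈ Finset.range n, l j with hL
  have hLpos : 0 < L := Finset.sum_pos (fun j _ => hlpos j) ⟨0, Finset.mem_range.2 hn⟩
  -- Arc length of the vertices, rescaled to total length one. The curve with tangent angle `φ j` on
  -- `[T j, T (j + 1))` then passes through the rescaled vertices.
  set T : ℕ → ℝ := fun j => (∑ i ∈ Finset.range j, l i) / L with hT
  have hTsucc : ∀ j, T (j + 1) = T j + l j / L := fun j => by
    simp only [hT, Finset.sum_range_succ, add_div]
  have hTm : StrictMono T := strictMono_nat_of_lt_succ fun j => by
    rw [hTsucc]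
    linarith [div_pos (hlpos j) hLpos]
  have hT0 : T 0 = 0 := by simp [hT]
  have hTn : T n = 1 := div_self hLpos.ne'
  have hTmem : ∀ j ≤ n, T j ∈ Icc (0 : ℝ) 1 := fun j hj =>
    ⟨hT0 ▸ hTm.monotone (Nat.zero_le j), hTn ▸ hTm.monotone hj⟩
  set q := stepAngle φ T n with hq
  have hqm : Monotone q := monotone_stepAngle hφ T n
  have hint : ∀ j ≤ n, path q (T j) = (z j - z 0) / L := by
    intro j
    induction j with
    | zero => intro _; simp [hT0, path]
    | succ j ih =>
      intro hj
      have h1 := path_sub_of_eq hqm (hTm (Nat.lt_succ_self j)).le (φ := φ j) fun u hu =>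
        stepAngle_eq φ hTm (n := n) hj ⟨hu.1.le, hu.2⟩
      rw [ih (by omega), hTsucc, add_sub_cancel_left] at h1
      rw [hTsucc, sub_eq_iff_eq_add.1 h1]
      have h2 := hedge j
      have hL' : (L : ℂ) ≠ 0 := by exact_mod_cast hLpos.ne'
      push_cast
      field_simp
      linear_combination -h2
  have hclosed : path q 1 = 0 := by
    have := hint n le_rfl
    rw [hTn, ← zero_add n, hz 0, sub_self, zero_div] at this
    exact this
  have hturn : IsTurning (turnExtend q) :=
    isTurning_turnExtend (hqm.monotoneOn _) (fun s _ t _ =>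
      (stepAngle_le hφ T n t).trans (hφn.trans (by
        have : φ 0 ≤ q s := hφ (Nat.zero_le _)
        linarith))) hclosed
  have hpath : ∀ j ≤ n, path (turnExtend q) (T j) = (z j - z 0) / L := fun j hj => by
    rw [← hint j hj]
    exact integral_turnExtend (fun x => Complex.exp ((x : ℂ) * Complex.I)) (hTmem j hj)
  have hsub : convexHull ℝ (range z) ⊆ (fun x => z 0 + L * x) '' body (turnExtend q) := by
    have himg : (fun x : ℂ => z 0 + L * x) '' body (turnExtend q) =
        (fun x => z 0 + x) '' (L • body (turnExtend q)) := by
      rw [← image_smul, image_image]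
      simp only [Complex.real_smul]
    refine convexHull_min ?_ (by
      rw [himg]
      exact (IsTurning.convex_body.smul L).translate (z 0))
    rintro _ ⟨j, rfl⟩
    refine ⟨_, IsTurning.path_mem_body (T (j % n)), ?_⟩
    simp only
    rw [hpath _ (Nat.mod_lt j hn).le, ← hz.map_mod_nat j]
    have hL' : (L : ℂ) ≠ 0 := by exact_mod_cast hLpos.ne'
    field_simp
    ring
  refine (measure_mono hsub).trans ?_
  rw [volume_image_add_mul]
  gcongr
  exact hturn.volume_body_le

/-! ### Isoperimetric inequality for convex bodies, by inscribed polygons. -/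

/-- The point of the boundary of `K` in the direction `θ`, as seen from the origin. -/
def radial (K : Set ℂ) (θ : ℝ) : ℂ :=
  ((gauge K (Complex.exp (θ * Complex.I)))⁻¹ : ℝ) * Complex.exp (θ * Complex.I)

section Radial

variable {K : Set ℂ} (hK : Convex ℝ K) (hc : IsCompact K) (h0 : 0 ∈ interior K)

include hc h0 in
theorem gauge_pos_of_ne_zero {x : ℂ} (hx : x ≠ 0) : 0 < gauge K x :=
  (gauge_pos (absorbent_nhds_zero (mem_interior_iff_mem_nhds.1 h0))
    ((NormedSpace.isVonNBounded_iff ℝ).2 hc.isBounded)).2 hx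

include hc h0 in
theorem gauge_exp_pos (θ : ℝ) : 0 < gauge K (Complex.exp (θ * Complex.I)) :=
  gauge_pos_of_ne_zero hc h0 (Complex.exp_ne_zero _)

theorem radial_add_two_pi (K : Set ℂ) (θ : ℝ) : radial K (θ + 2 * Real.pi) = radial K θ := by
  have : Complex.exp (((θ + 2 * Real.pi : ℝ) : ℂ) * Complex.I) = Complex.exp (θ * Complex.I) := by
    rw [← Complex.exp_periodic (θ * Complex.I)]
    congr 1
    push_cast
    ring
  rw [radial, radial, this]

include hK hc h0 in
theorem continuous_radial : Continuous (radial K) := by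
  have h1 : Continuous fun θ : ℝ => Complex.exp (θ * Complex.I) := by fun_prop
  have h2 : Continuous fun θ : ℝ => gauge K (Complex.exp (θ * Complex.I)) :=
    (continuous_gauge hK (mem_interior_iff_mem_nhds.1 h0)).comp h1
  exact (Complex.continuous_ofReal.comp
    (h2.inv₀ fun θ => (gauge_exp_pos hc h0 θ).ne')).mul h1

include hK hc h0 in
theorem radial_mem_frontier (θ : ℝ) : radial K θ ∈ frontier K := by
  refine (gauge_eq_one_iff_mem_frontier hK (mem_interior_iff_mem_nhds.1 h0)).1 ?_
  have hg := gauge_exp_pos hc h0 θ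
  rw [radial, ← Complex.real_smul, gauge_smul_of_nonneg (inv_nonneg.2 hg.le), smul_eq_mul]
  exact inv_mul_cancel₀ hg.ne'

include hc h0 in
theorem injOn_radial : InjOn (radial K) (Ico 0 (2 * Real.pi)) := by
  intro a ha b hb hab
  have hga := inv_pos.2 (gauge_exp_pos hc h0 a)
  have hgb := inv_pos.2 (gauge_exp_pos hc h0 b)
  have hn := congrArg norm hab
  simp only [radial, norm_mul, Complex.norm_exp_ofReal_mul_I, mul_one, Complex.norm_real,
    Real.norm_of_nonneg hga.le, Real.norm_of_nonneg hgb.le] at hn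
  rw [radial, radial, hn] at hab
  have hexp := mul_left_cancel₀ (by exact_mod_cast hgb.ne') hab
  have h1 : ((a : Torus) : Torus) = b := by
    apply AddCircle.injective_toCircle Real.two_pi_pos.ne'
    apply Subtype.ext
    rw [toCircle_coe, toCircle_coe, hexp]
  rw [← angle_coe ha, ← angle_coe hb, h1]

include hc h0 in
theorem exists_mem_segment_radial {x : ℂ} (hx : x ∈ K) :
    ∃ θ ≥ 0, x ∈ segment ℝ 0 (radial K θ) := by
  by_cases hx0 : x = 0
  · exact ⟨0, le_rfl, hx0 ▸ left_mem_segment ℝ _ _⟩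
  have hθ : (0 : ℝ) ≤ x.arg + 2 * Real.pi := by
    linarith [Complex.neg_pi_lt_arg x, Real.pi_pos]
  refine ⟨x.arg + 2 * Real.pi, hθ, ?_⟩
  rw [radial_add_two_pi, segment_eq_image']
  refine ⟨gauge K x, ⟨gauge_nonneg x, gauge_le_one_of_mem hx⟩, ?_⟩
  have h1 := Complex.norm_mul_exp_arg_mul_I x
  have h2 : gauge K x = ‖x‖ * gauge K (Complex.exp (x.arg * Complex.I)) := by
    conv_lhs => rw [← h1, ← Complex.real_smul, gauge_smul_of_nonneg (norm_nonneg x), smul_eq_mul]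
  have hg : (gauge K (Complex.exp (x.arg * Complex.I)) : ℂ) ≠ 0 := by
    exact_mod_cast (gauge_exp_pos hc h0 x.arg).ne'
  simp only [sub_zero, zero_add, Complex.real_smul, h2, radial]
  push_cast
  conv_rhs => rw [← h1]
  field_simp

include hK h0 in
/-- Convexity, expressed for three boundary points at equally spaced directions. -/
theorem two_mul_cos_le (θ : ℝ) {δ a b c : ℝ} (ha : 0 < a) (hb : 0 < b) (hc' : 0 < c)
    (h1 : (a : ℂ) * Complex.exp ((θ : ℂ) * Complex.I) ∈ K)
    (h2 : (b : ℂ) * Complex.exp (((θ + δ : ℝ) : ℂ) * Complex.I) ∈ frontier K)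
    (h3 : (c : ℂ) * Complex.exp (((θ + 2 * δ : ℝ) : ℂ) * Complex.I) ∈ K) :
    2 * a * c * Real.cos δ ≤ b * (a + c) := by
  by_contra! hlt
  have hac : 0 < a + c := by positivity
  -- The radius at which the chord between the outer points meets the middle direction. If `b < t`,
  -- the middle point lies strictly between the interior point `0` and a point of `K`, so it is
  -- interior.
  set t := 2 * a * c * Real.cos δ / (a + c) with ht
  have hbt : b < t := by rwa [ht, lt_div_iff₀ hac]
  have hmem : (t : ℂ) * Complex.exp (((θ + δ : ℝ) : ℂ) * Complex.I) ∈ K := by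
    have := hK h1 h3 (a := c / (a + c)) (b := a / (a + c)) (by positivity) (by positivity)
      (by field_simp; ring)
    convert this using 1
    have e1 : Complex.exp ((θ : ℂ) * Complex.I) = Complex.exp (((θ + δ : ℝ) : ℂ) * Complex.I) *
        Complex.exp (-(δ * Complex.I)) := by
      rw [← Complex.exp_add]
      congr 1
      push_cast
      ring
    have e2 : Complex.exp (((θ + 2 * δ : ℝ) : ℂ) * Complex.I) =
        Complex.exp (((θ + δ : ℝ) : ℂ) * Complex.I) * Complex.exp (δ * Complex.I) := by
      rw [← Complex.exp_add]
      congr 1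
      push_cast
      ring
    have e3 : (2 : ℂ) * ((Real.cos δ : ℝ) : ℂ) =
        Complex.exp (δ * Complex.I) + Complex.exp (-(δ * Complex.I)) := by
      rw [Complex.ofReal_cos, Complex.cos, neg_mul]
      ring
    have hac' : (a + c : ℂ) ≠ 0 := by exact_mod_cast hac.ne'
    rw [e1, e2, ht, Complex.real_smul, Complex.real_smul]
    push_cast
    rw [← Complex.ofReal_cos]
    field_simp
    linear_combination (a * c : ℂ) * e3
  refine h2.2 ?_
  have := hK.add_smul_sub_mem_interior hmem h0 (t := 1 - b / t)
    ⟨sub_pos.2 ((div_lt_one (hb.trans hbt)).2 hbt),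
      sub_le_self _ (div_nonneg hb.le (hb.trans hbt).le)⟩
  convert this using 1
  have ht0 : (t : ℂ) ≠ 0 := by exact_mod_cast (hb.trans hbt).ne'
  rw [Complex.real_smul]
  push_cast
  field_simp
  ring

include hK hc h0 in
theorem volume_convexHull_radial_le {n : ℕ} (hn : 2 < n) :
    volume (convexHull ℝ (range fun j : ℕ => radial K (2 * Real.pi * (j / n)))) ≤
      ENNReal.ofReal ((∑ j ∈ Finset.range n, dist (radial K (2 * Real.pi * (j / n)))
        (radial K (2 * Real.pi * ((j + 1 : ℕ) / n)))) ^ 2) * ENNReal.ofReal (1 / (4 * Real.pi)) := by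
  have hpi := Real.pi_pos
  have hn0 : (0 : ℝ) < n := by exact_mod_cast (by omega : 0 < n)
  set δ : ℝ := 2 * Real.pi / n with hδ
  have hδ0 : 0 < δ := by positivity
  have hδpi : δ < Real.pi := by
    rw [hδ, div_lt_iff₀ hn0]
    have : (2 : ℝ) < n := by exact_mod_cast hn
    nlinarith
  have hsin : 0 < Real.sin δ := Real.sin_pos_of_pos_of_lt_pi hδ0 hδpi
  set θ : ℕ → ℝ := fun j => 2 * Real.pi * (j / n) with hθ
  have hθs : ∀ j, θ (j + 1) = θ j + δ := fun j => by
    simp only [hθ, hδ]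
    push_cast
    ring
  have hθn : ∀ j, θ (j + n) = θ j + 2 * Real.pi := fun j => by
    simp only [hθ]
    push_cast
    field_simp
  set z : ℕ → ℂ := fun j => radial K (θ j) with hz
  set ρ : ℕ → ℝ := fun j => (gauge K (Complex.exp (θ j * Complex.I)))⁻¹ with hρ
  have hρ0 : ∀ j, 0 < ρ j := fun j => inv_pos.2 (gauge_exp_pos hc h0 _)
  have hzρ : ∀ j, z j = ρ j * Complex.exp (θ j * Complex.I) := fun j => rfl
  have hzper : Function.Periodic z n := fun j => by
    simp only [hz, hθn, radial_add_two_pi]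
  have hrot : ∀ j, Complex.exp (θ (j + 1) * Complex.I) =
      Complex.exp (θ j * Complex.I) * Complex.exp (δ * Complex.I) := fun j => by
    rw [hθs, ← Complex.exp_add]
    congr 1
    push_cast
    ring
  -- The edge seen in the frame rotated by `θ j`. Its imaginary part is positive because `0 < δ <
  -- π`, so its argument is in `(0, π)` and no branch cut is met.
  set v : ℕ → ℂ := fun j => ρ (j + 1) * Complex.exp (δ * Complex.I) - ρ j with hv
  have hvim : ∀ j, (v j).im = ρ (j + 1) * Real.sin δ := fun j => by
    simp only [hv, Complex.sub_im, Complex.im_ofReal_mul, Complex.exp_ofReal_mul_I_im,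
      Complex.ofReal_im, sub_zero]
  have hvim0 : ∀ j, 0 < (v j).im := fun j => by
    rw [hvim]
    exact mul_pos (hρ0 _) hsin
  have hedge : ∀ j, z (j + 1) - z j = Complex.exp (θ j * Complex.I) * v j := fun j => by
    simp only [hzρ, hrot, hv]
    ring
  have harg : ∀ j, (v j).arg ∈ Ioo 0 Real.pi := fun j => by
    refine ⟨lt_of_le_of_ne (Complex.arg_nonneg_iff.2 (hvim0 j).le) fun h => ?_,
      lt_of_le_of_ne (Complex.arg_le_pi _) fun h => ?_⟩
    · have := (Complex.arg_eq_zero_iff.1 h.symm).2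
      exact (hvim0 j).ne' this
    · have := (Complex.arg_eq_pi_iff.1 h).2
      exact (hvim0 j).ne' this
  have hvne : ∀ j, v j ≠ 0 := fun j h => by
    have := hvim0 j
    rw [h] at this
    exact lt_irrefl _ this
  have hdist : ∀ j, dist (z j) (z (j + 1)) = ‖v j‖ := fun j => by
    rw [dist_comm, dist_eq_norm, hedge, norm_mul, Complex.norm_exp_ofReal_mul_I, one_mul]
  set φ : ℕ → ℝ := fun j => θ j + (v j).arg with hφ
  have hvn : v n = v 0 := by
    have h1 : ∀ j, ρ (j + n) = ρ j := fun j => by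
      have : Complex.exp ((θ (j + n) : ℂ) * Complex.I) = Complex.exp (θ j * Complex.I) := by
        rw [hθn, ← Complex.exp_periodic (θ j * Complex.I)]
        congr 1
        push_cast
        ring
      simp only [hρ, this]
    have h2 := h1 0
    have h3 := h1 1
    rw [zero_add] at h2
    rw [add_comm] at h3
    simp only [hv, h2, h3, zero_add]
  have hmono : Monotone φ := by
    refine monotone_nat_of_le_succ fun j => ?_
    by_contra! hlt
    have hcos : 2 * ρ j * ρ (j + 2) * Real.cos δ ≤ ρ (j + 1) * (ρ j + ρ (j + 2)) := by
      refine two_mul_cos_le hK h0 (θ j) (hρ0 j) (hρ0 (j + 1)) (hρ0 (j + 2)) ?_ ?_ ?_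
      · exact hc.isClosed.frontier_subset (radial_mem_frontier hK hc h0 (θ j))
      · rw [← hθs]
        exact radial_mem_frontier hK hc h0 (θ (j + 1))
      · have : θ j + 2 * δ = θ (j + 2) := by
          rw [hθs (j + 1), hθs j]
          ring
        rw [this]
        exact hc.isClosed.frontier_subset (radial_mem_frontier hK hc h0 (θ (j + 2)))
    have hD : φ (j + 1) - φ j = δ + (v (j + 1)).arg - (v j).arg := by
      simp only [hφ, hθs]
      ring
    -- Consecutive edge angles differ by more than `-π`, so a decrease would make this sine
    -- negative. Up to positive factors it is the cross product of consecutive edges, which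
    -- `two_mul_cos_le` shows to be nonnegative.
    have hs : Real.sin (φ (j + 1) - φ j) < 0 :=
      Real.sin_neg_of_neg_of_neg_pi_lt (by linarith) (by
        rw [hD]
        linarith [(harg (j + 1)).1, (harg j).2])
    have h1 : ∀ i, ‖v i‖ * Real.cos (v i).arg = ρ (i + 1) * Real.cos δ - ρ i := fun i => by
      rw [Complex.norm_mul_cos_arg]
      simp only [hv, Complex.sub_re, Complex.re_ofReal_mul, Complex.exp_ofReal_mul_I_re,
        Complex.ofReal_re]
    have h2 : ∀ i, ‖v i‖ * Real.sin (v i).arg = ρ (i + 1) * Real.sin δ := fun i => by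
      rw [Complex.norm_mul_sin_arg, hvim]
    have hcross : ‖v j‖ * ‖v (j + 1)‖ * Real.sin (φ (j + 1) - φ j) =
        Real.sin δ * (ρ (j + 1) * (ρ j + ρ (j + 2)) - 2 * ρ j * ρ (j + 2) * Real.cos δ) := by
      rw [hD, Real.sin_sub, Real.sin_add, Real.cos_add]
      have e1 := h1 j
      have e2 := h2 j
      have e3 := h1 (j + 1)
      have e4 := h2 (j + 1)
      have hcs := Real.sin_sq_add_cos_sq δ
      calc _ = Real.sin δ * ((‖v (j + 1)‖ * Real.cos (v (j + 1)).arg) *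
              (‖v j‖ * Real.cos (v j).arg)) + Real.cos δ * ((‖v (j + 1)‖ *
              Real.sin (v (j + 1)).arg) * (‖v j‖ * Real.cos (v j).arg)) -
              Real.cos δ * ((‖v (j + 1)‖ * Real.cos (v (j + 1)).arg) *
              (‖v j‖ * Real.sin (v j).arg)) + Real.sin δ * ((‖v (j + 1)‖ *
              Real.sin (v (j + 1)).arg) * (‖v j‖ * Real.sin (v j).arg)) := by ring
        _ = _ := by
          rw [e1, e2, e3, e4]
          linear_combination (Real.sin δ * ρ (j + 1) * ρ (j + 2)) * hcs
    have hneg : ‖v j‖ * ‖v (j + 1)‖ * Real.sin (φ (j + 1) - φ j) < 0 :=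
      mul_neg_of_pos_of_neg (mul_pos (norm_pos_iff.2 (hvne j)) (norm_pos_iff.2 (hvne (j + 1)))) hs
    rw [hcross] at hneg
    exact absurd hneg (not_lt.2 (mul_nonneg hsin.le (sub_nonneg.2 hcos)))
  refine volume_convexHull_polygon_le hzper (by omega) hmono (le_of_eq ?_) (fun j h => ?_)
    fun j => ?_
  · have := hθn 0
    rw [zero_add] at this
    simp only [hφ, hvn, this]
    ring
  · have h1 := hedge j
    rw [h, sub_self, eq_comm] at h1
    exact (mul_ne_zero (Complex.exp_ne_zero _) (hvne j)) h1
  · rw [hdist, hedge]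
    conv_lhs => rw [← Complex.norm_mul_exp_arg_mul_I (v j)]
    have : Complex.exp ((φ j : ℂ) * Complex.I) =
        Complex.exp (θ j * Complex.I) * Complex.exp ((v j).arg * Complex.I) := by
      rw [← Complex.exp_add]
      congr 1
      simp only [hφ]
      push_cast
      ring
    rw [this]
    ring

include hK hc h0 in
/-- The isoperimetric inequality for a convex body with the origin in its interior. -/
theorem volume_le_of_hausdorffMeasure_frontier_le_one (hper : μH[1] (frontier K) ≤ 1) :
    volume K ≤ ENNReal.ofReal (1 / (4 * Real.pi)) := by
  have hpi := Real.pi_pos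
  -- Doubling the number of directions makes the polygons increase, so their volumes pass to the
  -- union; the exponent `m + 2` ensures more than two vertices.
  set P : ℕ → Set ℂ := fun m =>
    convexHull ℝ (range fun j : ℕ => radial K (2 * Real.pi * (j / (2 ^ (m + 2) : ℕ)))) with hP
  have hPvol : ∀ m, volume (P m) ≤ ENNReal.ofReal (1 / (4 * Real.pi)) := by
    intro m
    have hn : 2 < 2 ^ (m + 2) := by
      have : 1 ≤ 2 ^ m := Nat.one_le_two_pow
      rw [pow_add]
      omega
    set n := 2 ^ (m + 2) with hnn
    have hn0 : (0 : ℝ) < n := by exact_mod_cast (by omega : 0 < n)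
    refine (volume_convexHull_radial_le hK hc h0 hn).trans ?_
    have ht : StrictMono fun j : ℕ => 2 * Real.pi * ((j : ℝ) / n) := fun i j hij => by
      have : (i : ℝ) < j := by exact_mod_cast hij
      have := div_lt_div_of_pos_right this hn0
      exact mul_lt_mul_of_pos_left this Real.two_pi_pos
    have h1 : 2 * Real.pi * (((0 : ℕ) : ℝ) / n) = 0 := by simp
    have h2 : 2 * Real.pi * ((n : ℝ) / n) = 2 * Real.pi := by
      rw [div_self hn0.ne', mul_one]
    have hsum := sum_edist_le_hausdorffMeasure_image (continuous_radial hK hc h0) ht n (by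
      rw [h1, h2]
      exact injOn_radial hc h0)
    have hle : ENNReal.ofReal (∑ j ∈ Finset.range n, dist (radial K (2 * Real.pi * (j / n)))
        (radial K (2 * Real.pi * ((j + 1 : ℕ) / n)))) ≤ 1 := by
      rw [ENNReal.ofReal_sum_of_nonneg fun _ _ => dist_nonneg]
      simp only [← edist_dist]
      refine hsum.trans ((measure_mono ?_).trans hper)
      rintro _ ⟨t, -, rfl⟩
      exact radial_mem_frontier hK hc h0 t
    rw [ENNReal.ofReal_pow (Finset.sum_nonneg fun _ _ => dist_nonneg)]
    calc _ ≤ (1 : ℝ≥0∞) ^ 2 * ENNReal.ofReal (1 / (4 * Real.pi)) := by gcongr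
      _ = _ := by rw [one_pow, one_mul]
  have hPmono : Monotone P := monotone_nat_of_le_succ fun m => by
    refine convexHull_mono ?_
    rintro _ ⟨j, rfl⟩
    refine ⟨2 * j, ?_⟩
    simp only
    congr 2
    push_cast
    rw [show m + 1 + 2 = m + 2 + 1 from rfl, pow_succ _ (m + 2)]
    field_simp
  set U : Set ℂ := ⋃ m, P m with hU
  have hUc : Convex ℝ U := hPmono.directed_le.convex_iUnion fun m => convex_convexHull ℝ _
  have hUvol : volume U ≤ ENNReal.ofReal (1 / (4 * Real.pi)) := by
    rw [hU, hPmono.measure_iUnion]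
    exact iSup_le hPvol
  -- Dyadic directions are dense and `radial K` is continuous; `⌊a n⌋ / n` gives the approximating
  -- vertices.
  have hrad : ∀ θ ≥ 0, radial K θ ∈ closure U := by
    intro θ hθ
    set a := θ / (2 * Real.pi)
    have ha : 0 ≤ a := by positivity
    have hx : Tendsto (fun m : ℕ => ((2 ^ (m + 2) : ℕ) : ℝ)) atTop atTop :=
      tendsto_natCast_atTop_atTop.comp
        ((tendsto_pow_atTop_atTop_of_one_lt one_lt_two).comp (tendsto_add_atTop_nat 2))
    have h1 := (tendsto_nat_floor_mul_div_atTop ha).comp hx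
    have h2 : Tendsto (fun m : ℕ => radial K (2 * Real.pi *
        ((⌊a * (2 ^ (m + 2) : ℕ)⌋₊ : ℝ) / (2 ^ (m + 2) : ℕ)))) atTop (𝓝 (radial K θ)) := by
      have h3 : θ = 2 * Real.pi * a := (mul_div_cancel₀ _ Real.two_pi_pos.ne').symm
      rw [h3]
      exact ((continuous_radial hK hc h0).tendsto _).comp (h1.const_mul (2 * Real.pi))
    exact mem_closure_of_tendsto h2 (Eventually.of_forall fun m =>
      mem_iUnion.2 ⟨m, subset_convexHull ℝ _ ⟨_, rfl⟩⟩)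
  -- The origin lies between the boundary points in the directions `0` and `π`.
  have h0U : (0 : ℂ) ∈ closure U := by
    have e1 : radial K 0 = ((gauge K 1)⁻¹ : ℝ) := by simp [radial]
    have e2 : radial K Real.pi = -((gauge K (-1))⁻¹ : ℝ) := by simp [radial]
    have g1 : 0 < (gauge K (1 : ℂ))⁻¹ := inv_pos.2 (gauge_pos_of_ne_zero hc h0 one_ne_zero)
    have g2 : 0 < (gauge K (-1 : ℂ))⁻¹ :=
      inv_pos.2 (gauge_pos_of_ne_zero hc h0 (neg_ne_zero.2 one_ne_zero))
    set r := (gauge K (1 : ℂ))⁻¹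
    set s := (gauge K (-1 : ℂ))⁻¹
    have := hUc.closure (hrad 0 le_rfl) (hrad Real.pi hpi.le) (a := s / (r + s))
      (b := r / (r + s)) (by positivity) (by positivity) (by field_simp; ring)
    convert this using 1
    rw [e1, e2, Complex.real_smul, Complex.real_smul]
    push_cast
    ring
  have hKU : K ⊆ closure U := by
    intro x hx
    obtain ⟨θ, hθ, hxθ⟩ := exists_mem_segment_radial hc h0 hx
    exact hUc.closure.segment_subset h0U (hrad θ hθ) hxθ
  calc volume K ≤ volume (U ∪ frontier U) := measure_mono (by
        rwa [← closure_eq_self_union_frontier])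
    _ ≤ volume U + volume (frontier U) := measure_union_le _ _
    _ = volume U := by rw [hUc.addHaar_frontier volume, add_zero]
    _ ≤ _ := hUvol

end Radial

/-- The isoperimetric inequality for compact convex sets of the plane of perimeter `1`. -/
theorem volume_le_of_perimeter_eq_one {K : Set ℂ} (hc : IsCompact K) (hK : Convex ℝ K)
    (hper : perimeter K = 1) : volume K ≤ volume unitPerimeterDisc := by
  rcases (interior K).eq_empty_or_nonempty with hi | ⟨p, hp⟩
  · have := hK.addHaar_frontier volume
    rw [hc.isClosed.frontier_eq, hi, sdiff_empty] at this
    rw [this]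
    exact zero_le
  · rw [perimeter, if_pos ⟨p, hp⟩] at hper
    set e : ℂ ≃ᵢ ℂ := IsometryEquiv.addRight (-p)
    have himg : e '' K = (fun x => x + -p) '' K := rfl
    have hvol : volume (e '' K) = volume K := by
      rw [himg, image_add_right, measure_preimage_add_right]
    rw [volume_unitPerimeterDisc, ← hvol]
    refine volume_le_of_hausdorffMeasure_frontier_le_one ?_ (hc.image e.continuous) ?_ ?_
    · rw [himg]
      have := hK.translate (-p)
      simpa only [add_comm] using this
    · have : (0 : ℂ) ∈ e '' interior K := ⟨p, hp, by simp [e]⟩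
      rwa [← e.coe_toHomeomorph, e.toHomeomorph.image_interior] at this
    · rw [← e.coe_toHomeomorph, ← e.toHomeomorph.image_frontier, e.coe_toHomeomorph,
        e.hausdorffMeasure_image, hper]

end CCS

end

theorem mainTheorem6 :
    -- 1) and 2): one symmetrisation keeps the perimeter and does not decrease the area
    (∀ ν ∈ CCS.M0, ∀ θ ∈ Set.Icc (0 : ℝ) (2 * Real.pi),
      CCS.symm (CCS.rotate θ ν) ∈ CCS.M0 ∧
      CCS.perimeter (CCS.region ν) = 1 ∧
      CCS.perimeter (CCS.region (CCS.symm (CCS.rotate θ ν))) = 1 ∧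
      MeasureTheory.volume (CCS.region ν) ≤
        MeasureTheory.volume (CCS.region (CCS.symm (CCS.rotate θ ν)))) ∧
    -- 3): convergence to the disc for well chosen directions
    (∀ ν ∈ CCS.M0, ∀ k : ℕ, ∃ θ : ℕ → ℝ,
      (∀ j ∈ Set.Icc 1 k, θ j ∈ Set.Icc (0 : ℝ) (2 * Real.pi)) ∧
      Metric.hausdorffDist (CCS.region (CCS.symmIter ν θ k)) CCS.unitPerimeterDisc ≤
        (1 / 2 : ℝ) ^ k * Real.pi) ∧
    -- 4): among all compact convex sets of perimeter 1, the disc has the largest area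
    (CCS.perimeter CCS.unitPerimeterDisc = 1 ∧
      ∀ K : Set ℂ, IsCompact K → Convex ℝ K → CCS.perimeter K = 1 →
        MeasureTheory.volume K ≤ MeasureTheory.volume CCS.unitPerimeterDisc) := by
  refine ⟨fun ν hν θ _ => ⟨CCS.symm_rotate_mem_M0 hν θ, CCS.perimeter_region hν,
    CCS.perimeter_region (CCS.symm_rotate_mem_M0 hν θ), CCS.volume_region_le hν θ⟩,
    fun ν hν k => ?_, CCS.perimeter_unitPerimeterDisc,
    fun K hc hK hper => CCS.volume_le_of_perimeter_eq_one hc hK hper⟩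
  obtain ⟨θ, hθ, h⟩ := CCS.exists_hausdorffDist_region_symmIter_le hν
  exact ⟨θ, fun j _ => hθ j, h k⟩
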